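/- Let $n\ge 3$. For $\lambda\in\mathbb R^n$ let $\sigma_j(\lambda)$ be the $j$-th elementary symmetric function and $\Gamma_k=\{\lambda\in\mathbb R^n:\sigma_j(\lambda)>0,\ 1\le j\le k\}$. Let $\Gamma\subset\mathbb R^n$ be an open convex symmetric cone with vertex at the origin, $\Gamma_n\subset\Gamma\subset\Gamma_1$, and let $F$ be a $C^2$ symmetric function on $\Gamma$, homogeneous of degree one, with $F(1,\dots,1)=1$, such that in $\Gamma$: (A1) $F>0$; (A2) $F$ is concave; (A3) $\partial F/\partial\lambda_i>0$ for all $i$; (A4) there is $\varepsilon>0$ with $\partial F/\partial\lambda_i\ge\varepsilon F/\sigma_1$ for all $i$. Let $(M^n,g)$ be a smooth Riemannian manifold, and let $B_r\subset M$ be a geodesic ball of radius $r>0$ on which geodesic normal coordinates from its centre are defined (that is, the exponential map at the centre is a diffeomorphism from the ball of radius $r$ onto $B_r$); $B_{r/2}$ is the concentric geodesic ball. Let $t\ge n-1$ be a constant, $a,b$ smooth functions and $S$ a symmetric $2$-tensor of class $C^2$ on $B_r$, and $f(x,z)$ a positive $C^2$ function on $B_r\times\mathbb R$. Let $u$ be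 a $C^4$ solution in $B_r$ of $$F(g^{-1}V)=f(x,u),\qquad V=\frac{t-1}{n-2}(\Delta u)\,g-\nabla^2u-a\,du\otimes du-b\,|\nabla u|^2g+S,$$ where $F(g^{-1}V)$ is $F$ evaluated at the eigenvalues of $g^{-1}V$, and these eigenvalues lie in $\Gamma$ at every point of $B_r$. Suppose that $|\nabla_xf|\le\Lambda f$ and $|f_z|\le\Lambda f$ at $(x,u(x))$, $x\in B_r$, for a constant $\Lambda>0$. Put $$c_{\sup}(r)=\sup_{x\in B_r}\big(f+|\nabla_xf|+|f_z|+|\nabla_x^2f|+|\nabla_xf_z|+|f_{zz}|\big)(x,u(x)).$$ Norms of $a,b,S,g$ on $B_r$ are taken in the geodesic normal coordinates. Case (a). If $\Gamma\subset\Gamma_2$ and, on $B_r$, $\frac{t-1}{n-2}a+b\ge\delta_1>0$ and $\min\{2ab+b^2,\,b^2\}\ge\delta_2>0$, then $$\sup_{B_{r/2}}\big(|\nabla^2u|+|\nabla u|^2\big)\le C,$$ where $C$ depends only on $r,n,t,\Lambda,\delta_1,\delta_2$ and on upper bounds for $\|a\|_{C^2(B_r)},\|b\|_{C^2(B_r)},\|S\|_{C^2(B_r)},\|g\|_{C^3(B_r)},\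 \sup_{B_r}|g^{ij}|$ and $c_{\sup}(r)$. Case (b). If, on $B_r$, $a+nb\ge\delta_3>0$ and $a\ge0$, then $$\sup_{B_{r/2}}\big(|\nabla^2u|+|\nabla u|^2\big)\le C,$$ where $C$ depends only on $r,n,t,\Lambda,\delta_3$ and on upper bounds for $\|a\|_{C^2(B_r)},\|b\|_{C^2(B_r)},\|S\|_{C^2(B_r)},\|g\|_{C^3(B_r)},\ \sup_{B_r}|g^{ij}|$ and $c_{\sup}(r)$. -/

import Mathlib

open scoped Manifold ContDiff

noncomputable section

namespace InteriorEstimate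

/-! ### Symmetric functions and the structure conditions -/

/-- The `k`-th elementary symmetric function of `(lam 0, …, lam (n-1))`. -/
def sigma {n : ℕ} (k : ℕ) (lam : Fin n → ℝ) : ℝ :=
  ∑ s ∈ Finset.powersetCard k (Finset.univ : Finset (Fin n)), ∏ i ∈ s, lam i

/-- The Garding cone `Γ_k = {lam | sigma_j lam > 0 for 1 ≤ j ≤ k}`. -/
def gammaCone (n k : ℕ) : Set (Fin n → ℝ) :=
  {lam | ∀ j, 1 ≤ j → j ≤ k → 0 < sigma j lam}

/-- The partial derivative of `F` in the direction of the `i`-th eigenvalue. -/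
def partialF {n : ℕ} (F : (Fin n → ℝ) → ℝ) (i : Fin n) (lam : Fin n → ℝ) : ℝ :=
  fderiv ℝ F lam (Pi.single i 1)

/-- `Γ` is an open convex symmetric cone with vertex at the origin, `Γ_n ⊆ Γ ⊆ Γ_1`, and `F` is a
`C²` symmetric function on `Γ`, homogeneous of degree one, normalized by `F (1, …, 1) = 1`, which
is positive, concave, monotone and satisfies `∂F/∂lam_i ≥ ε F / sigma_1` for some `ε > 0`. -/
structure StructureConditions {n : ℕ} (Γ : Set (Fin n → ℝ)) (F : (Fin n → ℝ) → ℝ) : Prop where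
  isOpen : IsOpen Γ
  convex : Convex ℝ Γ
  cone : ∀ c : ℝ, 0 < c → ∀ lam ∈ Γ, c • lam ∈ Γ
  symm : ∀ p : Equiv.Perm (Fin n), ∀ lam ∈ Γ, lam ∘ p ∈ Γ
  gamma_n_subset : gammaCone n n ⊆ Γ
  subset_gamma_one : Γ ⊆ gammaCone n 1
  contDiffOn : ContDiffOn ℝ 2 F Γ
  F_symm : ∀ p : Equiv.Perm (Fin n), ∀ lam ∈ Γ, F (lam ∘ p) = F lam
  F_homogeneous : ∀ c : ℝ, 0 < c → ∀ lam ∈ Γ, F (c • lam) = c * F lam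
  F_one : F (fun _ => 1) = 1
  F_pos : ∀ lam ∈ Γ, 0 < F lam
  F_concave : ConcaveOn ℝ Γ F
  F_monotone : ∀ lam ∈ Γ, ∀ i, 0 < partialF F i lam
  F_lower : ∃ ε : ℝ, 0 < ε ∧ ∀ lam ∈ Γ, ∀ i, ε * (F lam / sigma 1 lam) ≤ partialF F i lam

/-! ### Riemannian geometry in a coordinate system

In this part `G : EuclideanSpace ℝ (Fin n) → Matrix (Fin n) (Fin n) ℝ` is the matrix `(g_ij)` of a
metric in coordinates, and functions on the manifold are written in these coordinates. -/

/-- The coordinate derivative `∂_i φ`. -/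
def pd {n : ℕ} (i : Fin n) (φ : EuclideanSpace ℝ (Fin n) → ℝ) (x : EuclideanSpace ℝ (Fin n)) : ℝ :=
  fderiv ℝ φ x (EuclideanSpace.single i 1)

/-- The Christoffel symbol `Γ^k_ij` of the Levi-Civita connection. -/
def christoffel {n : ℕ} (G : EuclideanSpace ℝ (Fin n) → Matrix (Fin n) (Fin n) ℝ)
    (k i j : Fin n) (x : EuclideanSpace ℝ (Fin n)) : ℝ :=
  (1 / 2) * ∑ l, (G x)⁻¹ k l *
    (pd i (fun y => G y j l) x + pd j (fun y => G y i l) x - pd l (fun y => G y i j) x)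

/-- The differential `dφ`, as the vector of its components. -/
def differential {n : ℕ} (φ : EuclideanSpace ℝ (Fin n) → ℝ) (x : EuclideanSpace ℝ (Fin n)) :
    Fin n → ℝ :=
  fun i => pd i φ x

/-- The covariant Hessian `φ_ij = ∂_i ∂_j φ - Γ^k_ij ∂_k φ`. -/
def hessian {n : ℕ} (G : EuclideanSpace ℝ (Fin n) → Matrix (Fin n) (Fin n) ℝ)
    (φ : EuclideanSpace ℝ (Fin n) → ℝ) (x : EuclideanSpace ℝ (Fin n)) :
    Matrix (Fin n) (Fin n) ℝ :=
  Matrix.of fun i j => pd i (fun y => pd j φ y) x - ∑ k, christoffel G k i j x * pd k φ x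

/-- The Laplacian `Δφ = g^ij φ_ij`. -/
def laplacian {n : ℕ} (G : EuclideanSpace ℝ (Fin n) → Matrix (Fin n) (Fin n) ℝ)
    (φ : EuclideanSpace ℝ (Fin n) → ℝ) (x : EuclideanSpace ℝ (Fin n)) : ℝ :=
  ((G x)⁻¹ * hessian G φ x).trace

/-- The squared norm `g^ij w_i w_j` of a covector. -/
def covectorNormSq {n : ℕ} (A : Matrix (Fin n) (Fin n) ℝ) (w : Fin n → ℝ) : ℝ :=
  w ⬝ᵥ A⁻¹.mulVec w

/-- The norm `(g^ik g^jl T_ij T_kl)^(1/2)` of a covariant 2-tensor. -/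
def tensorNorm {n : ℕ} (A T : Matrix (Fin n) (Fin n) ℝ) : ℝ :=
  Real.sqrt ((A⁻¹ * T * A⁻¹ * T.transpose).trace)

/-- `V = (t-1)/(n-2) (Δu) g - ∇²u - a du ⊗ du - b |∇u|² g + S`. -/
def tensorV {n : ℕ} (t : ℝ) (G : EuclideanSpace ℝ (Fin n) → Matrix (Fin n) (Fin n) ℝ)
    (a b u : EuclideanSpace ℝ (Fin n) → ℝ)
    (S : EuclideanSpace ℝ (Fin n) → Matrix (Fin n) (Fin n) ℝ) (x : EuclideanSpace ℝ (Fin n)) :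
    Matrix (Fin n) (Fin n) ℝ :=
  ((t - 1) / ((n : ℝ) - 2) * laplacian G u x) • G x - hessian G u x
    - a x • Matrix.vecMulVec (differential u x) (differential u x)
    - (b x * covectorNormSq (G x) (differential u x)) • G x + S x

/-- `lam` lists the eigenvalues of `g⁻¹ T` with multiplicity. -/
def IsEigenvalueList {n : ℕ} (A T : Matrix (Fin n) (Fin n) ℝ) (lam : Fin n → ℝ) : Prop :=
  (A⁻¹ * T).charpoly = ∏ i, (Polynomial.X - Polynomial.C (lam i))

/-- The `C^k` norm of `φ` on the ball of radius `r` is at most `N`. -/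
def CkBound {n : ℕ} (k : ℕ) (r N : ℝ) (φ : EuclideanSpace ℝ (Fin n) → ℝ) : Prop :=
  ∀ x ∈ Metric.ball (0 : EuclideanSpace ℝ (Fin n)) r, ∀ j ≤ k, ‖iteratedFDeriv ℝ j φ x‖ ≤ N

/-- The quantity `f + |∇_x f| + |f_z| + |∇_x² f| + |∇_x f_z| + |f_zz|` at `(x, z)`; all
`x`-derivatives are taken with `z` fixed, and their norms with respect to the metric. -/
def jetSize {n : ℕ} (G : EuclideanSpace ℝ (Fin n) → Matrix (Fin n) (Fin n) ℝ)
    (f : EuclideanSpace ℝ (Fin n) → ℝ → ℝ) (x : EuclideanSpace ℝ (Fin n)) (z : ℝ) : ℝ :=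
  f x z + Real.sqrt (covectorNormSq (G x) (differential (fun y => f y z) x))
    + |deriv (f x) z| + tensorNorm (G x) (hessian G (fun y => f y z) x)
    + Real.sqrt (covectorNormSq (G x) (differential (fun y => deriv (f y) z) x))
    + |deriv (deriv (f x)) z|

/-! ### Geodesic balls in a Riemannian manifold -/

/-- A field of bilinear forms on the tangent spaces of an `n`-manifold. -/
abbrev BilinField (n : ℕ) (M : Type*) [TopologicalSpace M]
    [ChartedSpace (EuclideanSpace ℝ (Fin n)) M] :=
  ∀ q : M, TangentSpace (𝓡 n) q →L[ℝ] TangentSpace (𝓡 n) q →L[ℝ] ℝ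

/-- A smooth Riemannian metric on `M`. -/
abbrev RiemMetric (n : ℕ) (M : Type*) [TopologicalSpace M]
    [ChartedSpace (EuclideanSpace ℝ (Fin n)) M] [IsManifold (𝓡 n) ∞ M] :=
  Bundle.ContMDiffRiemannianMetric (𝓡 n) ∞ (EuclideanSpace ℝ (Fin n))
    (fun q : M => TangentSpace (𝓡 n) q)

/-- The component matrix of a field of bilinear forms in the coordinates `ψ`. -/
def components {n : ℕ} {M : Type*} [TopologicalSpace M]
    [ChartedSpace (EuclideanSpace ℝ (Fin n)) M]
    (ψ : OpenPartialHomeomorph M (EuclideanSpace ℝ (Fin n))) (T : BilinField n M)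
    (x : EuclideanSpace ℝ (Fin n)) : Matrix (Fin n) (Fin n) ℝ :=
  Matrix.of fun i j =>
    T (ψ.symm x)
      (mfderiv (𝓡 n) (𝓡 n) ψ.symm x (EuclideanSpace.single i (1 : ℝ)))
      (mfderiv (𝓡 n) (𝓡 n) ψ.symm x (EuclideanSpace.single j (1 : ℝ)))

/-- The open set of `M` with coordinates in the ball of radius `r`. -/
def coordBall {n : ℕ} {M : Type*} [TopologicalSpace M]
    (ψ : OpenPartialHomeomorph M (EuclideanSpace ℝ (Fin n))) (r : ℝ) : Set M :=
  ψ.symm '' Metric.ball (0 : EuclideanSpace ℝ (Fin n)) r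

/-- `ψ` is a system of geodesic normal coordinates on the geodesic ball of radius `r` about
`ψ.symm 0`: the coordinate frame is orthonormal at the origin, and for all `x` in the ball
the ray `s ↦ s x` is a geodesic, that is `Γ^k_ij(x) x^i x^j = 0`. Hence `ψ.symm` is the
exponential map on the ball of radius `r`, and it is a diffeomorphism onto its image there. -/
structure IsGeodesicBall {n : ℕ} {M : Type*} [TopologicalSpace M]
    [ChartedSpace (EuclideanSpace ℝ (Fin n)) M] [IsManifold (𝓡 n) ∞ M] (g : RiemMetric n M)
    (ψ : OpenPartialHomeomorph M (EuclideanSpace ℝ (Fin n))) (r : ℝ) : Prop where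
  mem_atlas : ψ ∈ IsManifold.maximalAtlas (𝓡 n) ∞ M
  ball_subset : Metric.ball (0 : EuclideanSpace ℝ (Fin n)) r ⊆ ψ.target
  metric_zero : components ψ g.inner 0 = 1
  rays_geodesic : ∀ x ∈ Metric.ball (0 : EuclideanSpace ℝ (Fin n)) r, ∀ k,
    ∑ i, ∑ j, christoffel (components ψ g.inner) k i j x * (x i * x j) = 0

/-- `u` is a `C⁴` solution of `F (g⁻¹ V) = f (x, u)` with `g⁻¹ V ∈ Γ` in the geodesic ball of
radius `r` with normal coordinates `ψ`. The data are as regular as the equation presupposes, `f`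
is positive, `|∇_x f| ≤ Λ f` and `|f_z| ≤ Λ f` at the points `(x, u x)`, and the numbers
`Na, Nb, NS, Ng, Ni, c` bound `‖a‖_{C²}`, `‖b‖_{C²}`, `‖S‖_{C²}`, `‖g‖_{C³}`, `|g^ij|` and the
supremum of `f + |∇_x f| + |f_z| + |∇_x² f| + |∇_x f_z| + |f_zz|` along `u`. -/
structure IsSolution {n : ℕ} (t r Λ Na Nb NS Ng Ni c : ℝ)
    (Γ : Set (Fin n → ℝ)) (F : (Fin n → ℝ) → ℝ) {M : Type*} [TopologicalSpace M]
    [ChartedSpace (EuclideanSpace ℝ (Fin n)) M] [IsManifold (𝓡 n) ∞ M] (g : RiemMetric n M)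
    (ψ : OpenPartialHomeomorph M (EuclideanSpace ℝ (Fin n)))
    (a b u : M → ℝ) (S : BilinField n M) (f : M → ℝ → ℝ) : Prop where
  structureConditions : StructureConditions Γ F
  geodesicBall : IsGeodesicBall g ψ r
  a_smooth : ContMDiffOn (𝓡 n) 𝓘(ℝ, ℝ) ∞ a (coordBall ψ r)
  b_smooth : ContMDiffOn (𝓡 n) 𝓘(ℝ, ℝ) ∞ b (coordBall ψ r)
  S_symm : ∀ q ∈ coordBall ψ r, ∀ v w, S q v w = S q w v
  S_contDiff : ∀ i j, ContDiffOn ℝ 2 (fun x => components ψ S x i j)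
    (Metric.ball (0 : EuclideanSpace ℝ (Fin n)) r)
  f_contMDiff : ContMDiffOn ((𝓡 n).prod 𝓘(ℝ, ℝ)) 𝓘(ℝ, ℝ) 2 (fun q : M × ℝ => f q.1 q.2)
    (coordBall ψ r ×ˢ Set.univ)
  f_pos : ∀ q ∈ coordBall ψ r, ∀ z, 0 < f q z
  u_contMDiff : ContMDiffOn (𝓡 n) 𝓘(ℝ, ℝ) 4 u (coordBall ψ r)
  equation : ∀ x ∈ Metric.ball (0 : EuclideanSpace ℝ (Fin n)) r, ∃ lam : Fin n → ℝ,
    IsEigenvalueList (components ψ g.inner x)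
      (tensorV t (components ψ g.inner) (a ∘ ψ.symm) (b ∘ ψ.symm) (u ∘ ψ.symm)
        (components ψ S) x) lam ∧
    lam ∈ Γ ∧ F lam = f (ψ.symm x) (u (ψ.symm x))
  f_grad : ∀ x ∈ Metric.ball (0 : EuclideanSpace ℝ (Fin n)) r,
    Real.sqrt (covectorNormSq (components ψ g.inner x)
      (differential (fun y => f (ψ.symm y) (u (ψ.symm x))) x)) ≤ Λ * f (ψ.symm x) (u (ψ.symm x))
  f_deriv : ∀ q ∈ coordBall ψ r, |deriv (f q) (u q)| ≤ Λ * f q (u q)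
  a_bound : CkBound 2 r Na (a ∘ ψ.symm)
  b_bound : CkBound 2 r Nb (b ∘ ψ.symm)
  S_bound : ∀ i j, CkBound 2 r NS (fun x => components ψ S x i j)
  g_bound : ∀ i j, CkBound 3 r Ng (fun x => components ψ g.inner x i j)
  g_inv_bound : ∀ i j, CkBound 0 r Ni (fun x => (components ψ g.inner x)⁻¹ i j)
  c_sup_bound : ∀ x ∈ Metric.ball (0 : EuclideanSpace ℝ (Fin n)) r,
    jetSize (components ψ g.inner) (fun y z => f (ψ.symm y) z) x (u (ψ.symm x)) ≤ c

/-- `|∇²u| + |∇u|² ≤ C` on the concentric geodesic ball of radius `r / 2`. -/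
def InteriorBound {n : ℕ} (r C : ℝ) {M : Type*} [TopologicalSpace M]
    [ChartedSpace (EuclideanSpace ℝ (Fin n)) M] [IsManifold (𝓡 n) ∞ M] (g : RiemMetric n M)
    (ψ : OpenPartialHomeomorph M (EuclideanSpace ℝ (Fin n))) (u : M → ℝ) : Prop :=
  ∀ x ∈ Metric.ball (0 : EuclideanSpace ℝ (Fin n)) (r / 2),
    tensorNorm (components ψ g.inner x) (hessian (components ψ g.inner) (u ∘ ψ.symm) x)
      + covectorNormSq (components ψ g.inner x) (differential (u ∘ ψ.symm) x) ≤ C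

end InteriorEstimate

end

/-!
# Interior second derivative estimates

The proof bounds the maximum of
`ρ² (∇²u(e, e) + α |∇u|²)`, `ρ = R² - |x|²`,
over all points `x` of the ball of radius `R = 3r/4` and all unit tangent vectors `e`, where `α` is
a large constant. Together with the positivity of the trace of `V` (from `Γ ⊆ Γ₁`) this bounds
`|∇u|²` and the whole Hessian on the smaller ball.

*Differentiation.* Everything is differentiated along geodesics, in a frame that is parallel along
the geodesic and hence stays orthonormal (`exists_parallel_frame`). The covariant derivatives of `u`
of order up to four then are 2-jets of ordinary functions of one variable, recorded by `Jet2`, and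
commuting two covariant derivatives costs only lower order terms (`abs_covThird_sub_le`,
`abs_covFourth_sub_le`).

*The equation.* Diagonalize `V` at the maximum `x₀`, and let `F_m` be the partial derivatives of `F`
at its eigenvalues, with sum `T ≥ 1`. By Schur's theorem and concavity, for every point `x` and
every orthonormal frame `X` there, `∑ F_m V(X_m, X_m) - f(x, u(x))` is at least its value at `x₀`
(`exists_weights`). So along every geodesic through `x₀` this function has a minimum at `x₀`. Its
first derivative vanishes and its second derivative is nonnegative (`exists_linearized`), which is
all that is needed of the equation differentiated once and twice.

*The maximum.* The test function has a maximum at `x₀`, which gives one more pair of relations in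
each direction of the frame (`exists_test_function_jet`). Weighting these with `s T - F_m ≥ 0`,
`s = (t - 1)/(n - 2)`, all terms of third and fourth order cancel, and with `a, b` the coefficients,
`∑ (a F_m + b T) |∇²u(e, E_m)|² + α ∑ (s T - F_m) ∑_k |∇²u(E_m, E_k)|²`
is bounded by `T` times terms of lower order in the weighted sense, that is of order `3/2` in
`|∇²u| + |∇u|²` (`maximum_identity`, `maximum_inequality`, `exists_frame_inequality`).

*Conclusion.* In the first alternative of `CoefficientCondition` the left side controls the square
of
the top eigenvalue `μ` of the Hessian, by the good sign of `a + b`, and the trace of `V` controls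
`|∇u|²` and `|∇²u|` by `μ + 1`, by the good sign of `a + n b`. In the second alternative `s ≥ 2`, so
that `s T - F_m ≥ T` and the left side controls the full Hessian, while `|∇u|²` is controlled by
`|∇²u| + 1` because the smallest eigenvalue of `V` is at most `F = f`. Either way the quadratic term
dominates (`exists_bound_of_quadratic`). The hypotheses of case (a) lead to the first alternative
where `b > 0` and to the second where `b < 0`; those of case (b) lead to the first.

Uniformity of the constant is obtained by treating all solutions at once: a `Configuration` collects
the data of a solution in coordinates together with their bounds, and `JetBdd` expresses that
a family of functions has derivatives bounded uniformly over the family.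
-/

set_option maxSynthPendingDepth 3

open scoped Manifold ContDiff

noncomputable section

namespace InteriorEstimate

open Filter Topology

/-! ### Concavity of the operator in the matrix variable -/

section Spectral

variable {n : ℕ} {Γ : Set (Fin n → ℝ)} {F : (Fin n → ℝ) → ℝ}

theorem fderiv_eq_sum_partialF (lam v : Fin n → ℝ) :
    fderiv ℝ F lam v = ∑ i, partialF F i lam * v i := by
  conv_lhs => rw [pi_eq_sum_univ' v]
  simp only [map_sum, map_smul, smul_eq_mul, partialF]
  refine Finset.sum_congr rfl fun i _ => ?_
  rw [mul_comm]

theorem StructureConditions.differentiableAt (h : StructureConditions Γ F) {lam : Fin n → ℝ}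
    (hl : lam ∈ Γ) : DifferentiableAt ℝ F lam :=
  (h.contDiffOn.contDiffAt (h.isOpen.mem_nhds hl)).differentiableAt (by norm_num)

/-- The gradient of a concave function is a supergradient. -/
theorem StructureConditions.le_add_sum (h : StructureConditions Γ F) {lam d : Fin n → ℝ}
    (hl : lam ∈ Γ) (hd : d ∈ Γ) :
    F d ≤ F lam + ∑ i, partialF F i lam * (d i - lam i) := by
  have hder : HasDerivAt (fun s : ℝ => F (AffineMap.lineMap lam d s))
      (fderiv ℝ F lam (d - lam)) 0 := by
    have h1 : HasFDerivAt F (fderiv ℝ F lam) (AffineMap.lineMap lam d (0 : ℝ)) := by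
      simpa using (h.differentiableAt hl).hasFDerivAt
    exact h1.comp_hasDerivAt (0 : ℝ) AffineMap.hasDerivAt_lineMap
  have hconc : ConcaveOn ℝ (Set.Icc (0 : ℝ) 1) (fun s : ℝ => F (AffineMap.lineMap lam d s)) := by
    refine (h.F_concave.comp_affineMap (AffineMap.lineMap lam d)).subset ?_ (convex_Icc 0 1)
    intro s hs
    exact h.convex.lineMap_mem hl hd hs
  have := hconc.slope_le_of_hasDerivAt (x := 0) (y := 1) (by simp) (by simp) (by simp) hder
  rw [fderiv_eq_sum_partialF] at this
  simp [slope_def_field] at this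
  linarith

theorem StructureConditions.smul_one_mem (h : StructureConditions Γ F) {m : ℝ} (hm : 0 < m) :
    (fun _ => m) ∈ Γ := by
  apply h.gamma_n_subset
  intro j _ hj
  unfold sigma
  apply Finset.sum_pos
  · intro s _
    exact Finset.prod_pos fun _ _ => hm
  · rw [Finset.powersetCard_nonempty]
    simpa using hj

/-- Euler's relation for the homogeneous function `F`. -/
theorem StructureConditions.sum_partialF_mul (h : StructureConditions Γ F) {lam : Fin n → ℝ}
    (hl : lam ∈ Γ) : ∑ i, partialF F i lam * lam i = F lam := by
  rw [← fderiv_eq_sum_partialF]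
  have h1 : HasDerivAt (fun s : ℝ => F (s • lam)) (fderiv ℝ F lam lam) 1 := by
    have h1 : HasFDerivAt F (fderiv ℝ F lam) ((1 : ℝ) • lam) := by
      simpa using (h.differentiableAt hl).hasFDerivAt
    have h2 : HasDerivAt (fun s : ℝ => s • lam) lam 1 := by
      simpa using (hasDerivAt_id (1 : ℝ)).smul_const lam
    exact h1.comp_hasDerivAt (1 : ℝ) h2
  have h2 : HasDerivAt (fun s : ℝ => F (s • lam)) (F lam) 1 := by
    have h3 : HasDerivAt (fun s : ℝ => s * F lam) (F lam) 1 := by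
      simpa using (hasDerivAt_id (1 : ℝ)).mul_const (F lam)
    refine h3.congr_of_eventuallyEq ?_
    filter_upwards [lt_mem_nhds (zero_lt_one (α := ℝ))] with s hs
    exact h.F_homogeneous s hs lam hl
  exact h1.unique h2

theorem StructureConditions.one_le_sum_partialF (h : StructureConditions Γ F) {lam : Fin n → ℝ}
    (hl : lam ∈ Γ) : 1 ≤ ∑ i, partialF F i lam := by
  have h1 := h.le_add_sum hl (h.smul_one_mem one_pos)
  rw [h.F_one] at h1
  simp only [mul_sub, Finset.sum_sub_distrib, h.sum_partialF_mul hl, mul_one] at h1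
  linarith

/-- By monotonicity, `F` is bounded below by the smallest eigenvalue. -/
theorem StructureConditions.le_of_forall_le (h : StructureConditions Γ F) {lam : Fin n → ℝ}
    (hl : lam ∈ Γ) {m : ℝ} (hm : 0 < m) (hle : ∀ i, m ≤ lam i) : m ≤ F lam := by
  have hmem := h.smul_one_mem hm
  have h1 := h.le_add_sum hl hmem
  have h2 : F (fun _ => m) = m := by
    have := h.F_homogeneous m hm _ (h.smul_one_mem one_pos)
    rw [h.F_one] at this
    rw [mul_one] at this
    rw [← this]
    congr 1
    ext
    simp [this]
  have h3 : ∑ i, partialF F i lam * (m - lam i) ≤ 0 :=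
    Finset.sum_nonpos fun i _ =>
      mul_nonpos_of_nonneg_of_nonpos (h.F_monotone lam hl i).le (by linarith [hle i])
  linarith

/-- A symmetric concave function does not decrease under a doubly stochastic averaging. -/
theorem StructureConditions.doublyStochastic_mulVec (h : StructureConditions Γ F)
    {lam : Fin n → ℝ} (hl : lam ∈ Γ) {D : Matrix (Fin n) (Fin n) ℝ}
    (hD : D ∈ doublyStochastic ℝ (Fin n)) :
    D.mulVec lam ∈ Γ ∧ F lam ≤ F (D.mulVec lam) := by
  have hc : Convex ℝ {d : Fin n → ℝ | d ∈ Γ ∧ F lam ≤ F d} := h.F_concave.convex_ge (F lam)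
  have hsub : (doublyStochastic ℝ (Fin n) : Set (Matrix (Fin n) (Fin n) ℝ)) ⊆
      {D | D.mulVec lam ∈ {d : Fin n → ℝ | d ∈ Γ ∧ F lam ≤ F d}} := by
    rw [doublyStochastic_eq_convexHull_permMatrix]
    refine convexHull_min ?_ ?_
    · rintro _ ⟨σ, rfl⟩
      have : (Equiv.Perm.permMatrix ℝ σ).mulVec lam = lam ∘ σ := by
        ext i
        simp [Matrix.permMatrix_mulVec]
      simp only [Set.mem_ofPred_eq]
      rw [this]
      exact ⟨h.symm σ lam hl, (h.F_symm σ lam hl).ge⟩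
    · exact hc.is_linear_preimage (f := fun D : Matrix (Fin n) (Fin n) ℝ => D.mulVec lam)
        ⟨fun A B => Matrix.add_mulVec A B lam, fun c A => Matrix.smul_mulVec c A lam⟩
  exact hsub hD

theorem exists_perm_of_map_univ_eq {f g : Fin n → ℝ}
    (h : Finset.univ.val.map f = Finset.univ.val.map g) : ∃ σ : Equiv.Perm (Fin n), f ∘ σ = g := by
  simp only [Fin.univ_val_map, Multiset.coe_eq_coe] at h
  have hf : (List.ofFn f).Perm (List.ofFn (f ∘ Tuple.sort f)) :=
    (Equiv.Perm.ofFn_comp_perm (Tuple.sort f) f).symm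
  have hg : (List.ofFn g).Perm (List.ofFn (g ∘ Tuple.sort g)) :=
    (Equiv.Perm.ofFn_comp_perm (Tuple.sort g) g).symm
  have heq : List.ofFn (f ∘ Tuple.sort f) = List.ofFn (g ∘ Tuple.sort g) :=
    List.Perm.eq_of_sortedLE (Tuple.monotone_sort f).sortedLE_ofFn
      (Tuple.monotone_sort g).sortedLE_ofFn ((hf.symm.trans h).trans hg)
  have h2 : f ∘ Tuple.sort f = g ∘ Tuple.sort g := List.ofFn_injective heq
  refine ⟨(Tuple.sort g).symm.trans (Tuple.sort f), ?_⟩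
  ext i
  have := congrFun h2 ((Tuple.sort g).symm i)
  simpa using this

/-- The spectral theorem for a real symmetric matrix, with the eigenvalues in a given order. -/
theorem exists_orthogonal_diagonalization {A : Matrix (Fin n) (Fin n) ℝ} (hA : A.IsHermitian)
    {lam : Fin n → ℝ} (hchar : A.charpoly = ∏ i, (Polynomial.X - Polynomial.C (lam i))) :
    ∃ U : Matrix (Fin n) (Fin n) ℝ, U * U.transpose = 1 ∧ U.transpose * U = 1 ∧
      A = U * Matrix.diagonal lam * U.transpose := by
  obtain ⟨σ, hσ⟩ : ∃ σ : Equiv.Perm (Fin n), hA.eigenvalues ∘ σ = lam := by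
    apply exists_perm_of_map_univ_eq
    have h1 := hA.roots_charpoly_eq_eigenvalues
    rw [hchar] at h1
    have h2 : (∏ i, (Polynomial.X - Polynomial.C (lam i))) =
        ((Finset.univ.val.map lam).map fun a => Polynomial.X - Polynomial.C a).prod := by
      rw [Multiset.map_map]; rfl
    rw [h2, Polynomial.roots_multiset_prod_X_sub_C] at h1
    exact h1.symm
  set W : Matrix (Fin n) (Fin n) ℝ := hA.eigenvectorUnitary.1 with hW
  have hW1 : W * W.transpose = 1 := by
    have := Unitary.coe_mul_star_self hA.eigenvectorUnitary
    rwa [Unitary.coe_star, Matrix.star_eq_conjTranspose,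
        Matrix.conjTranspose_eq_transpose_of_trivial] at this
  have hspec : A = W * Matrix.diagonal hA.eigenvalues * W.transpose := by
    have := hA.spectral_theorem
    rw [Unitary.conjStarAlgAut_apply, Matrix.star_eq_conjTranspose,
      Matrix.conjTranspose_eq_transpose_of_trivial] at this
    exact this
  have hU1 : W.submatrix id σ * (W.submatrix id σ).transpose = 1 := by
    rw [Matrix.transpose_submatrix, Matrix.submatrix_mul_equiv, hW1, Matrix.submatrix_id_id]
  refine ⟨W.submatrix id σ, hU1, mul_eq_one_comm.mp hU1, ?_⟩
  have hd : Matrix.diagonal lam = (Matrix.diagonal hA.eigenvalues).submatrix σ σ := by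
    rw [Matrix.submatrix_diagonal_equiv, hσ]
  rw [hd, Matrix.submatrix_mul_equiv, Matrix.transpose_submatrix, Matrix.submatrix_mul_equiv,
    Matrix.submatrix_id_id]
  exact hspec

/-- Schur's theorem: if the eigenvalues of a symmetric matrix lie in `Γ`, then so does its
diagonal, and `F` is at least as large there. -/
theorem StructureConditions.diag (h : StructureConditions Γ F) {lam : Fin n → ℝ} (hl : lam ∈ Γ)
    {A : Matrix (Fin n) (Fin n) ℝ} (hA : A.IsHermitian)
    (hchar : A.charpoly = ∏ i, (Polynomial.X - Polynomial.C (lam i))) :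
    A.diag ∈ Γ ∧ F lam ≤ F A.diag := by
  obtain ⟨U, hU1, hU2, hAU⟩ := exists_orthogonal_diagonalization hA hchar
  have hD : (Matrix.of fun i j => U i j ^ 2) ∈ doublyStochastic ℝ (Fin n) := by
    rw [mem_doublyStochastic_iff_sum]
    refine ⟨fun i j => sq_nonneg _, fun i => ?_, fun j => ?_⟩
    · have := congrFun (congrFun hU1 i) i
      simpa [Matrix.mul_apply, sq] using this
    · have := congrFun (congrFun hU2 j) j
      simpa [Matrix.mul_apply, sq] using this
  have hdiag : A.diag = (Matrix.of fun i j => U i j ^ 2).mulVec lam := by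
    ext i
    rw [Matrix.diag_apply, hAU, Matrix.mul_apply, Matrix.mulVec, dotProduct]
    refine Finset.sum_congr rfl fun j _ => ?_
    simp [Matrix.mul_diagonal]
    ring
  rw [hdiag]
  exact h.doublyStochastic_mulVec hl hD

/-- The linearization of the concave operator `A ↦ F (eigenvalues of A)` at a diagonal matrix
bounds the operator from above. -/
theorem StructureConditions.le_linearization (h : StructureConditions Γ F) {lam mu : Fin n → ℝ}
    (hl : lam ∈ Γ) (hm : mu ∈ Γ) {A : Matrix (Fin n) (Fin n) ℝ} (hA : A.IsHermitian)
    (hchar : A.charpoly = ∏ i, (Polynomial.X - Polynomial.C (mu i))) :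
    F mu ≤ F lam + ∑ i, partialF F i lam * (A i i - lam i) := by
  obtain ⟨h1, h2⟩ := h.diag hm hA hchar
  exact h2.trans (h.le_add_sum hl h1)

end Spectral

/-! ### Second-order jets of curves -/

section Jets

variable {F F' E : Type*} [NormedAddCommGroup F] [NormedSpace ℝ F] [NormedAddCommGroup F']
  [NormedSpace ℝ F'] [NormedAddCommGroup E] [NormedSpace ℝ E]

/-- The curve `φ` is differentiable near `0`, twice differentiable at `0`, and its value and first
two derivatives at `0` are `a`, `b`, `c`. -/
structure Jet2 (φ : ℝ → F) (a b c : F) : Prop where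
  val : φ 0 = a
  exists_deriv : ∃ φ' : ℝ → F, (∀ᶠ τ in 𝓝 0, HasDerivAt φ (φ' τ) τ) ∧ φ' 0 = b ∧ HasDerivAt φ' c 0

namespace Jet2

variable {φ ψ : ℝ → F} {a b c a' b' c' : F}

theorem congr_eventually (h : Jet2 φ a b c) (he : ψ =ᶠ[𝓝 0] φ) : Jet2 ψ a b c := by
  obtain ⟨hv, φ', h1, h2, h3⟩ := h
  refine ⟨by rw [he.eq_of_nhds, hv], φ', ?_, h2, h3⟩
  filter_upwards [h1, he.eventually_nhds] with τ hτ heτ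
  exact hτ.congr_of_eventuallyEq heτ

theorem const (a : F) : Jet2 (fun _ => a) a 0 0 :=
  ⟨rfl, fun _ => 0, Eventually.of_forall fun τ => hasDerivAt_const τ a, rfl, hasDerivAt_const 0 0⟩

theorem add (h : Jet2 φ a b c) (h' : Jet2 ψ a' b' c') :
    Jet2 (fun τ => φ τ + ψ τ) (a + a') (b + b') (c + c') := by
  obtain ⟨hv, φ', h1, h2, h3⟩ := h
  obtain ⟨hv', ψ', h1', h2', h3'⟩ := h'
  refine ⟨by rw [hv, hv'], fun τ => φ' τ + ψ' τ, ?_, by beta_reduce; rw [h2, h2'], h3.add h3'⟩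
  filter_upwards [h1, h1'] with τ hτ hτ' using hτ.add hτ'

theorem sub (h : Jet2 φ a b c) (h' : Jet2 ψ a' b' c') :
    Jet2 (fun τ => φ τ - ψ τ) (a - a') (b - b') (c - c') := by
  obtain ⟨hv, φ', h1, h2, h3⟩ := h
  obtain ⟨hv', ψ', h1', h2', h3'⟩ := h'
  refine ⟨by rw [hv, hv'], fun τ => φ' τ - ψ' τ, ?_, by beta_reduce; rw [h2, h2'], h3.sub h3'⟩
  filter_upwards [h1, h1'] with τ hτ hτ' using hτ.sub hτ'

theorem sum {ι : Type*} {s : Finset ι} {φ : ι → ℝ → F} {a b c : ι → F}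
    (h : ∀ i ∈ s, Jet2 (φ i) (a i) (b i) (c i)) :
    Jet2 (fun τ => ∑ i ∈ s, φ i τ) (∑ i ∈ s, a i) (∑ i ∈ s, b i) (∑ i ∈ s, c i) := by
  classical
  induction s using Finset.induction_on with
  | empty => simpa using const (0 : F)
  | insert i s hi ih =>
    simp only [Finset.sum_insert hi]
    exact (h i (Finset.mem_insert_self i s)).add
      (ih fun j hj => h j (Finset.mem_insert_of_mem hj))

/-- The Leibniz rule. -/
theorem clm_apply {A : ℝ → F →L[ℝ] F'} {A0 A1 A2 : F →L[ℝ] F'} (hA : Jet2 A A0 A1 A2)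
    (h : Jet2 φ a b c) :
    Jet2 (fun τ => A τ (φ τ)) (A0 a) (A1 a + A0 b) (A2 a + A1 b + (A1 b + A0 c)) := by
  obtain ⟨hv, φ', h1, h2, h3⟩ := h
  obtain ⟨hv', A', h1', h2', h3'⟩ := hA
  refine ⟨by rw [hv, hv'], fun τ => A' τ (φ τ) + A τ (φ' τ), ?_, by beta_reduce; rw [h2, h2', hv,
      hv'], ?_⟩
  · filter_upwards [h1, h1'] with τ hτ hτ' using hτ'.clm_apply hτ
  · have e1 := h1.self_of_nhds
    have e2 := h1'.self_of_nhds
    have := (h3'.clm_apply e1).add (e2.clm_apply h3)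
    rw [hv, hv', h2, h2'] at this
    exact this

theorem mul {φ ψ : ℝ → ℝ} {a b c a' b' c' : ℝ} (h : Jet2 φ a b c) (h' : Jet2 ψ a' b' c') :
    Jet2 (fun τ => φ τ * ψ τ) (a * a') (b * a' + a * b') (c * a' + 2 * b * b' + a * c') := by
  obtain ⟨hv, φ', h1, h2, h3⟩ := h
  obtain ⟨hv', ψ', h1', h2', h3'⟩ := h'
  refine ⟨by rw [hv, hv'], fun τ => φ' τ * ψ τ + φ τ * ψ' τ, ?_, by beta_reduce; rw [h2, h2', hv,
      hv'], ?_⟩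
  · filter_upwards [h1, h1'] with τ hτ hτ' using hτ.mul hτ'
  · have e1 := h1.self_of_nhds
    have e2 := h1'.self_of_nhds
    have := (h3.mul e2).add (e1.mul h3')
    rw [hv, hv', h2, h2'] at this
    exact this.congr_deriv (by ring)

theorem const_mul {φ : ℝ → ℝ} {a b c : ℝ} (r : ℝ) (h : Jet2 φ a b c) :
    Jet2 (fun τ => r * φ τ) (r * a) (r * b) (r * c) := by
  simpa using (const r).mul h

theorem inv {φ : ℝ → ℝ} {a b c : ℝ} (h : Jet2 φ a b c) (ha : a ≠ 0) :
    Jet2 (fun τ => (φ τ)⁻¹) a⁻¹ (-b / a ^ 2) (-c / a ^ 2 + 2 * b ^ 2 / a ^ 3) := by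
  obtain ⟨hv, φ', h1, h2, h3⟩ := h
  refine ⟨by rw [hv], fun τ => -φ' τ / φ τ ^ 2, ?_, by beta_reduce; rw [h2, hv], ?_⟩
  · have hne : ∀ᶠ τ in 𝓝 0, φ τ ≠ 0 :=
      h1.self_of_nhds.continuousAt.eventually_ne (by rwa [hv])
    filter_upwards [h1, hne] with τ hτ hτ' using hτ.inv hτ'
  · have e1 := h1.self_of_nhds
    have := h3.neg.div (e1.pow 2) (by rw [Pi.pow_apply, hv]; positivity)
    simp only [Pi.pow_apply, Pi.neg_apply, hv, h2] at this
    refine this.congr_deriv ?_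
    field_simp
    ring

/-- The chain rule. -/
theorem comp {γ : ℝ → E} {x v w : E} (h : Jet2 γ x v w) {f : E → F} (hf : ContDiffAt ℝ 2 f x) :
    Jet2 (fun τ => f (γ τ)) (f x) (fderiv ℝ f x v)
      (fderiv ℝ (fderiv ℝ f) x v v + fderiv ℝ f x w) := by
  obtain ⟨hv, γ', h1, h2, h3⟩ := h
  have hc : Tendsto γ (𝓝 0) (𝓝 x) := by
    have := h1.self_of_nhds.continuousAt
    rwa [ContinuousAt, hv] at this
  refine ⟨by rw [hv], fun τ => fderiv ℝ f (γ τ) (γ' τ), ?_, by beta_reduce; rw [h2, hv], ?_⟩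
  · have hd : ∀ᶠ y in 𝓝 x, DifferentiableAt ℝ f y := by
      filter_upwards [hf.eventually (by simp)] with y hy using hy.differentiableAt (by norm_num)
    filter_upwards [h1, hc.eventually hd] with τ hτ hτ'
    exact hτ'.hasFDerivAt.comp_hasDerivAt τ hτ
  · have hd : HasFDerivAt (fderiv ℝ f) (fderiv ℝ (fderiv ℝ f) x) (γ 0) := by
      rw [hv]
      exact ((hf.fderiv_right (m := 1) (by norm_num)).differentiableAt
        (by norm_num)).hasFDerivAt
    have h4 := (hd.comp_hasDerivAt (0 : ℝ) h1.self_of_nhds).clm_apply h3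
    simpa only [Function.comp_apply, hv, h2] using h4

theorem prodMk {χ : ℝ → F'} {p q r : F'} (h : Jet2 φ a b c) (h' : Jet2 χ p q r) :
    Jet2 (fun τ => (φ τ, χ τ)) (a, p) (b, q) (c, r) := by
  obtain ⟨hv, φ', h1, h2, h3⟩ := h
  obtain ⟨hv', ψ', h1', h2', h3'⟩ := h'
  refine ⟨by rw [hv, hv'], fun τ => (φ' τ, ψ' τ), ?_, by beta_reduce; rw [h2, h2'], h3.prodMk h3'⟩
  filter_upwards [h1, h1'] with τ hτ hτ' using hτ.prodMk hτ'

theorem of_eq {a₁ b₁ c₁ : F} (h : Jet2 φ a b c) (ha : a = a₁) (hb : b = b₁) (hc : c = c₁) :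
    Jet2 φ a₁ b₁ c₁ := ha ▸ hb ▸ hc ▸ h

/-- The second-derivative test. -/
theorem of_isLocalMin {φ : ℝ → ℝ} {a b c : ℝ} (h : Jet2 φ a b c) (hm : IsLocalMin φ 0) :
    b = 0 ∧ 0 ≤ c := by
  obtain ⟨hv, φ', h1, h2, h3⟩ := h
  have hb : b = 0 := by
    rw [← h2]
    exact hm.hasDerivAt_eq_zero h1.self_of_nhds
  refine ⟨hb, ?_⟩
  by_contra! hc
  have hderiv : deriv φ =ᶠ[𝓝 0] φ' := by
    filter_upwards [h1] with τ hτ using hτ.deriv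
  have hdd : deriv (deriv φ) 0 = c := by rw [hderiv.deriv_eq, h3.deriv]
  have hmax : IsLocalMax φ 0 :=
    isLocalMax_of_deriv_deriv_neg (by rw [hdd]; exact hc)
      (by rw [hderiv.eq_of_nhds, h2, hb]) h1.self_of_nhds.continuousAt
  have hconst : φ =ᶠ[𝓝 0] fun _ => φ 0 := by
    filter_upwards [hm, hmax] with τ h5 h6 using le_antisymm h6 h5
  have h7 : deriv φ =ᶠ[𝓝 0] fun _ => 0 := by
    have := hconst.deriv
    simpa using this
  have h8 := h7.deriv_eq
  rw [hdd] at h8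
  simp at h8
  exact hc.ne h8

theorem of_isLocalMax {φ : ℝ → ℝ} {a b c : ℝ} (h : Jet2 φ a b c) (hm : IsLocalMax φ 0) :
    b = 0 ∧ c ≤ 0 := by
  have h1 := (h.const_mul (-1)).of_isLocalMin (by simpa using hm.neg)
  exact ⟨by linarith [h1.1], by linarith [h1.2]⟩

end Jet2

end Jets

/-! ### Geodesics and parallel frames -/

section Parallel

variable {E : Type*} [NormedAddCommGroup E] [NormedSpace ℝ E]

theorem hasDerivAt_comp_curve {F : Type*} [NormedAddCommGroup F] [NormedSpace ℝ F] {f : E → F}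
    {γ : ℝ → E} {v : E} {τ : ℝ} (hf : DifferentiableAt ℝ f (γ τ)) (hγ : HasDerivAt γ v τ) :
    HasDerivAt (fun s => f (γ s)) (fderiv ℝ f (γ τ) v) τ :=
  hf.hasFDerivAt.comp_hasDerivAt τ hγ

/-- The second derivative at `0` of the parallel field with initial value `v` along the geodesic
with initial velocity `z`. -/
def parallelSecond (K : E → E →L[ℝ] E →L[ℝ] E) (x z v : E) : E :=
  -(fderiv ℝ K x z z v) + K x (K x z z) v + K x z (K x z v)

/-- For a connection with Christoffel symbols `K` that is compatible with the metric `g`, there are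
a geodesic with given initial velocity and a parallel frame along it with given initial value;
the metric products of the frame are constant. -/
theorem exists_parallel_frame [CompleteSpace E] {ι : Type*} [Fintype ι] {U : Set E}
    (hU : IsOpen U) {K : E → E →L[ℝ] E →L[ℝ] E} {g : E → E →L[ℝ] E →L[ℝ] ℝ}
    (hK : ContDiffOn ℝ 1 K U) (hg : ∀ x ∈ U, DifferentiableAt ℝ g x)
    (hcompat : ∀ x ∈ U, ∀ z v w, fderiv ℝ g x z v w = g x (K x z v) w + g x v (K x z w))
    {x : E} (hx : x ∈ U) (z : E) (e : ι → E) :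
    ∃ (γ : ℝ → E) (X : ι → ℝ → E), Jet2 γ x z (-K x z z) ∧
      (∀ i, Jet2 (X i) (e i) (-K x z (e i)) (parallelSecond K x z (e i))) ∧
      ∀ᶠ τ in 𝓝 0, γ τ ∈ U ∧ ∀ i j, g (γ τ) (X i τ) (X j τ) = g x (e i) (e j) := by
  have hKx : ContDiffAt ℝ 1 K x := hK.contDiffAt (hU.mem_nhds hx)
  have hfield : ContDiffAt ℝ 1 (fun p : E × E × (ι → E) =>
      ((p.2.1, -K p.1 p.2.1 p.2.1, fun i => -K p.1 p.2.1 (p.2.2 i)) : E × E × (ι → E)))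
      (x, z, e) := by
    have h1 : ContDiffAt ℝ 1 (fun p : E × E × (ι → E) => K p.1) (x, z, e) :=
      hKx.comp (x, z, e) contDiffAt_fst
    have h2 : ContDiffAt ℝ 1 (fun p : E × E × (ι → E) => p.2.1) (x, z, e) :=
      contDiffAt_snd.fst
    have h3 : ContDiffAt ℝ 1 (fun p : E × E × (ι → E) => p.2.2) (x, z, e) :=
      contDiffAt_snd.snd
    refine h2.prodMk (((h1.clm_apply h2).clm_apply h2).neg.prodMk ?_)
    rw [contDiffAt_pi]
    intro i
    exact ((h1.clm_apply h2).clm_apply (contDiffAt_pi.1 h3 i)).neg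
  obtain ⟨α, hα0, ε, hε, hα⟩ :=
    hfield.exists_forall_mem_closedBall_exists_eq_forall_mem_Ioo_hasDerivAt₀ 0
  set γ : ℝ → E := fun τ => (α τ).1 with hγ
  set V : ℝ → E := fun τ => (α τ).2.1 with hV
  set X : ι → ℝ → E := fun i τ => (α τ).2.2 i with hX
  have hev : ∀ᶠ τ in 𝓝 (0 : ℝ), τ ∈ Set.Ioo (0 - ε) (0 + ε) :=
    Ioo_mem_nhds (by linarith) (by linarith)
  have hγ' : ∀ τ ∈ Set.Ioo (0 - ε) (0 + ε), HasDerivAt γ (V τ) τ := fun τ hτ => (hα τ hτ).fst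
  have hV' : ∀ τ ∈ Set.Ioo (0 - ε) (0 + ε), HasDerivAt V (-K (γ τ) (V τ) (V τ)) τ :=
    fun τ hτ => (hα τ hτ).snd.fst
  have hX' : ∀ τ ∈ Set.Ioo (0 - ε) (0 + ε), ∀ i,
      HasDerivAt (X i) (-K (γ τ) (V τ) (X i τ)) τ :=
    fun τ hτ i => hasDerivAt_pi.1 (hα τ hτ).snd.snd i
  have h0 : (0 : ℝ) ∈ Set.Ioo (0 - ε) (0 + ε) := ⟨by linarith, by linarith⟩
  have hγ0 : γ 0 = x := by rw [hγ]; simp [hα0]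
  have hV0 : V 0 = z := by rw [hV]; simp [hα0]
  have hX0 : ∀ i, X i 0 = e i := fun i => by rw [hX]; simp [hα0]
  have hKd : DifferentiableAt ℝ K (γ 0) := by
    rw [hγ0]; exact hKx.differentiableAt (by norm_num)
  have hKγ : HasDerivAt (fun τ => K (γ τ)) (fderiv ℝ K x z) 0 := by
    have := hasDerivAt_comp_curve (F := E →L[ℝ] E →L[ℝ] E) hKd (hγ' 0 h0)
    rwa [hV0, hγ0] at this
  refine ⟨γ, X, ⟨hγ0, V, ?_, hV0, ?_⟩, fun i => ⟨hX0 i, fun τ => -K (γ τ) (V τ) (X i τ), ?_, ?_,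
      ?_⟩,
    ?_⟩
  · filter_upwards [hev] with τ hτ using hγ' τ hτ
  · have := hV' 0 h0
    rwa [hγ0, hV0] at this
  · filter_upwards [hev] with τ hτ using hX' τ hτ i
  · beta_reduce; rw [hγ0, hV0, hX0]
  · have := ((hKγ.clm_apply (hV' 0 h0)).clm_apply (hX' 0 h0 i)).neg
    rw [hγ0, hV0, hX0] at this
    refine this.congr_deriv ?_
    simp [parallelSecond]
    abel
  · have hcont : ContinuousAt γ 0 := (hγ' 0 h0).continuousAt
    have hUev : ∀ᶠ τ in 𝓝 (0 : ℝ), γ τ ∈ U :=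
      hcont.eventually (by rw [hγ0]; exact hU.mem_nhds hx)
    obtain ⟨δ, hδ, hball⟩ := Metric.eventually_nhds_iff_ball.1 (hev.and hUev)
    filter_upwards [Metric.ball_mem_nhds (0 : ℝ) hδ] with τ hτ
    refine ⟨(hball τ hτ).2, fun i j => ?_⟩
    -- metric compatibility makes the derivative of each product vanish
    have hder : ∀ s ∈ Metric.ball (0 : ℝ) δ,
        HasDerivAt (fun s => g (γ s) (X i s) (X j s)) 0 s := by
      intro s hs
      obtain ⟨hs1, hs2⟩ := hball s hs
      have hgs : HasDerivAt (fun s => g (γ s)) (fderiv ℝ g (γ s) (V s)) s :=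
        hasDerivAt_comp_curve (F := E →L[ℝ] E →L[ℝ] ℝ) (hg _ hs2) (hγ' s hs1)
      refine ((hgs.clm_apply (hX' s hs1 i)).clm_apply (hX' s hs1 j)).congr_deriv ?_
      simp [hcompat _ hs2]
    have := Metric.isOpen_ball.is_const_of_deriv_eq_zero
      (convex_ball (0 : ℝ) δ).isPreconnected
      (fun s hs => (hder s hs).differentiableAt.differentiableWithinAt)
      (fun s hs => (hder s hs).deriv) hτ (Metric.mem_ball_self hδ)
    simpa only [hγ0, hX0] using this

end Parallel

/-! ### The covariant Hessian and the commutation of covariant derivatives -/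

section Commutation

variable {E : Type*} [NormedAddCommGroup E] [NormedSpace ℝ E]

/-- The covariant Hessian for the connection with Christoffel symbols `K`. -/
def covHess (K : E → E →L[ℝ] E →L[ℝ] E) (u : E → ℝ) (x v w : E) : ℝ :=
  fderiv ℝ (fderiv ℝ u) x v w - fderiv ℝ u x (K x v w)

/-- The covariant derivative in direction `z` of the covariant Hessian, evaluated at `v`, `w`. -/
def covThird (K : E → E →L[ℝ] E →L[ℝ] E) (u : E → ℝ) (x z v w : E) : ℝ :=
  fderiv ℝ (fderiv ℝ (fderiv ℝ u)) x z v w - fderiv ℝ (fderiv ℝ u) x z (K x v w)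
    - fderiv ℝ u x (fderiv ℝ K x z v w) - covHess K u x (K x z v) w - covHess K u x v (K x z w)

/-- The terms of second and first order in the second covariant derivative of the Hessian. -/
def covFourthLow (K : E → E →L[ℝ] E →L[ℝ] E) (u : E → ℝ) (x z v : E) : ℝ :=
  let D2 := fderiv ℝ (fderiv ℝ u) x
  let w1 := fderiv ℝ K x z v v - K x (K x z v) v - K x v (K x z v)
  let w2 := fderiv ℝ (fderiv ℝ K) x z z v v - fderiv ℝ K x (K x z z) v v
    - 2 • fderiv ℝ K x z (K x z v) v - 2 • fderiv ℝ K x z v (K x z v)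
    + K x (parallelSecond K x z v) v + K x v (parallelSecond K x z v)
    + 2 • K x (K x z v) (K x z v)
  2 * D2 (K x z v) (K x z v) + D2 (parallelSecond K x z v) v + D2 v (parallelSecond K x z v)
    + D2 (K x z z) (K x v v) - 2 * D2 z w1 - fderiv ℝ u x w2

/-- The second covariant derivative in direction `z` of the covariant Hessian, evaluated at
`v`, `v`. -/
def covFourth (K : E → E →L[ℝ] E →L[ℝ] E) (u : E → ℝ) (x z v : E) : ℝ :=
  let D3 := fderiv ℝ (fderiv ℝ (fderiv ℝ u)) x
  fderiv ℝ (fderiv ℝ (fderiv ℝ (fderiv ℝ u))) x z z v v - D3 (K x z z) v v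
    - 2 * D3 z (K x z v) v - 2 * D3 z v (K x z v) - D3 z z (K x v v) + covFourthLow K u x z v

variable {K : E → E →L[ℝ] E →L[ℝ] E} {u : E → ℝ} {x : E}

theorem jet2_fderiv_apply (hu : ContDiffAt ℝ 3 u x) {γ X : ℝ → E} {z v : E}
    (hγ : Jet2 γ x z (-K x z z)) (hX : Jet2 X v (-K x z v) (parallelSecond K x z v)) :
    Jet2 (fun τ => fderiv ℝ u (γ τ) (X τ)) (fderiv ℝ u x v) (covHess K u x z v)
      (covThird K u x z z v) := by
  have h1 := (hγ.comp (hu.fderiv_right (m := 2) (by norm_num))).clm_apply hX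
  refine h1.of_eq rfl ?_ ?_
  · simp [covHess]; ring
  · simp [covThird, covHess, parallelSecond]; ring

theorem jet2_covHess (hu : ContDiffAt ℝ 4 u x) (hK : ContDiffAt ℝ 2 K x) {γ X : ℝ → E} {z v : E}
    (hγ : Jet2 γ x z (-K x z z)) (hX : Jet2 X v (-K x z v) (parallelSecond K x z v)) :
    Jet2 (fun τ => covHess K u (γ τ) (X τ) (X τ)) (covHess K u x v v) (covThird K u x z v v)
      (covFourth K u x z v) := by
  have hu1 : ContDiffAt ℝ 3 (fderiv ℝ u) x := hu.fderiv_right (by norm_num)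
  have hu2 : ContDiffAt ℝ 2 (fderiv ℝ (fderiv ℝ u)) x := hu1.fderiv_right (by norm_num)
  have h1 := ((hγ.comp hu2).clm_apply hX).clm_apply hX
  have h2 := (hγ.comp (hu1.of_le (by norm_num))).clm_apply (((hγ.comp hK).clm_apply hX).clm_apply
      hX)
  refine (h1.sub h2).of_eq rfl ?_ ?_
  · simp [covThird, covHess]; ring
  · simp [covFourth, covFourthLow, two_smul]; ring

end Commutation

section Symmetry

variable {E : Type*} [NormedAddCommGroup E] [NormedSpace ℝ E] {F : Type*} [NormedAddCommGroup F]
  [NormedSpace ℝ F] {u : E → ℝ} {x : E}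

theorem fderiv_swap {A : E → E →L[ℝ] E →L[ℝ] F} (hA : DifferentiableAt ℝ A x)
    (hs : ∀ᶠ y in 𝓝 x, ∀ v w, A y v w = A y w v) (z v w : E) :
    fderiv ℝ A x z v w = fderiv ℝ A x z w v := by
  have h1 : ∀ a b : E, HasFDerivAt (fun y => A y a b)
      (((fderiv ℝ A x).flip a).flip b) x := by
    intro a b
    have := (hA.hasFDerivAt.clm_apply (hasFDerivAt_const a x)).clm_apply (hasFDerivAt_const b x)
    refine this.congr_fderiv ?_
    ext; simp
  have h2 : (fun y => A y v w) =ᶠ[𝓝 x] fun y => A y w v := by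
    filter_upwards [hs] with y hy using hy v w
  have h3 := (h1 v w).unique ((h1 w v).congr_of_eventuallyEq h2)
  simpa using congrArg (fun L => L z) h3

theorem fderiv_fderiv_symm {f : E → F} (hf : ContDiffAt ℝ 2 f x) (v w : E) :
    fderiv ℝ (fderiv ℝ f) x v w = fderiv ℝ (fderiv ℝ f) x w v :=
  (hf.isSymmSndFDerivAt (by simp)).eq v w

theorem fderiv_fderiv_symm_eventually {f : E → F} (hf : ContDiffAt ℝ 2 f x) :
    ∀ᶠ y in 𝓝 x, ∀ v w, fderiv ℝ (fderiv ℝ f) y v w = fderiv ℝ (fderiv ℝ f) y w v := by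
  filter_upwards [hf.eventually (by simp)] with y hy using fderiv_fderiv_symm hy

theorem third_symm (hu : ContDiffAt ℝ 3 u x) (z v w : E) :
    fderiv ℝ (fderiv ℝ (fderiv ℝ u)) x z v w = fderiv ℝ (fderiv ℝ (fderiv ℝ u)) x z w v ∧
    fderiv ℝ (fderiv ℝ (fderiv ℝ u)) x z v w = fderiv ℝ (fderiv ℝ (fderiv ℝ u)) x v z w := by
  have h1 : ContDiffAt ℝ 2 (fderiv ℝ u) x := hu.fderiv_right (by norm_num)
  have h2 : ContDiffAt ℝ 1 (fderiv ℝ (fderiv ℝ u)) x := h1.fderiv_right (by norm_num)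
  refine ⟨fderiv_swap (h2.differentiableAt (by norm_num))
    (fderiv_fderiv_symm_eventually (hu.of_le (by norm_num))) z v w, ?_⟩
  rw [fderiv_fderiv_symm h1]

theorem fourth_symm (hu : ContDiffAt ℝ 4 u x) (z v : E) :
    fderiv ℝ (fderiv ℝ (fderiv ℝ (fderiv ℝ u))) x z z v v =
      fderiv ℝ (fderiv ℝ (fderiv ℝ (fderiv ℝ u))) x v v z z := by
  have h1 : ContDiffAt ℝ 3 (fderiv ℝ u) x := hu.fderiv_right (by norm_num)
  have h2 : ContDiffAt ℝ 2 (fderiv ℝ (fderiv ℝ u)) x := h1.fderiv_right (by norm_num)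
  have h3 : ContDiffAt ℝ 1 (fderiv ℝ (fderiv ℝ (fderiv ℝ u))) x := h2.fderiv_right (by norm_num)
  have hd := h3.differentiableAt (by norm_num)
  have hmid : ∀ a b c d : E, fderiv ℝ (fderiv ℝ (fderiv ℝ (fderiv ℝ u))) x a b c d =
      fderiv ℝ (fderiv ℝ (fderiv ℝ (fderiv ℝ u))) x a c b d := by
    intro a b c d
    rw [fderiv_swap hd (fderiv_fderiv_symm_eventually (h1.of_le (by norm_num)))]
  have hfirst : ∀ a b c d : E, fderiv ℝ (fderiv ℝ (fderiv ℝ (fderiv ℝ u))) x a b c d =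
      fderiv ℝ (fderiv ℝ (fderiv ℝ (fderiv ℝ u))) x b a c d := by
    intro a b c d
    rw [fderiv_fderiv_symm h2]
  have hlast : ∀ a b c d : E, fderiv ℝ (fderiv ℝ (fderiv ℝ (fderiv ℝ u))) x a b c d =
      fderiv ℝ (fderiv ℝ (fderiv ℝ (fderiv ℝ u))) x a b d c := by
    intro a b c d
    have hA : DifferentiableAt ℝ (fun y => fderiv ℝ (fderiv ℝ (fderiv ℝ u)) y b) x :=
      hd.clm_apply (differentiableAt_const b)
    have h4 := fderiv_swap hA (by
      filter_upwards [hu.eventually (by simp)] with y hy v w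
      exact (third_symm (hy.of_le (by norm_num)) b v w).1) a c d
    have h5 : ∀ p : E, fderiv ℝ (fun y => fderiv ℝ (fderiv ℝ (fderiv ℝ u)) y b) x p =
        fderiv ℝ (fderiv ℝ (fderiv ℝ (fderiv ℝ u))) x p b := by
      intro p
      rw [(hd.hasFDerivAt.clm_apply (hasFDerivAt_const b x)).fderiv]
      simp
    rwa [h5] at h4
  rw [hmid, hfirst, hlast, hmid]

end Symmetry

section Bounds

variable {E : Type*} [NormedAddCommGroup E] [NormedSpace ℝ E] {F : Type*} [NormedAddCommGroup F]
  [NormedSpace ℝ F]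

theorem norm_apply₂_le {A : E →L[ℝ] E →L[ℝ] F} {v w : E} {a b c : ℝ} (hA : ‖A‖ ≤ a) (hv : ‖v‖ ≤ b)
    (hw : ‖w‖ ≤ c) : ‖A v w‖ ≤ a * b * c := by
  have ha : 0 ≤ a := (norm_nonneg _).trans hA
  have hb : 0 ≤ b := (norm_nonneg _).trans hv
  exact (A.le_opNorm₂ v w).trans (by gcongr)

theorem norm_apply₁_le {A : E →L[ℝ] F} {v : E} {a b : ℝ} (hA : ‖A‖ ≤ a) (hv : ‖v‖ ≤ b) :
    ‖A v‖ ≤ a * b := by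
  have ha : 0 ≤ a := (norm_nonneg _).trans hA
  exact (A.le_opNorm v).trans (by gcongr)

variable {K : E → E →L[ℝ] E →L[ℝ] E} {u : E → ℝ} {x : E} {B : ℝ}

theorem norm_parallelSecond_le (hB : 1 ≤ B) (hK0 : ‖K x‖ ≤ B) (hK1 : ‖fderiv ℝ K x‖ ≤ B) {z v : E}
    (hz : ‖z‖ ≤ B) (hv : ‖v‖ ≤ B) : ‖parallelSecond K x z v‖ ≤ 3 * B ^ 5 := by
  have h1 := norm_apply₂_le (norm_apply₁_le hK1 hz) hz hv
  have h2 := norm_apply₂_le hK0 (norm_apply₂_le hK0 hz hz) hv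
  have h3 := norm_apply₂_le hK0 hz (norm_apply₂_le hK0 hz hv)
  have h4 : B ^ 4 ≤ B ^ 5 := pow_le_pow_right₀ hB (by norm_num)
  calc ‖parallelSecond K x z v‖
      ≤ ‖fderiv ℝ K x z z v‖ + ‖K x (K x z z) v‖ + ‖K x z (K x z v)‖ := by
        unfold parallelSecond
        refine (norm_add₃_le).trans ?_
        rw [norm_neg]
    _ ≤ 3 * B ^ 5 := by linarith

/-- The covariant derivative of the Hessian is symmetric up to a curvature term. -/
theorem abs_covThird_sub_le (hu : ContDiffAt ℝ 3 u x) (hB : 1 ≤ B)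
    (hsymm : ∀ v w, K x v w = K x w v) (hK0 : ‖K x‖ ≤ B) (hK1 : ‖fderiv ℝ K x‖ ≤ B) {z v : E}
    (hz : ‖z‖ ≤ B) (hv : ‖v‖ ≤ B) :
    |covThird K u x z z v - covThird K u x v z z| ≤ 6 * B ^ 5 * ‖fderiv ℝ u x‖ := by
  have h2 := fderiv_fderiv_symm (hu.of_le (by norm_num) : ContDiffAt ℝ 2 u x)
  have h3 : fderiv ℝ (fderiv ℝ (fderiv ℝ u)) x z z v =
      fderiv ℝ (fderiv ℝ (fderiv ℝ u)) x v z z := by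
    rw [(third_symm hu z z v).1, (third_symm hu z v z).2]
  have heq : covThird K u x z z v - covThird K u x v z z =
      fderiv ℝ u x (fderiv ℝ K x v z z - fderiv ℝ K x z z v + K x (K x z z) v + K x z (K x z v)
        - K x (K x z v) z - K x z (K x z v)) := by
    simp only [covThird, covHess, h3, hsymm v z, map_add, map_sub]
    rw [h2 (K x z z) v, h2 (K x z v) z]
    ring
  have b1 := norm_apply₂_le (norm_apply₁_le hK1 hv) hz hz
  have b2 := norm_apply₂_le (norm_apply₁_le hK1 hz) hz hv
  have b3 := norm_apply₂_le hK0 (norm_apply₂_le hK0 hz hz) hv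
  have b4 := norm_apply₂_le hK0 hz (norm_apply₂_le hK0 hz hv)
  have b5 := norm_apply₂_le hK0 (norm_apply₂_le hK0 hz hv) hz
  have hp : B ^ 4 ≤ B ^ 5 := pow_le_pow_right₀ hB (by norm_num)
  rw [heq, ← Real.norm_eq_abs, mul_comm]
  refine norm_apply₁_le le_rfl ?_
  refine (norm_sub_le _ _).trans ?_
  refine (add_le_add_left (norm_sub_le _ _) _).trans ?_
  refine (add_le_add_left (add_le_add_left (norm_add_le _ _) _) _).trans ?_
  refine (add_le_add_left (add_le_add_left (add_le_add_left (norm_add_le _ _) _) _) _).trans ?_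
  refine (add_le_add_left (add_le_add_left (add_le_add_left (add_le_add_left
    (norm_sub_le _ _) _) _) _) _).trans ?_
  linarith

theorem abs_covFourthLow_le (hB : 1 ≤ B) (hK0 : ‖K x‖ ≤ B) (hK1 : ‖fderiv ℝ K x‖ ≤ B)
    (hK2 : ‖fderiv ℝ (fderiv ℝ K) x‖ ≤ B) {z v : E} (hz : ‖z‖ ≤ B) (hv : ‖v‖ ≤ B) :
    |covFourthLow K u x z v| ≤
      15 * B ^ 7 * (‖fderiv ℝ (fderiv ℝ u) x‖ + ‖fderiv ℝ u x‖) := by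
  have hB0 : 0 ≤ B := by linarith
  have hps := norm_parallelSecond_le hB hK0 hK1 hz hv
  set D1 := fderiv ℝ u x
  set D2 := fderiv ℝ (fderiv ℝ u) x
  have kzv := norm_apply₂_le hK0 hz hv
  have kzz := norm_apply₂_le hK0 hz hz
  have kvv := norm_apply₂_le hK0 hv hv
  have p45 : B ^ 4 ≤ B ^ 7 := pow_le_pow_right₀ hB (by norm_num)
  have p57 : B ^ 5 ≤ B ^ 7 := pow_le_pow_right₀ hB (by norm_num)
  have p67 : B ^ 6 ≤ B ^ 7 := pow_le_pow_right₀ hB (by norm_num)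
  have p7 : 0 ≤ B ^ 7 := by positivity
  have p46 : B ^ 4 ≤ B ^ 5 := pow_le_pow_right₀ hB (by norm_num)
  have hw1 : ‖fderiv ℝ K x z v v - K x (K x z v) v - K x v (K x z v)‖ ≤ 3 * B ^ 5 := by
    have b1 := norm_apply₂_le (norm_apply₁_le hK1 hz) hv hv
    have b2 := norm_apply₂_le hK0 kzv hv
    have b3 := norm_apply₂_le hK0 hv kzv
    refine (norm_sub_le _ _).trans ?_
    refine (add_le_add_left (norm_sub_le _ _) _).trans ?_
    linarith
  have hw2 : ‖fderiv ℝ (fderiv ℝ K) x z z v v - fderiv ℝ K x (K x z z) v v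
      - 2 • fderiv ℝ K x z (K x z v) v - 2 • fderiv ℝ K x z v (K x z v)
      + K x (parallelSecond K x z v) v + K x v (parallelSecond K x z v)
      + 2 • K x (K x z v) (K x z v)‖ ≤ 15 * B ^ 7 := by
    have b1 := norm_apply₂_le (norm_apply₂_le hK2 hz hz) hv hv
    have b2 := norm_apply₂_le (norm_apply₁_le hK1 kzz) hv hv
    have b3 := norm_apply₂_le (norm_apply₁_le hK1 hz) kzv hv
    have b4 := norm_apply₂_le (norm_apply₁_le hK1 hz) hv kzv
    have b5 := norm_apply₂_le hK0 hps hv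
    have b6 := norm_apply₂_le hK0 hv hps
    have b7 := norm_apply₂_le hK0 kzv kzv
    simp only [two_smul]
    refine (norm_add_le _ _).trans ?_
    refine (add_le_add_left (norm_add_le _ _) _).trans ?_
    refine (add_le_add_left (add_le_add_left (norm_add_le _ _) _) _).trans ?_
    refine (add_le_add_left (add_le_add_left (add_le_add_left (norm_sub_le _ _) _) _) _).trans ?_
    refine (add_le_add_left (add_le_add_left (add_le_add_left (add_le_add_left
      (norm_sub_le _ _) _) _) _) _).trans ?_
    refine (add_le_add_left (add_le_add_left (add_le_add_left (add_le_add_left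
      (add_le_add_left (norm_sub_le _ _) _) _) _) _) _).trans ?_
    refine (add_le_add (add_le_add_left (add_le_add_left (add_le_add (add_le_add_right
      (norm_add_le _ _) _) (norm_add_le _ _)) _) _) (norm_add_le _ _)).trans ?_
    linarith
  have c1 := norm_apply₂_le (le_refl ‖D2‖) kzv kzv
  have c2 := norm_apply₂_le (le_refl ‖D2‖) hps hv
  have c3 := norm_apply₂_le (le_refl ‖D2‖) hv hps
  have c4 := norm_apply₂_le (le_refl ‖D2‖) kzz kvv
  have c5 := norm_apply₂_le (le_refl ‖D2‖) hz hw1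
  have c6 := norm_apply₁_le (le_refl ‖D1‖) hw2
  have hD : ‖D2‖ * B ^ 6 ≤ ‖D2‖ * B ^ 7 := by gcongr
  rw [Real.norm_eq_abs] at c1 c2 c3 c4 c5 c6
  rw [abs_le] at c1 c2 c3 c4 c5 c6
  simp only [covFourthLow]
  rw [abs_le]
  have hD1 : 0 ≤ ‖D1‖ * B ^ 7 := by positivity
  constructor <;> linarith [c1.1, c1.2, c2.1, c2.2, c3.1, c3.2, c4.1, c4.2, c5.1, c5.2, c6.1, c6.2]

/-- Second covariant derivatives of the Hessian commute up to terms of lower order. -/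
theorem abs_covFourth_sub_le (hu : ContDiffAt ℝ 4 u x) (hB : 1 ≤ B)
    (hsymm : ∀ v w, K x v w = K x w v) (hK0 : ‖K x‖ ≤ B) (hK1 : ‖fderiv ℝ K x‖ ≤ B)
    (hK2 : ‖fderiv ℝ (fderiv ℝ K) x‖ ≤ B) {z v : E} (hz : ‖z‖ ≤ B) (hv : ‖v‖ ≤ B) :
    |covFourth K u x z v - covFourth K u x v z| ≤
      30 * B ^ 7 * (‖fderiv ℝ (fderiv ℝ u) x‖ + ‖fderiv ℝ u x‖) := by
  have h3 := third_symm (hu.of_le (by norm_num) : ContDiffAt ℝ 3 u x)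
  have e1 : fderiv ℝ (fderiv ℝ (fderiv ℝ u)) x z (K x z v) v =
      fderiv ℝ (fderiv ℝ (fderiv ℝ u)) x v (K x z v) z := by
    rw [(h3 _ _ _).2, (h3 _ _ _).1, (h3 _ _ _).2]
  have e2 : fderiv ℝ (fderiv ℝ (fderiv ℝ u)) x z v (K x z v) =
      fderiv ℝ (fderiv ℝ (fderiv ℝ u)) x v z (K x z v) := (h3 _ _ _).2
  have e3 : ∀ p q : E, fderiv ℝ (fderiv ℝ (fderiv ℝ u)) x p q q =
      fderiv ℝ (fderiv ℝ (fderiv ℝ u)) x q q p := by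
    intro p q
    rw [(h3 p q q).2, (h3 q p q).1]
  have heq : covFourth K u x z v - covFourth K u x v z =
      covFourthLow K u x z v - covFourthLow K u x v z := by
    simp only [covFourth, hsymm v z, fourth_symm hu z v, e1, e2, e3 (K x z z), e3 (K x v v)]
    ring
  have l1 := abs_covFourthLow_le (u := u) hB hK0 hK1 hK2 hz hv
  have l2 := abs_covFourthLow_le (u := u) hB hK0 hK1 hK2 hv hz
  rw [heq]
  refine (abs_sub _ _).trans ?_
  linarith

end Bounds

/-! ### The algebra of the maximum principle -/

section Algebra

variable {n : ℕ}

theorem abs_sum_le_of_le {f : Fin n → ℝ} {c : ℝ} (h : ∀ i, |f i| ≤ c) : |∑ i, f i| ≤ n * c := by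
  refine (Finset.abs_sum_le_sum_abs _ _).trans ?_
  refine (Finset.sum_le_sum fun i _ => h i).trans ?_
  simp

theorem abs_mul_le_mul {a b c d : ℝ} (h1 : |a| ≤ c) (h2 : |b| ≤ d) : |a * b| ≤ c * d := by
  rw [abs_mul]
  exact mul_le_mul h1 h2 (abs_nonneg _) ((abs_nonneg _).trans h1)

theorem abs_weight_le {T C a b f : ℝ} (ha : |a| ≤ C) (hb : |b| ≤ C) (hf0 : 0 ≤ f) (hfT : f ≤ T) :
    |a * f + b * T| ≤ 2 * C * T := by
  have hf : |f| ≤ T := abs_le.2 ⟨by linarith, hfT⟩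
  have hT : |T| ≤ T := (abs_of_nonneg (hf0.trans hfT)).le
  have := (abs_add_le (a * f) (b * T)).trans (add_le_add (abs_mul_le_mul ha hf)
    (abs_mul_le_mul hb hT))
  linarith

/-- The differential inequality at a maximum of the test function, before estimating the remainder.
Here `u`, `H` are the components of the gradient and of the Hessian in an orthonormal frame, `He` is
the Hessian applied to the top eigenvector, `Fv` is the gradient of the operator,
`A`, `D` are third and `N` fourth covariant derivatives, and a prime marks exchanged indices.
The critical point equation `hIV` and the differentiated equation `hIII` make all products of third
derivatives with the gradient cancel. -/
theorem maximum_identity {Fv u He D D' q1 q2 N N' S2 f1 : Fin n → ℝ}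
    {H A A' S1 w : Fin n → Fin n → ℝ} {P v w1 w2 : Fin n → ℝ} {α M f2 : ℝ}
    (hP : ∀ m, 0 ≤ P m) (hH : ∀ m k, H m k = H k m)
    (hI : ∀ m, N m + 2 * α * ∑ k, (H m k ^ 2 + u k * A m k) - M * q2 m ≤ 0)
    (hIV : ∀ m, D' m + 2 * α * ∑ k, u k * H m k - M * q1 m = 0)
    (hII : 0 ≤ ∑ m, P m * N' m - ∑ m, (v m * (2 * He m ^ 2 + 2 * (u m * D m))
      + 4 * (w1 m * (u m * He m)) + w2 m * u m ^ 2) + ∑ m, Fv m * S2 m - f2)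
    (hIII : ∀ k, 0 = ∑ m, P m * A' m k - ∑ m, (v m * (2 * (u m * H k m)) + w k m * u m ^ 2)
      + ∑ m, Fv m * S1 m k - f1 k) :
    2 * ∑ m, v m * He m ^ 2 + 2 * α * ∑ m, P m * ∑ k, H m k ^ 2 ≤
      M * ∑ m, P m * q2 m - 2 * M * ∑ m, v m * (u m * q1 m)
      - ∑ m, P m * (N m - N' m) - 2 * α * ∑ k, u k * ∑ m, P m * (A m k - A' m k)
      - 2 * ∑ m, v m * (u m * (D m - D' m)) - 4 * ∑ m, w1 m * (u m * He m)
      - ∑ m, w2 m * u m ^ 2 + ∑ m, Fv m * S2 m - f2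
      - 2 * α * ∑ k, u k * (∑ m, w k m * u m ^ 2 - ∑ m, Fv m * S1 m k + f1 k) := by
  have h1 : ∑ m, P m * (N m + 2 * α * ∑ k, (H m k ^ 2 + u k * A m k) - M * q2 m) ≤ 0 :=
    Finset.sum_nonpos fun m _ => mul_nonpos_of_nonneg_of_nonpos (hP m) (hI m)
  have h1' : ∑ m, P m * (N m + 2 * α * ∑ k, (H m k ^ 2 + u k * A m k) - M * q2 m) =
      ∑ m, P m * N m + 2 * α * ∑ m, P m * ∑ k, H m k ^ 2
        + 2 * α * ∑ k, u k * ∑ m, P m * A m k - M * ∑ m, P m * q2 m := by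
    have : ∑ k, u k * ∑ m, P m * A m k = ∑ m, P m * ∑ k, u k * A m k := by
      simp only [Finset.mul_sum]
      rw [Finset.sum_comm]
      exact Finset.sum_congr rfl fun _ _ => Finset.sum_congr rfl fun _ _ => by ring
    rw [this]
    simp only [Finset.sum_add_distrib, Finset.mul_sum]
    simp only [← Finset.sum_add_distrib, ← Finset.sum_sub_distrib, mul_add, mul_sub, Finset.mul_sum]
    refine Finset.sum_congr rfl fun m _ => ?_
    simp only [Finset.sum_add_distrib]
    have e1 : ∑ k, P m * (2 * α * H m k ^ 2) = ∑ k, 2 * α * (P m * H m k ^ 2) :=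
      Finset.sum_congr rfl fun _ _ => by ring
    have e2 : ∑ k, P m * (2 * α * (u k * A m k)) = ∑ k, 2 * α * (P m * (u k * A m k)) :=
      Finset.sum_congr rfl fun _ _ => by ring
    rw [e1, e2]
    ring
  have hN : ∑ m, P m * (N m - N' m) = ∑ m, P m * N m - ∑ m, P m * N' m := by
    simp only [mul_sub, Finset.sum_sub_distrib]
  have hA : ∑ k, u k * ∑ m, P m * (A m k - A' m k) =
      ∑ k, u k * ∑ m, P m * A m k - ∑ k, u k * ∑ m, P m * A' m k := by
    simp only [mul_sub, Finset.sum_sub_distrib]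
  have hA' : ∑ k, u k * ∑ m, P m * A' m k =
      ∑ k, u k * ∑ m, v m * (2 * (u m * H k m))
        + ∑ k, u k * (∑ m, w k m * u m ^ 2 - ∑ m, Fv m * S1 m k + f1 k) := by
    rw [← Finset.sum_add_distrib]
    refine Finset.sum_congr rfl fun k _ => ?_
    rw [← mul_add]
    congr 1
    have := hIII k
    rw [Finset.sum_add_distrib] at this
    linarith
  have hD : ∑ m, v m * (u m * (D m - D' m)) =
      ∑ m, v m * (u m * D m) + α * ∑ k, u k * ∑ m, v m * (2 * (u m * H k m))
        - M * ∑ m, v m * (u m * q1 m) := by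
    have : α * ∑ k, u k * ∑ m, v m * (2 * (u m * H k m)) =
        ∑ m, v m * (u m * (2 * α * ∑ k, u k * H m k)) := by
      simp only [Finset.mul_sum]
      rw [Finset.sum_comm]
      exact Finset.sum_congr rfl fun m _ => Finset.sum_congr rfl fun k _ => by
        rw [hH k m]; ring
    rw [this, Finset.mul_sum, ← Finset.sum_add_distrib, ← Finset.sum_sub_distrib]
    refine Finset.sum_congr rfl fun m _ => ?_
    rw [eq_sub_of_add_eq (sub_eq_zero.1 (hIV m))]
    ring
  have hII' : ∑ m, (v m * (2 * He m ^ 2 + 2 * (u m * D m))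
      + 4 * (w1 m * (u m * He m)) + w2 m * u m ^ 2) =
      2 * ∑ m, v m * He m ^ 2 + 2 * ∑ m, v m * (u m * D m) + 4 * ∑ m, w1 m * (u m * He m)
        + ∑ m, w2 m * u m ^ 2 := by
    simp only [Finset.mul_sum, ← Finset.sum_add_distrib]
    exact Finset.sum_congr rfl fun m _ => by ring
  rw [h1'] at h1
  rw [hII'] at hII
  rw [hN, hA, hA', hD]
  rw [hA'] at hA
  have h2 := congrArg (fun t => 2 * α * t) hA'
  beta_reduce at h2
  linarith only [h2, h1, hII]

theorem remainder_le {n s T C α y q : ℝ} (hn0 : 0 ≤ n) (hs : 1 ≤ s) (hα : 0 ≤ α) (hC : 1 ≤ C)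
    (hT : 1 ≤ T) (hy : 0 ≤ y) (hq : 0 ≤ q) :
    let Z := (n + 1) ^ 2 * (s * (1 + α)) * (C ^ 2 * T) * (1 + y * q + q ^ 3 + y + q ^ 2 + q)
    n * (s * T * (C * (y + q))) ≤ Z ∧ α * (n * (q * (n * (s * T * (C * q))))) ≤ Z ∧
    n * (2 * C * T * (q * (C * q))) ≤ 2 * Z ∧ n * (2 * C * T * (q * y)) ≤ 2 * Z ∧
    n * (2 * C * T * (q * q)) ≤ 2 * Z ∧ n * (T * C) ≤ Z ∧ C * (1 + q ^ 2 + y) ≤ Z ∧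
    α * (n * (q * (n * (2 * C * T * (q * q)) + n * (T * C) + C * (1 + q)))) ≤ 4 * Z ∧ 0 ≤ Z := by
  intro Z
  -- every remainder term is a product of four factors, bounded by those of `Z`
  set Q : ℝ := 1 + y * q + q ^ 3 + y + q ^ 2 + q with hQ
  have hZ : Z = (n + 1) ^ 2 * (s * (1 + α)) * (C ^ 2 * T) * Q := rfl
  have hyq : 0 ≤ y * q := mul_nonneg hy hq
  have hq3 : 0 ≤ q ^ 3 := by positivity
  have hq2 : 0 ≤ q ^ 2 := by positivity
  have hs0 : 0 ≤ s := by linarith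
  have hsα : 0 ≤ s * α := mul_nonneg hs0 hα
  have hC0 : 0 ≤ C := by linarith
  have hT0 : 0 ≤ T := by linarith
  have hCT : C * T ≤ C ^ 2 * T := by
    have : 0 ≤ C * T * (C - 1) := mul_nonneg (mul_nonneg hC0 hT0) (by linarith)
    linarith
  have hC1 : C ≤ C ^ 2 * T := by
    have : 0 ≤ C * (T - 1) := mul_nonneg hC0 (by linarith)
    linarith
  have small : ∀ k₁ k₂ k₃ r : ℝ, 0 ≤ k₁ → k₁ ≤ (n + 1) ^ 2 → 0 ≤ k₂ → k₂ ≤ s * (1 + α) →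
      0 ≤ k₃ → k₃ ≤ C ^ 2 * T → 0 ≤ r → r ≤ Q → k₁ * k₂ * k₃ * r ≤ Z := by
    intro k₁ k₂ k₃ r h1 h2 h3 h4 h5 h6 h7 h8
    rw [hZ]
    gcongr
  have kn : n ≤ (n + 1) ^ 2 := by nlinarith
  have kn2 : n ^ 2 ≤ (n + 1) ^ 2 := by nlinarith
  have k1 : (1 : ℝ) ≤ (n + 1) ^ 2 := by nlinarith
  have l1 : 1 ≤ s * (1 + α) := by nlinarith
  have ls : s ≤ s * (1 + α) := by nlinarith
  have lα : α ≤ s * (1 + α) := by nlinarith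
  have lsα : s * α ≤ s * (1 + α) := by nlinarith
  have hCT0 : 0 ≤ C * T := mul_nonneg hC0 hT0
  have hCCT0 : 0 ≤ C ^ 2 * T := by positivity
  have t1 := small n s (C * T) (y + q) hn0 kn hs0 ls hCT0 hCT (by linarith only [hQ, hyq, hq3, hy,
      hq2, hq]) (by linarith only [hQ, hyq, hq3, hy, hq2, hq])
  have t2 := small (n ^ 2) (s * α) (C * T) (q ^ 2) (by positivity) kn2 hsα lsα hCT0 hCT hq2
    (by linarith only [hQ, hyq, hq3, hy, hq2, hq])
  have t3 := small n 1 (C ^ 2 * T) (q ^ 2) hn0 kn one_pos.le l1 hCCT0 le_rfl hq2 (by linarith only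
      [hQ, hyq, hq3, hy, hq2, hq])
  have t4 := small n 1 (C * T) (y * q) hn0 kn one_pos.le l1 hCT0 hCT hyq (by linarith only [hQ,
      hyq, hq3, hy, hq2, hq])
  have t5 := small n 1 (C * T) (q ^ 2) hn0 kn one_pos.le l1 hCT0 hCT hq2 (by linarith only [hQ,
      hyq, hq3, hy, hq2, hq])
  have t6 := small n 1 (C * T) 1 hn0 kn one_pos.le l1 hCT0 hCT one_pos.le (by linarith only [hQ,
      hyq, hq3, hy, hq2, hq])
  have t7 := small 1 1 C (1 + q ^ 2 + y) one_pos.le k1 one_pos.le l1 hC0 hC1 (by linarith only [hQ,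
      hyq, hq3, hy, hq2, hq])
    (by linarith only [hQ, hyq, hq3, hy, hq2, hq])
  have t8 := small (n ^ 2) α (C * T) (q ^ 3) (by positivity) kn2 hα lα hCT0 hCT hq3 (by linarith
      only [hQ, hyq, hq3, hy, hq2, hq])
  have t9 := small (n ^ 2) α (C * T) q (by positivity) kn2 hα lα hCT0 hCT hq (by linarith only [hQ,
      hyq, hq3, hy, hq2, hq])
  have t10 := small n α C (q + q ^ 2) hn0 kn hα lα hC0 hC1 (by linarith only [hQ, hyq, hq3, hy,
      hq2, hq]) (by linarith only [hQ, hyq, hq3, hy, hq2, hq])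
  have hZ0 : 0 ≤ Z := by positivity
  have r1 : n * (s * T * (C * (y + q))) ≤ Z := by linarith only [t1]
  have r2 : α * (n * (q * (n * (s * T * (C * q))))) ≤ Z := by linarith only [t2]
  have r3 : n * (2 * C * T * (q * (C * q))) ≤ 2 * Z := by linarith only [t3]
  have r4 : n * (2 * C * T * (q * y)) ≤ 2 * Z := by linarith only [t4]
  have r5 : n * (2 * C * T * (q * q)) ≤ 2 * Z := by linarith only [t5]
  have r6 : n * (T * C) ≤ Z := by linarith only [t6]
  have r8 : α * (n * (q * (n * (2 * C * T * (q * q)) + n * (T * C) + C * (1 + q)))) ≤ 4 * Z := by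
    linarith only [t8, t9, t10]
  exact ⟨r1, r2, r3, r4, r5, r6, by linarith only [t7], r8, hZ0⟩

/-- The differential inequality at a maximum of the test function. The quantities `y` and `q` bound
the Hessian and the gradient, and `C` bounds the coefficients. -/
theorem maximum_inequality {Fv u He D D' q1 q2 N N' S2 f1 da db : Fin n → ℝ}
    {H A A' S1 : Fin n → Fin n → ℝ} {s T α M f2 C y q a b a1 b1 a2 b2 : ℝ}
    (hF : ∀ m, 0 ≤ Fv m) (hFT : ∑ m, Fv m = T) (hT : 1 ≤ T) (hs : 1 ≤ s) (hα : 0 ≤ α)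
    (hC : 1 ≤ C) (hy : 0 ≤ y) (hq : 0 ≤ q)
    (hH : ∀ m k, H m k = H k m)
    (hI : ∀ m, N m + 2 * α * ∑ k, (H m k ^ 2 + u k * A m k) - M * q2 m ≤ 0)
    (hIV : ∀ m, D' m + 2 * α * ∑ k, u k * H m k - M * q1 m = 0)
    (hII : 0 ≤ ∑ m, (s * T - Fv m) * N' m
      - ∑ m, ((a * Fv m + b * T) * (2 * He m ^ 2 + 2 * (u m * D m))
      + 4 * ((a1 * Fv m + b1 * T) * (u m * He m)) + (a2 * Fv m + b2 * T) * u m ^ 2)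
      + ∑ m, Fv m * S2 m - f2)
    (hIII : ∀ k, 0 = ∑ m, (s * T - Fv m) * A' m k
      - ∑ m, ((a * Fv m + b * T) * (2 * (u m * H k m)) + (da k * Fv m + db k * T) * u m ^ 2)
      + ∑ m, Fv m * S1 m k - f1 k)
    (bHe : ∀ m, |He m| ≤ y) (bu : ∀ m, |u m| ≤ q)
    (bN : ∀ m, |N m - N' m| ≤ C * (y + q)) (bA : ∀ m k, |A m k - A' m k| ≤ C * q)
    (bD : ∀ m, |D m - D' m| ≤ C * q)
    (ba : |a| ≤ C) (bb : |b| ≤ C) (ba1 : |a1| ≤ C) (bb1 : |b1| ≤ C) (ba2 : |a2| ≤ C)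
    (bb2 : |b2| ≤ C) (bda : ∀ k, |da k| ≤ C) (bdb : ∀ k, |db k| ≤ C)
    (bS1 : ∀ m k, |S1 m k| ≤ C) (bS2 : ∀ m, |S2 m| ≤ C) (bf1 : ∀ k, |f1 k| ≤ C * (1 + q))
    (bf2 : |f2| ≤ C * (1 + q ^ 2 + y)) :
    2 * ∑ m, (a * Fv m + b * T) * He m ^ 2 + 2 * α * ∑ m, (s * T - Fv m) * ∑ k, H m k ^ 2 ≤
      M * ∑ m, (s * T - Fv m) * q2 m - 2 * M * ∑ m, (a * Fv m + b * T) * (u m * q1 m)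
      + 40 * (n + 1) ^ 2 * s * (1 + α) * C ^ 2 * T * (1 + y * q + q ^ 3 + y + q ^ 2 + q) := by
  have hFle : ∀ m, Fv m ≤ T := fun m => by
    rw [← hFT]; exact Finset.single_le_sum (fun i _ => hF i) (Finset.mem_univ m)
  have hsT : T ≤ s * T := by nlinarith
  have hP : ∀ m, 0 ≤ s * T - Fv m := fun m => by linarith [hFle m]
  have bP : ∀ m, |s * T - Fv m| ≤ s * T := fun m =>
    abs_le.2 ⟨by linarith [hP m], by linarith [hF m]⟩
  have bF : ∀ m, |Fv m| ≤ T := fun m => abs_le.2 ⟨by linarith [hF m], hFle m⟩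
  have key := maximum_identity (v := fun m => a * Fv m + b * T)
    (w1 := fun m => a1 * Fv m + b1 * T) (w2 := fun m => a2 * Fv m + b2 * T)
    (w := fun k m => da k * Fv m + db k * T) hP hH hI hIV hII hIII
  refine key.trans ?_
  have bu2 : ∀ m, |u m ^ 2| ≤ q * q := fun m => by
    rw [sq]; exact abs_mul_le_mul (bu m) (bu m)
  have e1 := abs_sum_le_of_le fun m => abs_mul_le_mul (bP m) (bN m)
  have e2 := abs_sum_le_of_le fun k => abs_mul_le_mul (bu k)
    (abs_sum_le_of_le fun m => abs_mul_le_mul (bP m) (bA m k))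
  have e3 := abs_sum_le_of_le fun m => abs_mul_le_mul (abs_weight_le ba bb (hF m) (hFle m))
    (abs_mul_le_mul (bu m) (bD m))
  have e4 := abs_sum_le_of_le fun m => abs_mul_le_mul (abs_weight_le ba1 bb1 (hF m) (hFle m))
    (abs_mul_le_mul (bu m) (bHe m))
  have e5 := abs_sum_le_of_le fun m => abs_mul_le_mul (abs_weight_le ba2 bb2 (hF m) (hFle m))
    (bu2 m)
  have e6 := abs_sum_le_of_le fun m => abs_mul_le_mul (bF m) (bS2 m)
  have e8' : ∀ k, |∑ m, (da k * Fv m + db k * T) * u m ^ 2 - ∑ m, Fv m * S1 m k + f1 k| ≤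
      n * (2 * C * T * (q * q)) + n * (T * C) + C * (1 + q) := by
    intro k
    have h1 := abs_sum_le_of_le fun m =>
      abs_mul_le_mul (abs_weight_le (bda k) (bdb k) (hF m) (hFle m)) (bu2 m)
    have h2 := abs_sum_le_of_le fun m => abs_mul_le_mul (bF m) (bS1 m k)
    refine (abs_add_le _ _).trans ?_
    refine (add_le_add_left (abs_sub _ _) _).trans ?_
    exact add_le_add (add_le_add h1 h2) (bf1 k)
  have e8 := abs_sum_le_of_le fun k => abs_mul_le_mul (bu k) (e8' k)
  rw [abs_le] at e1 e2 e3 e4 e5 e6 e8 bf2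
  obtain ⟨r1, r2, r3, r4, r5, r6, r7, r8, hZ0⟩ :=
    remainder_le (Nat.cast_nonneg n : (0 : ℝ) ≤ n) hs hα hC hT hy hq
  have r2' := mul_le_mul_of_nonneg_left e2.1 hα
  have r8' := mul_le_mul_of_nonneg_left e8.1 hα
  linarith only [e1.1, e3.1, e4.1, e5.1, e6.2, bf2.1, r2', r8', r1, r2, r3, r4, r5, r6, r8, r7, hZ0]

/-- Lower bound for the quadratic terms in terms of the top eigenvalue `μ` alone. The coefficient is
affine in `Fv m ∈ [0, T]` and at least `c` at both ends. -/
theorem quadratic_ge_top {Fv He e : Fin n → ℝ} {H : Fin n → Fin n → ℝ} {s T α a b c μ : ℝ}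
    (hF : ∀ m, 0 ≤ Fv m) (hFT : ∑ m, Fv m = T) (hs : 1 ≤ s) (hα : 0 ≤ α)
    (hHe : ∀ m, He m = ∑ k, H m k * e k) (hμ : ∀ m, He m = μ * e m) (he : ∑ m, e m ^ 2 = 1)
    (h0 : c ≤ b + α * s) (h1 : c ≤ a + b + α * (s - 1)) :
    c * T * μ ^ 2 ≤ ∑ m, (a * Fv m + b * T) * He m ^ 2
      + α * ∑ m, (s * T - Fv m) * ∑ k, H m k ^ 2 := by
  have hFle : ∀ m, Fv m ≤ T := fun m => by
    rw [← hFT]; exact Finset.single_le_sum (fun i _ => hF i) (Finset.mem_univ m)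
  rw [Finset.mul_sum, ← Finset.sum_add_distrib]
  calc c * T * μ ^ 2 = ∑ m, c * T * μ ^ 2 * e m ^ 2 := by rw [← Finset.mul_sum, he, mul_one]
    _ ≤ _ := Finset.sum_le_sum fun m _ => ?_
  have hcs : He m ^ 2 ≤ ∑ k, H m k ^ 2 := by
    have := Finset.sum_mul_sq_le_sq_mul_sq Finset.univ (H m) e
    rw [he, mul_one, ← hHe] at this
    exact this
  have hT0 : 0 ≤ T := (hF m).trans (hFle m)
  have hP : 0 ≤ α * (s * T - Fv m) := mul_nonneg hα (by nlinarith [hFle m])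
  have hcoef : c * T ≤ (a * Fv m + b * T) + α * (s * T - Fv m) := by
    nlinarith [mul_le_mul_of_nonneg_right h0 (sub_nonneg.2 (hFle m)),
      mul_le_mul_of_nonneg_right h1 (hF m)]
  calc c * T * μ ^ 2 * e m ^ 2 = c * T * He m ^ 2 := by rw [hμ]; ring
    _ ≤ ((a * Fv m + b * T) + α * (s * T - Fv m)) * He m ^ 2 := by gcongr
    _ ≤ (a * Fv m + b * T) * He m ^ 2 + α * (s * T - Fv m) * ∑ k, H m k ^ 2 := by
      rw [add_mul]; gcongr
    _ = _ := by ring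

/-- Lower bound for the quadratic terms by the full Hessian, when `s ≥ 2`. -/
theorem quadratic_ge_full {Fv He e : Fin n → ℝ} {H : Fin n → Fin n → ℝ} {s T α a b B : ℝ}
    (hF : ∀ m, 0 ≤ Fv m) (hFT : ∑ m, Fv m = T) (hs : 2 ≤ s)
    (hHe : ∀ m, He m = ∑ k, H m k * e k) (he : ∑ m, e m ^ 2 = 1)
    (ha : |a| ≤ B) (hb : |b| ≤ B) (hα : 2 * B + 1 ≤ α) :
    T * ∑ m, ∑ k, H m k ^ 2 ≤ ∑ m, (a * Fv m + b * T) * He m ^ 2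
      + α * ∑ m, (s * T - Fv m) * ∑ k, H m k ^ 2 := by
  have hFle : ∀ m, Fv m ≤ T := fun m => by
    rw [← hFT]; exact Finset.single_le_sum (fun i _ => hF i) (Finset.mem_univ m)
  rw [Finset.mul_sum, Finset.mul_sum, ← Finset.sum_add_distrib]
  refine Finset.sum_le_sum fun m _ => ?_
  have hcs : He m ^ 2 ≤ ∑ k, H m k ^ 2 := by
    have := Finset.sum_mul_sq_le_sq_mul_sq Finset.univ (H m) e
    rw [he, mul_one, ← hHe] at this
    exact this
  have hT0 : 0 ≤ T := (hF m).trans (hFle m)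
  have hS : 0 ≤ ∑ k, H m k ^ 2 := Finset.sum_nonneg fun _ _ => sq_nonneg _
  have hB : 0 ≤ B := (abs_nonneg a).trans ha
  have hw := abs_le.1 (abs_weight_le ha hb (hF m) (hFle m))
  have h1 : -(2 * B * T) * ∑ k, H m k ^ 2 ≤ (a * Fv m + b * T) * He m ^ 2 := by
    have h2 : 2 * B * T * He m ^ 2 ≤ 2 * B * T * ∑ k, H m k ^ 2 := by gcongr
    have h3 := mul_le_mul_of_nonneg_right hw.1 (sq_nonneg (He m))
    linarith
  have h4 : (2 * B + 1) * (T * ∑ k, H m k ^ 2) ≤ α * ((s * T - Fv m) * ∑ k, H m k ^ 2) := by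
    have : T ≤ s * T - Fv m := by nlinarith [hFle m]
    have hα0 : 0 ≤ α := by linarith
    gcongr
  linarith

/-- The power counting at the maximum: the quadratic term dominates the remainder, which has order
`3/2` once weighted with the cut-off `ρ ^ 2`. -/
theorem exists_bound_of_quadratic {c K l α R : ℝ} (hc : 0 < c) (hK : 0 ≤ K) (hl : 1 ≤ l)
    (hα : 0 ≤ α) (hR : 0 < R) :
    ∃ W : ℝ, ∀ y q ρ M : ℝ, 0 ≤ y → 0 ≤ q → 0 < ρ → ρ ≤ R → q ^ 2 ≤ l ^ 2 * (y + 1) →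
      M ≤ ρ ^ 2 * (y + α * q ^ 2) →
      c * y ^ 2 ≤ K * (1 + y * q + q ^ 3 + y + q ^ 2 + q) + K * (M / ρ ^ 4) + K * (M * q / ρ ^ 3) →
      M ≤ W := by
  set A : ℝ := 1 + α * l ^ 2 with hA
  set K₂ : ℝ := 2 / c * (c * R ^ 4 + 6 * K * l ^ 3 * R + K * A + K * A * l) with hK₂
  have hA0 : 0 ≤ A := by positivity
  have hK₂0 : 0 ≤ K₂ := by positivity
  refine ⟨A * (1 + 3 * K₂) ^ 2, fun y q ρ M hy hq hρ hρR hqy hM hmain => ?_⟩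
  set r : ℝ := Real.sqrt (y + 1) with hr
  have hr2 : r ^ 2 = y + 1 := Real.sq_sqrt (by linarith)
  have hr1 : 1 ≤ r := by rw [hr]; exact Real.one_le_sqrt.2 (by linarith)
  have hr0 : 0 ≤ r := by linarith
  have hqr : q ≤ l * r := by
    refine abs_le_of_sq_le_sq' ?_ (by positivity) |>.2
    rw [mul_pow, hr2]; exact hqy
  set w : ℝ := ρ * r with hw
  have hw0 : 0 ≤ w := by positivity
  have hMw : M ≤ A * w ^ 2 := by
    calc M ≤ ρ ^ 2 * (y + α * q ^ 2) := hM
      _ ≤ ρ ^ 2 * (r ^ 2 + α * (l ^ 2 * r ^ 2)) := by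
        rw [hr2]; gcongr; linarith
      _ = A * w ^ 2 := by rw [hw, hA]; ring
  have hQ : 1 + y * q + q ^ 3 + y + q ^ 2 + q ≤ 6 * l ^ 3 * r ^ 3 := by
    have hyr : y ≤ r ^ 2 := by linarith
    have p1 : (1 : ℝ) ≤ l ^ 3 * r ^ 3 := by
      have := one_le_pow₀ hl (n := 3)
      have := one_le_pow₀ hr1 (n := 3)
      nlinarith
    have l13 : l ≤ l ^ 3 := le_self_pow₀ hl (by norm_num)
    have l23 : l ^ 2 ≤ l ^ 3 := pow_le_pow_right₀ hl (by norm_num)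
    have r13 : r ≤ r ^ 3 := le_self_pow₀ hr1 (by norm_num)
    have r23 : r ^ 2 ≤ r ^ 3 := pow_le_pow_right₀ hr1 (by norm_num)
    have l03 : (1 : ℝ) ≤ l ^ 3 := one_le_pow₀ hl
    have p2 : y * q ≤ l ^ 3 * r ^ 3 := by
      calc y * q ≤ r ^ 2 * (l * r) := by gcongr
        _ = l * r ^ 3 := by ring
        _ ≤ l ^ 3 * r ^ 3 := by gcongr
    have p3 : q ^ 3 ≤ l ^ 3 * r ^ 3 := by
      calc q ^ 3 ≤ (l * r) ^ 3 := by gcongr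
        _ = _ := by ring
    have p4 : y ≤ l ^ 3 * r ^ 3 := by
      calc y ≤ 1 * r ^ 3 := by linarith
        _ ≤ _ := by gcongr
    have p5 : q ^ 2 ≤ l ^ 3 * r ^ 3 := by
      calc q ^ 2 ≤ (l * r) ^ 2 := by gcongr
        _ = l ^ 2 * r ^ 2 := by ring
        _ ≤ _ := by gcongr
    have p6 : q ≤ l ^ 3 * r ^ 3 := hqr.trans (by gcongr)
    linarith
  have hy2 : r ^ 4 / 2 - 1 ≤ y ^ 2 := by
    have : y = r ^ 2 - 1 := by linarith
    rw [this]; nlinarith [sq_nonneg (r ^ 2 - 2)]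
  have hpoly : w ^ 4 ≤ K₂ * (1 + w ^ 2 + w ^ 3) := by
    have h1 : ρ ^ 4 * (c * y ^ 2) ≤ ρ ^ 4 * (K * (1 + y * q + q ^ 3 + y + q ^ 2 + q)
        + K * (M / ρ ^ 4) + K * (M * q / ρ ^ 3)) := by gcongr
    have h2 : ρ ^ 4 * (K * (1 + y * q + q ^ 3 + y + q ^ 2 + q)
        + K * (M / ρ ^ 4) + K * (M * q / ρ ^ 3)) =
        K * (ρ ^ 4 * (1 + y * q + q ^ 3 + y + q ^ 2 + q)) + K * M + K * (ρ * q * M) := by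
      field_simp
    have h3 : K * (ρ ^ 4 * (1 + y * q + q ^ 3 + y + q ^ 2 + q)) ≤
        6 * K * l ^ 3 * R * w ^ 3 := by
      calc K * (ρ ^ 4 * (1 + y * q + q ^ 3 + y + q ^ 2 + q))
          ≤ K * (ρ ^ 4 * (6 * l ^ 3 * r ^ 3)) := by gcongr
        _ = 6 * K * l ^ 3 * ρ * w ^ 3 := by rw [hw]; ring
        _ ≤ 6 * K * l ^ 3 * R * w ^ 3 := by gcongr
    have h4 : K * M ≤ K * A * w ^ 2 := by
      calc K * M ≤ K * (A * w ^ 2) := by gcongr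
        _ = _ := by ring
    have h5 : K * (ρ * q * M) ≤ K * A * l * w ^ 3 := by
      calc K * (ρ * q * M) ≤ K * (ρ * q * (A * w ^ 2)) := by gcongr
        _ ≤ K * (ρ * (l * r) * (A * w ^ 2)) := by gcongr
        _ = _ := by rw [hw]; ring
    have h6 : c * (w ^ 4 / 2) - c * R ^ 4 ≤ ρ ^ 4 * (c * y ^ 2) := by
      have h7 : ρ ^ 4 * (c * (r ^ 4 / 2 - 1)) ≤ ρ ^ 4 * (c * y ^ 2) := by gcongr
      have h8 : c * ρ ^ 4 ≤ c * R ^ 4 := by gcongr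
      have h9 : ρ ^ 4 * (c * (r ^ 4 / 2 - 1)) = c * (w ^ 4 / 2) - c * ρ ^ 4 := by rw [hw]; ring
      linarith
    have h10 : c / 2 * w ^ 4 ≤
        (c * R ^ 4 + 6 * K * l ^ 3 * R + K * A + K * A * l) * (1 + w ^ 2 + w ^ 3) := by
      have n1 : 0 ≤ c * R ^ 4 * (w ^ 2 + w ^ 3) := by positivity
      have n2 : 0 ≤ 6 * K * l ^ 3 * R * (1 + w ^ 2) := by positivity
      have n3 : 0 ≤ K * A * (1 + w ^ 3) := by positivity
      have n4 : 0 ≤ K * A * l * (1 + w ^ 2) := by positivity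
      linarith
    calc w ^ 4 = 2 / c * (c / 2 * w ^ 4) := by field_simp
      _ ≤ 2 / c * ((c * R ^ 4 + 6 * K * l ^ 3 * R + K * A + K * A * l) * (1 + w ^ 2 + w ^ 3)) := by
        gcongr
      _ = _ := by rw [hK₂]; ring
  have hwle : w ≤ 1 + 3 * K₂ := by
    by_contra! hlt
    have hw1 : 1 < w := by linarith
    have h1 : w ^ 2 ≤ w ^ 3 := pow_le_pow_right₀ hw1.le (by norm_num)
    have h2 : 1 ≤ w ^ 3 := one_le_pow₀ hw1.le
    have h3 : K₂ * (1 + w ^ 2 + w ^ 3) ≤ K₂ * (3 * w ^ 3) := by gcongr; linarith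
    have h4 : 3 * K₂ * w ^ 3 < w * w ^ 3 := by
      apply mul_lt_mul_of_pos_right _ (by positivity); linarith
    linarith
  exact hMw.trans (by gcongr)

end Algebra

/-! ### Families of functions with uniformly bounded derivatives -/

section JetBdd

variable {ι E F : Type*} [NormedAddCommGroup E] [NormedSpace ℝ E] [NormedAddCommGroup F]
  [NormedSpace ℝ F] {U : Set E} {k : ℕ}

/-- The functions `φ i` are of class `C^k` on `U`, with derivatives up to order `k` bounded on `U`
uniformly in `i`. -/
structure JetBdd (U : Set E) (k : ℕ) (φ : ι → E → F) : Prop where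
  contDiffOn : ∀ i, ContDiffOn ℝ k (φ i) U
  bound : ∀ j ≤ k, ∃ C : ℝ, ∀ i, ∀ x ∈ U, ‖iteratedFDeriv ℝ j (φ i) x‖ ≤ C

namespace JetBdd

theorem of_le {φ : ι → E → F} {m : ℕ} (h : JetBdd U k φ) (hm : m ≤ k) : JetBdd U m φ :=
  ⟨fun i => (h.contDiffOn i).of_le (by exact_mod_cast hm), fun j hj => h.bound j (hj.trans hm)⟩

theorem const (c : F) : JetBdd U k (fun (_ : ι) (_ : E) => c) := by
  refine ⟨fun _ => contDiffOn_const, fun j _ => ⟨‖c‖, fun _ x _ => ?_⟩⟩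
  rcases j with _ | j
  · simp
  · simp [iteratedFDeriv_const_of_ne (𝕜 := ℝ) (Nat.succ_ne_zero j) c]

theorem congr {φ ψ : ι → E → F} (hU : IsOpen U) (h : JetBdd U k φ)
    (he : ∀ i, ∀ x ∈ U, ψ i x = φ i x) : JetBdd U k ψ := by
  refine ⟨fun i => (h.contDiffOn i).congr (he i), fun j hj => ?_⟩
  obtain ⟨C, hC⟩ := h.bound j hj
  refine ⟨C, fun i x hx => ?_⟩
  have : ψ i =ᶠ[𝓝 x] φ i := by
    filter_upwards [hU.mem_nhds hx] with y hy using he i y hy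
  rw [(this.iteratedFDeriv ℝ j).eq_of_nhds]
  exact hC i x hx

theorem add {φ ψ : ι → E → F} (hU : IsOpen U) (h : JetBdd U k φ) (h' : JetBdd U k ψ) :
    JetBdd U k (fun i x => φ i x + ψ i x) := by
  refine ⟨fun i => (h.contDiffOn i).add (h'.contDiffOn i), fun j hj => ?_⟩
  obtain ⟨C, hC⟩ := h.bound j hj
  obtain ⟨C', hC'⟩ := h'.bound j hj
  refine ⟨C + C', fun i x hx => ?_⟩
  have hjk : (j : ℕ∞ω) ≤ k := by exact_mod_cast hj
  have h1 := ((h.contDiffOn i).contDiffAt (hU.mem_nhds hx)).of_le hjk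
  have h2 := ((h'.contDiffOn i).contDiffAt (hU.mem_nhds hx)).of_le hjk
  have := iteratedFDeriv_add_apply h1 h2
  have e : (fun x => φ i x + ψ i x) = φ i + ψ i := rfl
  rw [e, this]
  exact (norm_add_le _ _).trans (add_le_add (hC i x hx) (hC' i x hx))

theorem sum {α : Type*} {s : Finset α} {φ : α → ι → E → F} (hU : IsOpen U)
    (h : ∀ a ∈ s, JetBdd U k (φ a)) : JetBdd U k (fun i x => ∑ a ∈ s, φ a i x) := by
  classical
  induction s using Finset.induction_on with
  | empty => simpa using const (0 : F)
  | insert a s ha ih =>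
    simp only [Finset.sum_insert ha]
    exact (h a (Finset.mem_insert_self a s)).add hU
      (ih fun b hb => h b (Finset.mem_insert_of_mem hb))

theorem smul {φ : ι → E → ℝ} {ψ : ι → E → F} (hU : IsOpen U) (h : JetBdd U k φ)
    (h' : JetBdd U k ψ) : JetBdd U k (fun i x => φ i x • ψ i x) := by
  refine ⟨fun i => (h.contDiffOn i).smul (h'.contDiffOn i), fun j hj => ?_⟩
  choose! C hC using h.bound
  choose! C' hC' using h'.bound
  refine ⟨∑ l ∈ Finset.range (j + 1), (j.choose l : ℝ) * C l * C' (j - l), fun i x hx => ?_⟩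
  have hw := iteratedFDerivWithin_of_isOpen (𝕜 := ℝ) (f := fun x => φ i x • ψ i x) j hU hx
  rw [← hw]
  refine (norm_iteratedFDerivWithin_smul_le (h.contDiffOn i) (h'.contDiffOn i) hU.uniqueDiffOn hx
    (by exact_mod_cast hj)).trans (Finset.sum_le_sum fun l hl => ?_)
  rw [Finset.mem_range] at hl
  rw [iteratedFDerivWithin_of_isOpen (𝕜 := ℝ) l hU hx,
    iteratedFDerivWithin_of_isOpen (𝕜 := ℝ) (j - l) hU hx]
  have h1 := hC l (by omega) i x hx
  have h2 := hC' (j - l) (by omega) i x hx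
  have h3 : 0 ≤ C l := (norm_nonneg _).trans h1
  gcongr

theorem mul {φ ψ : ι → E → ℝ} (hU : IsOpen U) (h : JetBdd U k φ) (h' : JetBdd U k ψ) :
    JetBdd U k (fun i x => φ i x * ψ i x) := h.smul hU h'

theorem prod {α : Type*} {s : Finset α} {φ : α → ι → E → ℝ} (hU : IsOpen U)
    (h : ∀ a ∈ s, JetBdd U k (φ a)) : JetBdd U k (fun i x => ∏ a ∈ s, φ a i x) := by
  classical
  induction s using Finset.induction_on with
  | empty => simpa using const (1 : ℝ)
  | insert a s ha ih =>
    simp only [Finset.prod_insert ha]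
    exact (h a (Finset.mem_insert_self a s)).mul hU
      (ih fun b hb => h b (Finset.mem_insert_of_mem hb))

theorem sub {φ ψ : ι → E → F} (hU : IsOpen U) (h : JetBdd U k φ) (h' : JetBdd U k ψ) :
    JetBdd U k (fun i x => φ i x - ψ i x) := by
  have := h.add hU ((const (-1 : ℝ)).smul hU h')
  simpa [sub_eq_add_neg] using this

theorem clm_comp {F' : Type*} [NormedAddCommGroup F'] [NormedSpace ℝ F'] (L : F →L[ℝ] F')
    {φ : ι → E → F} (hU : IsOpen U) (h : JetBdd U k φ) : JetBdd U k (fun i x => L (φ i x)) := by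
  refine ⟨fun i => L.contDiff.comp_contDiffOn (h.contDiffOn i), fun j hj => ?_⟩
  obtain ⟨C, hC⟩ := h.bound j hj
  refine ⟨‖L‖ * C, fun i x hx => ?_⟩
  refine (L.norm_iteratedFDeriv_comp_left ((h.contDiffOn i).contDiffAt (hU.mem_nhds hx))
    (by exact_mod_cast hj)).trans ?_
  gcongr
  exact hC i x hx

theorem fderiv {φ : ι → E → F} (hU : IsOpen U) (h : JetBdd U (k + 1) φ) :
    JetBdd U k (fun i => fderiv ℝ (φ i)) := by
  refine ⟨fun i => ?_, fun j hj => ?_⟩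
  · exact (h.contDiffOn i).fderiv_of_isOpen hU (by norm_cast)
  · obtain ⟨C, hC⟩ := h.bound (j + 1) (by omega)
    exact ⟨C, fun i x hx => by rw [norm_iteratedFDeriv_fderiv]; exact hC i x hx⟩

theorem of_fderiv {φ : ι → E → F} (hU : IsOpen U) (h0 : JetBdd U 0 φ)
    (hd : ∀ i, DifferentiableOn ℝ (φ i) U) (h1 : JetBdd U k (fun i => _root_.fderiv ℝ (φ i))) :
    JetBdd U (k + 1) φ := by
  refine ⟨fun i => ?_, fun j hj => ?_⟩
  · have := (contDiffOn_succ_iff_fderiv_of_isOpen (n := k) hU).2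
      ⟨hd i, by simp, h1.contDiffOn i⟩
    exact_mod_cast this
  · rcases j with _ | j
    · exact h0.bound 0 le_rfl
    · obtain ⟨C, hC⟩ := h1.bound j (by omega)
      exact ⟨C, fun i x hx => by rw [← norm_iteratedFDeriv_fderiv]; exact hC i x hx⟩

theorem inv {φ : ι → E → ℝ} (hU : IsOpen U) (h : JetBdd U k φ) (hne : ∀ i, ∀ x ∈ U, φ i x ≠ 0)
    (hb : ∃ C : ℝ, ∀ i, ∀ x ∈ U, |(φ i x)⁻¹| ≤ C) : JetBdd U k (fun i x => (φ i x)⁻¹) := by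
  induction k with
  | zero =>
    refine ⟨fun i => (h.contDiffOn i).inv (hne i), fun j hj => ?_⟩
    obtain rfl : j = 0 := by omega
    obtain ⟨C, hC⟩ := hb
    exact ⟨C, fun i x hx => by rw [norm_iteratedFDeriv_zero]; exact hC i x hx⟩
  | succ k ih =>
    have h1 := ih (h.of_le (Nat.le_succ k))
    have hd : ∀ i, ∀ x ∈ U, HasFDerivAt (φ i) (_root_.fderiv ℝ (φ i) x) x := fun i x hx =>
      (((h.contDiffOn i).contDiffAt (hU.mem_nhds hx)).differentiableAt
        (by simp)).hasFDerivAt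
    have hd' : ∀ i, ∀ x ∈ U, HasFDerivAt (fun x => (φ i x)⁻¹)
        ((-1 * ((φ i x)⁻¹ * (φ i x)⁻¹)) • _root_.fderiv ℝ (φ i) x) x := fun i x hx => by
      refine (hasDerivAt_inv (hne i x hx)).comp_hasFDerivAt x (hd i x hx) |>.congr_fderiv ?_
      congr 1
      field_simp
    refine of_fderiv hU (h1.of_le (Nat.zero_le k))
      (fun i x hx => (hd' i x hx).differentiableAt.differentiableWithinAt) ?_
    refine JetBdd.congr hU ((((const (-1 : ℝ)).mul hU (h1.mul hU h1))).smul hU (h.fderiv hU)) ?_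
    exact fun i x hx => (hd' i x hx).fderiv

theorem exists_bound {φ : ι → E → F} (h : JetBdd U k φ) :
    ∃ C : ℝ, 1 ≤ C ∧ ∀ j ≤ k, ∀ i, ∀ x ∈ U, ‖iteratedFDeriv ℝ j (φ i) x‖ ≤ C := by
  choose! C hC using h.bound
  refine ⟨1 + ∑ j ∈ Finset.range (k + 1), |C j|, ?_, fun j hj i x hx => ?_⟩
  · have : 0 ≤ ∑ j ∈ Finset.range (k + 1), |C j| := Finset.sum_nonneg fun _ _ => abs_nonneg _
    linarith
  · have h1 := Finset.single_le_sum (f := fun j => |C j|) (fun _ _ => abs_nonneg _)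
      (Finset.mem_range.2 (Nat.lt_succ_of_le hj))
    have h2 := hC j hj i x hx
    have h3 := le_abs_self (C j)
    linarith

theorem exists_bound_two {φ : ι → E → F} (h : JetBdd U 2 φ) :
    ∃ C : ℝ, 1 ≤ C ∧ ∀ i, ∀ x ∈ U, ‖φ i x‖ ≤ C ∧ ‖_root_.fderiv ℝ (φ i) x‖ ≤ C ∧
      ‖_root_.fderiv ℝ (_root_.fderiv ℝ (φ i)) x‖ ≤ C := by
  obtain ⟨C, hC1, hC⟩ := h.exists_bound
  refine ⟨C, hC1, fun i x hx => ⟨?_, ?_, ?_⟩⟩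
  · simpa using hC 0 (by norm_num) i x hx
  · rw [← norm_iteratedFDeriv_one]
    exact hC 1 (by norm_num) i x hx
  · rw [← norm_iteratedFDeriv_one, norm_iteratedFDeriv_fderiv]
    exact hC 2 le_rfl i x hx

end JetBdd

end JetBdd

/-! ### Forms and connections in coordinates -/

section Forms

variable {n : ℕ}

/-- The coordinate space, with its Euclidean norm. -/
abbrev Coord (n : ℕ) := EuclideanSpace ℝ (Fin n)

/-- The bilinear form with a given matrix. -/
def toForm (A : Matrix (Fin n) (Fin n) ℝ) : Coord n →L[ℝ] Coord n →L[ℝ] ℝ :=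
  ∑ i, ∑ j, A i j • (EuclideanSpace.proj i : Coord n →L[ℝ] ℝ).smulRight
    (EuclideanSpace.proj j : Coord n →L[ℝ] ℝ)

theorem toForm_apply (A : Matrix (Fin n) (Fin n) ℝ) (v w : Coord n) :
    toForm A v w = ∑ i, ∑ j, A i j * (v i * w j) := by
  simp [toForm]

theorem toForm_apply_eq_dotProduct (A : Matrix (Fin n) (Fin n) ℝ) (v w : Coord n) :
    toForm A v w = v.ofLp ⬝ᵥ A.mulVec w.ofLp := by
  rw [toForm_apply, dotProduct]
  refine Finset.sum_congr rfl fun i _ => ?_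
  rw [Matrix.mulVec, dotProduct, Finset.mul_sum]
  exact Finset.sum_congr rfl fun j _ => by ring

/-- The Christoffel symbols as a bilinear map with values in the coordinate space. -/
def christoffelMap (G : Coord n → Matrix (Fin n) (Fin n) ℝ) (x : Coord n) :
    Coord n →L[ℝ] Coord n →L[ℝ] Coord n :=
  ∑ k, ∑ i, ∑ j, christoffel G k i j x • (EuclideanSpace.proj i : Coord n →L[ℝ] ℝ).smulRight
    ((EuclideanSpace.proj j : Coord n →L[ℝ] ℝ).smulRight (EuclideanSpace.single k (1 : ℝ)))

theorem christoffelMap_apply (G : Coord n → Matrix (Fin n) (Fin n) ℝ) (x v w : Coord n) (k : Fin n)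
    :
    christoffelMap G x v w k = ∑ i, ∑ j, christoffel G k i j x * (v i * w j) := by
  simp only [christoffelMap, sum_apply, smul_apply,
    ContinuousLinearMap.smulRight_apply, WithLp.ofLp_sum, Finset.sum_apply, PiLp.smul_apply,
    PiLp.single_apply, smul_eq_mul, PiLp.proj_apply]
  rw [Finset.sum_eq_single k]
  · simp
  · intro l _ hl
    simp [Ne.symm hl]
  · simp

theorem sum_single_smul (v : Coord n) : v = ∑ i, v i • EuclideanSpace.single i (1 : ℝ) := by
  ext j
  simp [Pi.single_apply]

theorem fderiv_apply_eq_sum_pd (φ : Coord n → ℝ) (x v : Coord n) :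
    fderiv ℝ φ x v = ∑ i, v i * pd i φ x := by
  conv_lhs => rw [sum_single_smul v]
  simp [pd]

/-- The form of the coordinate Hessian is the covariant Hessian of the Christoffel map. -/
theorem toForm_hessian {G : Coord n → Matrix (Fin n) (Fin n) ℝ} {u : Coord n → ℝ} {x : Coord n}
    (hu : ContDiffAt ℝ 2 u x) (v w : Coord n) :
    toForm (hessian G u x) v w = covHess (christoffelMap G) u x v w := by
  have hd : DifferentiableAt ℝ (fderiv ℝ u) x :=
    (hu.fderiv_right (m := 1) (by norm_num)).differentiableAt (by norm_num)
  have h2 : ∀ i j, pd i (fun y => pd j u y) x =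
      fderiv ℝ (fderiv ℝ u) x (EuclideanSpace.single i 1) (EuclideanSpace.single j 1) := by
    intro i j
    have := (hd.hasFDerivAt.clm_apply
      (hasFDerivAt_const (EuclideanSpace.single j (1 : ℝ)) x)).fderiv
    simp only [pd, this]
    simp
  have h3 : fderiv ℝ (fderiv ℝ u) x v w = ∑ i, ∑ j, pd i (fun y => pd j u y) x * (v i * w j) := by
    conv_lhs => rw [sum_single_smul v, sum_single_smul w]
    simp only [map_sum, map_smul, sum_apply, smul_apply,
      smul_eq_mul, h2, Finset.mul_sum]
    rw [Finset.sum_comm]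
    exact Finset.sum_congr rfl fun _ _ => Finset.sum_congr rfl fun _ _ => by ring
  have h4 : fderiv ℝ u x (christoffelMap G x v w) =
      ∑ i, ∑ j, (∑ k, christoffel G k i j x * pd k u x) * (v i * w j) := by
    rw [fderiv_apply_eq_sum_pd]
    simp only [christoffelMap_apply, Finset.sum_mul]
    rw [Finset.sum_comm]
    refine Finset.sum_congr rfl fun i _ => ?_
    rw [Finset.sum_comm]
    exact Finset.sum_congr rfl fun _ _ => Finset.sum_congr rfl fun _ _ => by ring
  rw [covHess, h3, h4, toForm_apply, ← Finset.sum_sub_distrib]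
  refine Finset.sum_congr rfl fun i _ => ?_
  rw [← Finset.sum_sub_distrib]
  refine Finset.sum_congr rfl fun j _ => ?_
  simp only [hessian, Matrix.of_apply]
  ring

theorem fderiv_toForm {A : Coord n → Matrix (Fin n) (Fin n) ℝ} {x : Coord n}
    (hA : ∀ i j, DifferentiableAt ℝ (fun y => A y i j) x) :
    HasFDerivAt (fun y => toForm (A y)) (∑ i, ∑ j, (fderiv ℝ (fun y => A y i j) x).smulRight
      ((EuclideanSpace.proj i : Coord n →L[ℝ] ℝ).smulRight
        (EuclideanSpace.proj j : Coord n →L[ℝ] ℝ))) x := by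
  unfold toForm
  exact HasFDerivAt.fun_sum fun i _ => HasFDerivAt.fun_sum fun j _ =>
    (hA i j).hasFDerivAt.smul_const _

/-- The Christoffel symbols of the first kind. -/
theorem sum_mul_christoffel {G : Coord n → Matrix (Fin n) (Fin n) ℝ} {x : Coord n}
    (hG : IsUnit (G x).det) (l i j : Fin n) :
    ∑ k, G x l k * christoffel G k i j x = (1 / 2) *
      (pd i (fun y => G y j l) x + pd j (fun y => G y i l) x - pd l (fun y => G y i j) x) := by
  have h1 : ∀ d : Fin n → ℝ, ∑ k, G x l k * ∑ m, (G x)⁻¹ k m * d m = d l := by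
    intro d
    have := congrFun (Matrix.mulVec_mulVec d (G x) (G x)⁻¹) l
    rw [Matrix.mul_nonsing_inv _ hG, Matrix.one_mulVec] at this
    simpa only [Matrix.mulVec, dotProduct] using this
  rw [← h1 fun m => pd i (fun y => G y j m) x + pd j (fun y => G y i m) x
    - pd m (fun y => G y i j) x, Finset.mul_sum]
  refine Finset.sum_congr rfl fun k _ => ?_
  rw [christoffel]
  ring

theorem christoffel_symm {G : Coord n → Matrix (Fin n) (Fin n) ℝ} {x : Coord n}
    (hsymm : ∀ i j, (fun y => G y i j) =ᶠ[𝓝 x] fun y => G y j i) (k i j : Fin n) :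
    christoffel G k i j x = christoffel G k j i x := by
  unfold christoffel
  congr 1
  refine Finset.sum_congr rfl fun l _ => ?_
  have : pd l (fun y => G y i j) x = pd l (fun y => G y j i) x := by
    simp only [pd, (hsymm i j).fderiv_eq]
  rw [this]
  ring

theorem christoffelMap_symm {G : Coord n → Matrix (Fin n) (Fin n) ℝ} {x : Coord n}
    (hsymm : ∀ i j, (fun y => G y i j) =ᶠ[𝓝 x] fun y => G y j i) (v w : Coord n) :
    christoffelMap G x v w = christoffelMap G x w v := by
  ext k
  rw [christoffelMap_apply, christoffelMap_apply, Finset.sum_comm]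
  exact Finset.sum_congr rfl fun i _ => Finset.sum_congr rfl fun j _ => by
    rw [christoffel_symm hsymm]; ring

theorem toForm_christoffelMap_left {G : Coord n → Matrix (Fin n) (Fin n) ℝ} {x : Coord n}
    (hsymm : ∀ i j, G x i j = G x j i) (hG : IsUnit (G x).det) (z v w : Coord n) :
    toForm (G x) (christoffelMap G x z v) w = ∑ i, ∑ j, ∑ l, (1 / 2) *
      (pd i (fun y => G y j l) x + pd j (fun y => G y i l) x - pd l (fun y => G y i j) x)
        * (z i * v j * w l) := by
  simp only [← sum_mul_christoffel hG, toForm_apply, christoffelMap_apply, Finset.sum_mul,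
    Finset.mul_sum]
  calc _ = ∑ k, ∑ i, ∑ j, ∑ l, G x k l * (christoffel G k i j x * (z i * v j) * w l) := by
        refine Finset.sum_congr rfl fun k _ => ?_
        rw [Finset.sum_comm]
        refine Finset.sum_congr rfl fun i _ => ?_
        rw [Finset.sum_comm]
    _ = ∑ i, ∑ j, ∑ l, ∑ k, G x k l * (christoffel G k i j x * (z i * v j) * w l) := by
        rw [Finset.sum_comm]
        refine Finset.sum_congr rfl fun i _ => ?_
        rw [Finset.sum_comm]
        refine Finset.sum_congr rfl fun j _ => ?_
        rw [Finset.sum_comm]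
    _ = _ := by
        refine Finset.sum_congr rfl fun i _ => Finset.sum_congr rfl fun j _ =>
          Finset.sum_congr rfl fun l _ => Finset.sum_congr rfl fun k _ => ?_
        rw [hsymm k l]
        ring

theorem toForm_symm {A : Matrix (Fin n) (Fin n) ℝ} (hsymm : ∀ i j, A i j = A j i) (v w : Coord n) :
    toForm A v w = toForm A w v := by
  rw [toForm_apply, toForm_apply, Finset.sum_comm]
  exact Finset.sum_congr rfl fun i _ => Finset.sum_congr rfl fun j _ => by
    rw [hsymm]; ring

/-- The Levi-Civita connection is compatible with the metric. -/
theorem fderiv_toForm_metric {G : Coord n → Matrix (Fin n) (Fin n) ℝ} {x : Coord n}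
    (hsymm : ∀ᶠ y in 𝓝 x, ∀ i j, G y i j = G y j i) (hG : IsUnit (G x).det)
    (hd : ∀ i j, DifferentiableAt ℝ (fun y => G y i j) x) (z v w : Coord n) :
    fderiv ℝ (fun y => toForm (G y)) x z v w =
      toForm (G x) (christoffelMap G x z v) w + toForm (G x) v (christoffelMap G x z w) := by
  have hs := hsymm.self_of_nhds
  have hpd : ∀ k i j, pd k (fun y => G y i j) x = pd k (fun y => G y j i) x := by
    intro k i j
    have : (fun y => G y i j) =ᶠ[𝓝 x] fun y => G y j i := by
      filter_upwards [hsymm] with y hy using hy i j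
    simp only [pd, this.fderiv_eq]
  rw [toForm_symm hs v, toForm_christoffelMap_left hs hG, toForm_christoffelMap_left hs hG,
    (fderiv_toForm hd).fderiv]
  simp only [sum_apply, ContinuousLinearMap.smulRight_apply,
    smul_apply, fderiv_apply_eq_sum_pd, smul_eq_mul,
    PiLp.proj_apply]
  calc _ = ∑ i, ∑ j, ∑ l, pd i (fun y => G y j l) x * (z i * v j * w l) := by
        simp only [Finset.sum_mul]
        calc _ = ∑ j, ∑ i, ∑ l, z i * pd i (fun y => G y j l) x * (v j * w l) :=
              Finset.sum_congr rfl fun j _ => Finset.sum_comm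
          _ = _ := by
              rw [Finset.sum_comm]
              exact Finset.sum_congr rfl fun i _ => Finset.sum_congr rfl fun j _ =>
                Finset.sum_congr rfl fun l _ => by ring
    _ = _ := by
        rw [← Finset.sum_add_distrib]
        refine Finset.sum_congr rfl fun i _ => ?_
        have : ∑ j, ∑ l, (1 / 2) * (pd i (fun y => G y j l) x + pd j (fun y => G y i l) x
            - pd l (fun y => G y i j) x) * (z i * w j * v l) =
            ∑ j, ∑ l, (1 / 2) * (pd i (fun y => G y l j) x + pd l (fun y => G y i j) x
            - pd j (fun y => G y i l) x) * (z i * w l * v j) := Finset.sum_comm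
        rw [this, ← Finset.sum_add_distrib]
        refine Finset.sum_congr rfl fun j _ => ?_
        rw [← Finset.sum_add_distrib]
        refine Finset.sum_congr rfl fun l _ => ?_
        rw [hpd i l j]
        ring

end Forms

/-! ### Orthonormal frames -/

section Frames

variable {n : ℕ}

/-- `X` is an orthonormal frame for the inner product with matrix `A`. -/
def IsFrame (A : Matrix (Fin n) (Fin n) ℝ) (X : Fin n → Coord n) : Prop :=
  ∀ k l, toForm A (X k) (X l) = if k = l then 1 else 0

/-- The matrix with columns `X k`. -/
def frameMatrix (X : Fin n → Coord n) : Matrix (Fin n) (Fin n) ℝ := Matrix.of fun i k => X k i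

theorem transpose_mul_mul_frameMatrix (T : Matrix (Fin n) (Fin n) ℝ) (X : Fin n → Coord n) :
    (frameMatrix X).transpose * T * frameMatrix X = Matrix.of fun k l => toForm T (X k) (X l) := by
  ext k l
  simp only [Matrix.mul_apply, Matrix.of_apply, toForm_apply, frameMatrix, Matrix.transpose_apply,
    Finset.sum_mul]
  rw [Finset.sum_comm]
  exact Finset.sum_congr rfl fun _ _ => Finset.sum_congr rfl fun _ _ => by ring

variable {A : Matrix (Fin n) (Fin n) ℝ} {X : Fin n → Coord n}

theorem isFrame_iff :
    IsFrame A X ↔ (frameMatrix X).transpose * A * frameMatrix X = 1 := by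
  rw [transpose_mul_mul_frameMatrix]
  constructor
  · intro h
    ext k l
    rw [Matrix.of_apply, h k l, Matrix.one_apply]
  · intro h k l
    have := congrFun (congrFun h k) l
    rwa [Matrix.of_apply, Matrix.one_apply] at this

theorem IsFrame.mul_transpose (h : IsFrame A X) :
    A⁻¹ = frameMatrix X * (frameMatrix X).transpose := by
  have h1 := isFrame_iff.1 h
  rw [Matrix.mul_assoc] at h1
  have h2 := mul_eq_one_comm.1 h1
  rw [Matrix.mul_assoc] at h2
  exact Matrix.inv_eq_right_inv h2

theorem IsFrame.trace_inv_mul (h : IsFrame A X) (T : Matrix (Fin n) (Fin n) ℝ) :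
    (A⁻¹ * T).trace = ∑ k, toForm T (X k) (X k) := by
  rw [h.mul_transpose, Matrix.mul_assoc, Matrix.trace_mul_comm, transpose_mul_mul_frameMatrix]
  rfl

theorem IsFrame.covectorNormSq_eq (h : IsFrame A X) (w : Fin n → ℝ) :
    covectorNormSq A w = ∑ k, (∑ i, w i * X k i) ^ 2 := by
  rw [covectorNormSq, h.mul_transpose, ← Matrix.mulVec_mulVec, Matrix.dotProduct_mulVec,
    Matrix.mulVec_transpose, dotProduct]
  refine Finset.sum_congr rfl fun k _ => ?_
  rw [sq]
  rfl

theorem IsFrame.tensorNorm_eq (h : IsFrame A X) (T : Matrix (Fin n) (Fin n) ℝ) :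
    tensorNorm A T = Real.sqrt (∑ k, ∑ l, toForm T (X k) (X l) ^ 2) := by
  rw [tensorNorm, h.mul_transpose]
  congr 1
  set M := frameMatrix X
  have h1 : M * M.transpose * T * (M * M.transpose) * T.transpose =
      M * ((M.transpose * T * M) * (M.transpose * T.transpose)) := by
    simp only [Matrix.mul_assoc]
  have h2 : (M.transpose * T * M) * (M.transpose * T.transpose) * M =
      (M.transpose * T * M) * (M.transpose * T * M).transpose := by
    simp only [Matrix.mul_assoc, Matrix.transpose_mul, Matrix.transpose_transpose]
  rw [h1, Matrix.trace_mul_comm, h2, transpose_mul_mul_frameMatrix, Matrix.trace]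
  refine Finset.sum_congr rfl fun k _ => ?_
  rw [Matrix.diag_apply, Matrix.mul_apply]
  exact Finset.sum_congr rfl fun l _ => by simp [sq]

theorem IsFrame.charpoly_eq (h : IsFrame A X) (T : Matrix (Fin n) (Fin n) ℝ) :
    (A⁻¹ * T).charpoly = (Matrix.of fun k l => toForm T (X k) (X l)).charpoly := by
  rw [h.mul_transpose, Matrix.mul_assoc, Matrix.charpoly_mul_comm, transpose_mul_mul_frameMatrix]

theorem IsFrame.expansion (h : IsFrame A X) (hsymm : ∀ i j, A i j = A j i) (v : Coord n) :
    v = ∑ k, toForm A v (X k) • X k := by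
  have h1 := isFrame_iff.1 h
  rw [Matrix.mul_assoc] at h1
  have h2 := mul_eq_one_comm.1 h1
  rw [Matrix.mul_assoc] at h2
  have h3 := mul_eq_one_comm.1 h2
  have h4 : (frameMatrix X * (frameMatrix X).transpose * A).mulVec v.ofLp = v.ofLp := by
    rw [h3, Matrix.one_mulVec]
  ext i
  have h5 := congrFun h4 i
  rw [Matrix.mul_assoc, ← Matrix.mulVec_mulVec, ← Matrix.mulVec_mulVec] at h5
  rw [← h5]
  simp only [WithLp.ofLp_sum, Finset.sum_apply, PiLp.smul_apply, smul_eq_mul]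
  rw [Matrix.mulVec, dotProduct]
  refine Finset.sum_congr rfl fun k _ => ?_
  rw [toForm_symm hsymm, toForm_apply_eq_dotProduct, mul_comm]
  rfl

/-- A positive definite form and a symmetric form are simultaneously diagonalizable. -/
theorem exists_frame_diagonal (hA : A.PosDef) {T : Matrix (Fin n) (Fin n) ℝ}
    (hT : ∀ i j, T i j = T j i) {lam : Fin n → ℝ} (hlam : IsEigenvalueList A T lam) :
    ∃ X : Fin n → Coord n, IsFrame A X ∧
      ∀ k l, toForm T (X k) (X l) = if k = l then lam k else 0 := by
  obtain ⟨U, hU1, hU2, hAU⟩ := exists_orthogonal_diagonalization hA.isHermitian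
    (by simpa using hA.isHermitian.charpoly_eq)
  have hpos := hA.eigenvalues_pos
  set d : Fin n → ℝ := fun i => 1 / Real.sqrt (hA.isHermitian.eigenvalues i) with hd
  set Y := U * Matrix.diagonal d with hY
  have hYA : Y.transpose * A * Y = 1 := by
    have h1 : Y.transpose * A * Y = Matrix.diagonal d * (U.transpose * U)
        * Matrix.diagonal hA.isHermitian.eigenvalues * (U.transpose * U) * Matrix.diagonal d := by
      conv_lhs => rw [hAU]
      simp only [hY, Matrix.transpose_mul, Matrix.diagonal_transpose, Matrix.mul_assoc]
    rw [h1, hU2, Matrix.mul_one, Matrix.mul_one, Matrix.diagonal_mul_diagonal,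
      Matrix.diagonal_mul_diagonal, ← Matrix.diagonal_one]
    congr 1
    ext i
    have hs := Real.sqrt_pos.2 (hpos i)
    have hss := Real.mul_self_sqrt (hpos i).le
    simp only [hd]
    field_simp
    nlinarith
  have hYY : A⁻¹ = Y * Y.transpose := by
    rw [Matrix.mul_assoc] at hYA
    have h2 := mul_eq_one_comm.1 hYA
    rw [Matrix.mul_assoc] at h2
    exact Matrix.inv_eq_right_inv h2
  have hTs : T.transpose = T := by ext i j; exact hT j i
  have hherm : (Y.transpose * T * Y).IsHermitian := by
    rw [Matrix.IsHermitian, Matrix.conjTranspose_eq_transpose_of_trivial]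
    simp only [Matrix.transpose_mul, Matrix.transpose_transpose, hTs, Matrix.mul_assoc]
  have hchar : (Y.transpose * T * Y).charpoly = ∏ i, (Polynomial.X - Polynomial.C (lam i)) := by
    rw [← hlam, hYY, Matrix.mul_assoc Y, Matrix.charpoly_mul_comm Y]
  obtain ⟨O, hO1, hO2, hTO⟩ := exists_orthogonal_diagonalization hherm hchar
  set M := Y * O with hM
  set X : Fin n → Coord n := fun k => WithLp.toLp 2 fun i => M i k with hX
  have hXM : frameMatrix X = M := by ext i k; simp [frameMatrix, hX]
  refine ⟨X, ?_, ?_⟩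
  · rw [isFrame_iff, hXM]
    have : M.transpose * A * M = O.transpose * (Y.transpose * A * Y) * O := by
      simp only [hM, Matrix.transpose_mul, Matrix.mul_assoc]
    rw [this, hYA, Matrix.mul_one, hO2]
  · have h1 := transpose_mul_mul_frameMatrix T X
    have h2 : M.transpose * T * M = Matrix.diagonal lam := by
      have : M.transpose * T * M = O.transpose * (Y.transpose * T * Y) * O := by
        simp only [hM, Matrix.transpose_mul, Matrix.mul_assoc]
      rw [this, hTO]
      have h3 : O.transpose * (O * Matrix.diagonal lam * O.transpose) * O =
          (O.transpose * O) * Matrix.diagonal lam * (O.transpose * O) := by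
        simp only [Matrix.mul_assoc]
      rw [h3, hO2, Matrix.one_mul, Matrix.mul_one]
    rw [hXM, h2] at h1
    intro k l
    have := congrFun (congrFun h1 k) l
    rw [Matrix.of_apply, Matrix.diagonal_apply] at this
    exact this.symm

theorem exists_frame (hA : A.PosDef) : ∃ X : Fin n → Coord n, IsFrame A X := by
  obtain ⟨X, hX, -⟩ := exists_frame_diagonal hA (T := 0) (lam := 0) (fun _ _ => rfl) (by
    simp [IsEigenvalueList])
  exact ⟨X, hX⟩

/-- Parseval's identity in a frame. -/
theorem IsFrame.sum_sq (h : IsFrame A X) (hsymm : ∀ i j, A i j = A j i) (v : Coord n) :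
    ∑ k, toForm A v (X k) ^ 2 = toForm A v v := by
  conv_rhs => enter [2]; rw [h.expansion hsymm v]
  simp only [map_sum, map_smul, smul_eq_mul, sq]

theorem IsFrame.apply_eq_sum (h : IsFrame A X) (hsymm : ∀ i j, A i j = A j i)
    (w : Coord n →L[ℝ] ℝ) (v : Coord n) : w v = ∑ k, toForm A v (X k) * w (X k) := by
  conv_lhs => rw [h.expansion hsymm v]
  simp only [map_sum, map_smul, smul_eq_mul]

theorem IsFrame.apply_sq_le (h : IsFrame A X) (hsymm : ∀ i j, A i j = A j i)
    (w : Coord n →L[ℝ] ℝ) (v : Coord n) : w v ^ 2 ≤ toForm A v v * ∑ k, w (X k) ^ 2 := by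
  rw [h.apply_eq_sum hsymm w v, ← h.sum_sq hsymm v]
  exact Finset.sum_mul_sq_le_sq_mul_sq _ _ _

theorem IsFrame.toForm_self_nonneg (h : IsFrame A X) (hsymm : ∀ i j, A i j = A j i)
    (v : Coord n) : 0 ≤ toForm A v v := by
  rw [← h.sum_sq hsymm v]
  exact Finset.sum_nonneg fun _ _ => sq_nonneg _

theorem IsFrame.apply₂_sq_le (h : IsFrame A X) (hsymm : ∀ i j, A i j = A j i)
    (T : Coord n →L[ℝ] Coord n →L[ℝ] ℝ) (v w : Coord n) :
    T v w ^ 2 ≤ toForm A v v * toForm A w w * ∑ k, ∑ l, T (X k) (X l) ^ 2 := by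
  have h1 := h.apply_sq_le hsymm (T v) w
  have h2 : ∑ l, T v (X l) ^ 2 ≤ toForm A v v * ∑ k, ∑ l, T (X k) (X l) ^ 2 := by
    rw [Finset.sum_comm, Finset.mul_sum]
    exact Finset.sum_le_sum fun l _ => h.apply_sq_le hsymm (T.flip (X l)) v
  have h3 := mul_le_mul_of_nonneg_left h2 (h.toForm_self_nonneg hsymm w)
  linarith

/-- The components of a differential in a frame. -/
theorem IsFrame.covectorNormSq_differential (h : IsFrame A X) (u : Coord n → ℝ) (x : Coord n) :
    covectorNormSq A (differential u x) = ∑ k, fderiv ℝ u x (X k) ^ 2 := by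
  rw [h.covectorNormSq_eq]
  refine Finset.sum_congr rfl fun k _ => ?_
  rw [fderiv_apply_eq_sum_pd]
  congr 1
  exact Finset.sum_congr rfl fun i _ => mul_comm _ _

theorem toForm_add (A B : Matrix (Fin n) (Fin n) ℝ) (v w : Coord n) :
    toForm (A + B) v w = toForm A v w + toForm B v w := by
  simp only [toForm_apply, Matrix.add_apply, add_mul, Finset.sum_add_distrib]

theorem toForm_sub (A B : Matrix (Fin n) (Fin n) ℝ) (v w : Coord n) :
    toForm (A - B) v w = toForm A v w - toForm B v w := by
  simp only [toForm_apply, Matrix.sub_apply, sub_mul, Finset.sum_sub_distrib]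

theorem toForm_smul (c : ℝ) (A : Matrix (Fin n) (Fin n) ℝ) (v w : Coord n) :
    toForm (c • A) v w = c * toForm A v w := by
  simp only [toForm_apply, Matrix.smul_apply, smul_eq_mul, Finset.mul_sum, mul_assoc]

theorem toForm_vecMulVec_differential (u : Coord n → ℝ) (x v w : Coord n) :
    toForm (Matrix.vecMulVec (differential u x) (differential u x)) v w =
      fderiv ℝ u x v * fderiv ℝ u x w := by
  rw [toForm_apply, fderiv_apply_eq_sum_pd, fderiv_apply_eq_sum_pd, Finset.sum_mul_sum]
  exact Finset.sum_congr rfl fun i _ => Finset.sum_congr rfl fun j _ => by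
    rw [Matrix.vecMulVec_apply, differential, differential]; ring

/-- The diagonal components of `V` in an orthonormal frame. -/
theorem toForm_tensorV {t : ℝ} {G S : Coord n → Matrix (Fin n) (Fin n) ℝ} {a b u : Coord n → ℝ}
    {x : Coord n} (hX : IsFrame (G x) X) (hu : ContDiffAt ℝ 2 u x) (k l : Fin n) :
    toForm (tensorV t G a b u S x) (X k) (X l) =
      (t - 1) / ((n : ℝ) - 2) * (∑ j, covHess (christoffelMap G) u x (X j) (X j))
          * (if k = l then 1 else 0)
        - covHess (christoffelMap G) u x (X k) (X l)
        - a x * (fderiv ℝ u x (X k) * fderiv ℝ u x (X l))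
        - b x * (∑ j, fderiv ℝ u x (X j) ^ 2) * (if k = l then 1 else 0)
        + toForm (S x) (X k) (X l) := by
  rw [tensorV, toForm_add, toForm_sub, toForm_sub, toForm_sub, toForm_smul, toForm_smul,
      toForm_smul,
    toForm_hessian hu, toForm_vecMulVec_differential, hX k l, laplacian, hX.trace_inv_mul,
    hX.covectorNormSq_differential]
  simp only [toForm_hessian hu]

end Frames

/-! ### Solutions in coordinates and uniform bounds for their coefficients -/

section Configuration

variable {n : ℕ} {t r Na Nb NS Ng Ni c : ℝ}

/-- A solution of the equation in coordinates on the ball of radius `r`, with the regularity and the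
bounds on the data that the estimate depends on. Constants that are uniform over this type are the
constants depending only on `n, t, r, Na, Nb, NS, Ng, Ni, c`. -/
structure Configuration (n : ℕ) (t r Na Nb NS Ng Ni c : ℝ) where
  /-- The cone. -/
  cone : Set (Fin n → ℝ)
  /-- The operator, as a function of the eigenvalues. -/
  F : (Fin n → ℝ) → ℝ
  /-- The metric. -/
  G : Coord n → Matrix (Fin n) (Fin n) ℝ
  /-- The coefficient of `du ⊗ du`. -/
  a : Coord n → ℝ
  /-- The coefficient of `|∇u|² g`. -/
  b : Coord n → ℝ
  /-- The solution. -/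
  u : Coord n → ℝ
  /-- The inhomogeneous symmetric tensor. -/
  S : Coord n → Matrix (Fin n) (Fin n) ℝ
  /-- The right-hand side. -/
  f : Coord n → ℝ → ℝ
  structureConditions : StructureConditions cone F
  contDiffOn_G : ∀ i j, ContDiffOn ℝ 3 (fun x => G x i j) (Metric.ball 0 r)
  posDef : ∀ x ∈ Metric.ball (0 : Coord n) r, (G x).PosDef
  contDiffOn_a : ContDiffOn ℝ 2 a (Metric.ball 0 r)
  contDiffOn_b : ContDiffOn ℝ 2 b (Metric.ball 0 r)
  contDiffOn_S : ∀ i j, ContDiffOn ℝ 2 (fun x => S x i j) (Metric.ball 0 r)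
  symm_S : ∀ x ∈ Metric.ball (0 : Coord n) r, ∀ i j, S x i j = S x j i
  contDiffOn_f : ContDiffOn ℝ 2 (fun q : Coord n × ℝ => f q.1 q.2)
    (Metric.ball (0 : Coord n) r ×ˢ Set.univ)
  contDiffOn_u : ContDiffOn ℝ 4 u (Metric.ball 0 r)
  f_pos : ∀ x ∈ Metric.ball (0 : Coord n) r, ∀ z, 0 < f x z
  equation : ∀ x ∈ Metric.ball (0 : Coord n) r, ∃ lam : Fin n → ℝ,
    IsEigenvalueList (G x) (tensorV t G a b u S x) lam ∧ lam ∈ cone ∧ F lam = f x (u x)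
  a_bound : CkBound 2 r Na a
  b_bound : CkBound 2 r Nb b
  S_bound : ∀ i j, CkBound 2 r NS (fun x => S x i j)
  G_bound : ∀ i j, CkBound 3 r Ng (fun x => G x i j)
  G_inv_bound : ∀ i j, CkBound 0 r Ni (fun x => (G x)⁻¹ i j)
  jetSize_le : ∀ x ∈ Metric.ball (0 : Coord n) r, jetSize G f x (u x) ≤ c

namespace Configuration

theorem jetBdd_of_ckBound {ι : Type*} {k : ℕ} {N : ℝ} {φ : ι → Coord n → ℝ}
    (h : ∀ i, ContDiffOn ℝ k (φ i) (Metric.ball 0 r)) (hb : ∀ i, CkBound k r N (φ i)) :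
    JetBdd (Metric.ball (0 : Coord n) r) k φ :=
  ⟨h, fun j hj => ⟨N, fun i x hx => hb i x hx j hj⟩⟩

theorem jetBdd_G (i j : Fin n) : JetBdd (Metric.ball (0 : Coord n) r) 3
    (fun (σ : Configuration n t r Na Nb NS Ng Ni c) x => σ.G x i j) :=
  jetBdd_of_ckBound (fun σ => σ.contDiffOn_G i j) fun σ => σ.G_bound i j

theorem jetBdd_det {ι : Type*} {U : Set (Coord n)} (hU : IsOpen U) {k : ℕ}
    {A : ι → Coord n → Matrix (Fin n) (Fin n) ℝ} (hA : ∀ i j, JetBdd U k fun σ x => A σ x i j) :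
    JetBdd U k fun σ x => (A σ x).det := by
  simp only [Matrix.det_apply']
  exact JetBdd.sum hU fun p _ => (JetBdd.const _).mul hU (JetBdd.prod hU fun i _ => hA _ _)

theorem det_ne_zero (σ : Configuration n t r Na Nb NS Ng Ni c) {x : Coord n}
    (hx : x ∈ Metric.ball (0 : Coord n) r) : (σ.G x).det ≠ 0 := (σ.posDef x hx).det_pos.ne'

theorem symm_G (σ : Configuration n t r Na Nb NS Ng Ni c) {x : Coord n}
    (hx : x ∈ Metric.ball (0 : Coord n) r) (i j : Fin n) : σ.G x i j = σ.G x j i := by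
  simpa using (σ.posDef x hx).isHermitian.apply j i

theorem abs_inv_le (σ : Configuration n t r Na Nb NS Ng Ni c) {x : Coord n}
    (hx : x ∈ Metric.ball (0 : Coord n) r) (i j : Fin n) : |(σ.G x)⁻¹ i j| ≤ Ni := by
  have := σ.G_inv_bound i j x hx 0 le_rfl
  rwa [norm_iteratedFDeriv_zero, Real.norm_eq_abs] at this

theorem jetBdd_G_inv (i j : Fin n) : JetBdd (Metric.ball (0 : Coord n) r) 3
    (fun (σ : Configuration n t r Na Nb NS Ng Ni c) x => (σ.G x)⁻¹ i j) := by
  have hU : IsOpen (Metric.ball (0 : Coord n) r) := Metric.isOpen_ball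
  have h1 : JetBdd (Metric.ball (0 : Coord n) r) 3
      (fun (σ : Configuration n t r Na Nb NS Ng Ni c) x => ((σ.G x).det)⁻¹) := by
    refine (jetBdd_det hU jetBdd_G).inv hU (fun σ x hx => σ.det_ne_zero hx) ?_
    refine ⟨(Nat.factorial (Fintype.card (Fin n))) • Ni ^ Fintype.card (Fin n),
      fun σ x hx => ?_⟩
    rw [← Ring.inverse_eq_inv', ← Matrix.det_nonsing_inv]
    exact Matrix.det_le (abv := AbsoluteValue.abs) fun i j => σ.abs_inv_le hx i j
  have h2 : JetBdd (Metric.ball (0 : Coord n) r) 3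
      (fun (σ : Configuration n t r Na Nb NS Ng Ni c) x => (σ.G x).adjugate i j) := by
    simp only [Matrix.adjugate_apply]
    refine jetBdd_det hU fun k l => ?_
    by_cases hk : k = j
    · subst hk
      simpa using JetBdd.const _
    · simpa [Matrix.updateRow_ne hk] using jetBdd_G k l
  refine (h1.mul hU h2).congr hU fun σ x _ => ?_
  rw [Matrix.inv_def, Matrix.smul_apply, smul_eq_mul, Ring.inverse_eq_inv']

theorem jetBdd_pd_G (k i j : Fin n) : JetBdd (Metric.ball (0 : Coord n) r) 2
    (fun (σ : Configuration n t r Na Nb NS Ng Ni c) x => pd k (fun y => σ.G y i j) x) :=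
  ((jetBdd_G i j).fderiv Metric.isOpen_ball).clm_comp
    (ContinuousLinearMap.apply ℝ ℝ (EuclideanSpace.single k (1 : ℝ))) Metric.isOpen_ball

theorem jetBdd_christoffelMap : JetBdd (Metric.ball (0 : Coord n) r) 2
    (fun (σ : Configuration n t r Na Nb NS Ng Ni c) x => christoffelMap σ.G x) := by
  have hU : IsOpen (Metric.ball (0 : Coord n) r) := Metric.isOpen_ball
  unfold christoffelMap christoffel
  refine JetBdd.sum hU fun k _ => JetBdd.sum hU fun i _ => JetBdd.sum hU fun j _ => ?_
  refine JetBdd.smul hU ((JetBdd.const _).mul hU (JetBdd.sum hU fun l _ => ?_)) (JetBdd.const _)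
  exact ((jetBdd_G_inv k l).of_le (by norm_num)).mul hU
    (((jetBdd_pd_G i j l).add hU (jetBdd_pd_G j i l)).sub hU (jetBdd_pd_G l i j))

theorem jetBdd_toForm {ι : Type*} {U : Set (Coord n)} (hU : IsOpen U) {k : ℕ}
    {A : ι → Coord n → Matrix (Fin n) (Fin n) ℝ} (hA : ∀ i j, JetBdd U k fun σ x => A σ x i j) :
    JetBdd U k fun σ x => toForm (A σ x) := by
  unfold toForm
  exact JetBdd.sum hU fun i _ => JetBdd.sum hU fun j _ => (hA i j).smul hU (JetBdd.const _)

theorem jetBdd_S (i j : Fin n) : JetBdd (Metric.ball (0 : Coord n) r) 2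
    (fun (σ : Configuration n t r Na Nb NS Ng Ni c) x => σ.S x i j) :=
  jetBdd_of_ckBound (fun σ => σ.contDiffOn_S i j) fun σ => σ.S_bound i j

/-- The coefficients of the configuration `σ`, with their derivatives up to second order, are
bounded by `B` at `x`. -/
structure CoeffBound (σ : Configuration n t r Na Nb NS Ng Ni c) (B : ℝ) (x : Coord n) : Prop where
  K0 : ‖christoffelMap σ.G x‖ ≤ B
  K1 : ‖fderiv ℝ (christoffelMap σ.G) x‖ ≤ B
  K2 : ‖fderiv ℝ (fderiv ℝ (christoffelMap σ.G)) x‖ ≤ B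
  S0 : ‖toForm (σ.S x)‖ ≤ B
  S1 : ‖fderiv ℝ (fun y => toForm (σ.S y)) x‖ ≤ B
  S2 : ‖fderiv ℝ (fderiv ℝ fun y => toForm (σ.S y)) x‖ ≤ B
  a0 : |σ.a x| ≤ B
  a1 : ‖fderiv ℝ σ.a x‖ ≤ B
  a2 : ‖fderiv ℝ (fderiv ℝ σ.a) x‖ ≤ B
  b0 : |σ.b x| ≤ B
  b1 : ‖fderiv ℝ σ.b x‖ ≤ B
  b2 : ‖fderiv ℝ (fderiv ℝ σ.b) x‖ ≤ B
  g0 : ‖toForm (σ.G x)‖ ≤ B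
  c_le : c ≤ B
  r_le : r ≤ B
  unit : ∀ v, toForm (σ.G x) v v = 1 → ‖v‖ ≤ B

theorem exists_coeffBound (n : ℕ) (t r Na Nb NS Ng Ni c : ℝ) : ∃ B : ℝ, 1 ≤ B ∧
    ∀ σ : Configuration n t r Na Nb NS Ng Ni c, ∀ x ∈ Metric.ball (0 : Coord n) r,
      σ.CoeffBound B x := by
  obtain ⟨B1, h1, hK⟩ :=
    (jetBdd_christoffelMap (t := t) (r := r) (Na := Na) (Nb := Nb) (NS := NS)
      (Ng := Ng) (Ni := Ni) (c := c) (n := n)).exists_bound_two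
  obtain ⟨B2, h2, hS⟩ := (jetBdd_toForm Metric.isOpen_ball
    (jetBdd_S (t := t) (r := r) (Na := Na) (Nb := Nb) (NS := NS)
      (Ng := Ng) (Ni := Ni) (c := c) (n := n))).exists_bound_two
  obtain ⟨B3, h3, ha⟩ := (jetBdd_of_ckBound
    (φ := fun σ : Configuration n t r Na Nb NS Ng Ni c => σ.a)
    (fun σ => σ.contDiffOn_a) fun σ => σ.a_bound).exists_bound_two
  obtain ⟨B4, h4, hb⟩ := (jetBdd_of_ckBound
    (φ := fun σ : Configuration n t r Na Nb NS Ng Ni c => σ.b)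
    (fun σ => σ.contDiffOn_b) fun σ => σ.b_bound).exists_bound_two
  obtain ⟨B5, h5, hg⟩ := ((jetBdd_toForm Metric.isOpen_ball
    (jetBdd_G (t := t) (r := r) (Na := Na) (Nb := Nb) (NS := NS)
      (Ng := Ng) (Ni := Ni) (c := c) (n := n))).of_le (by norm_num : 2 ≤ 3)).exists_bound_two
  have h6 : 0 ≤ |n * Ni| := abs_nonneg _
  have h7 : c ≤ |c| := le_abs_self c
  have h8 : r ≤ |r| := le_abs_self r
  have h9 : 0 ≤ |c| := abs_nonneg c
  have h10 : 0 ≤ |r| := abs_nonneg r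
  refine ⟨B1 + B2 + B3 + B4 + B5 + (1 + |n * Ni|) + |c| + |r|, by linarith, fun σ x hx => ?_⟩
  obtain ⟨k0, k1, k2⟩ := hK σ x hx
  obtain ⟨s0, s1, s2⟩ := hS σ x hx
  obtain ⟨a0, a1, a2⟩ := ha σ x hx
  obtain ⟨b0, b1, b2⟩ := hb σ x hx
  obtain ⟨g0, -, -⟩ := hg σ x hx
  refine ⟨k0.trans (by linarith), k1.trans (by linarith), k2.trans (by linarith),
    s0.trans (by linarith), s1.trans (by linarith), s2.trans (by linarith),
    a0.trans (by linarith), a1.trans (by linarith), a2.trans (by linarith),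
    b0.trans (by linarith), b1.trans (by linarith), b2.trans (by linarith),
    g0.trans (by linarith), by linarith, by linarith, fun v hv => ?_⟩
  obtain ⟨X, hX⟩ := exists_frame (σ.posDef x hx)
  have hsq : ‖v‖ ^ 2 ≤ n * Ni := by
    have h1 := hX.sum_sq (σ.symm_G hx) v
    rw [EuclideanSpace.norm_sq_eq]
    calc ∑ i, ‖v i‖ ^ 2 ≤ ∑ _i : Fin n, Ni := Finset.sum_le_sum fun i _ => ?_
      _ = n * Ni := by simp
    have h2 := hX.apply_sq_le (σ.symm_G hx) (EuclideanSpace.proj i : Coord n →L[ℝ] ℝ) v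
    rw [hv, one_mul] at h2
    simp only [PiLp.proj_apply] at h2
    rw [Real.norm_eq_abs, sq_abs]
    have h3 : ∑ k, (X k) i ^ 2 = (σ.G x)⁻¹ i i := by
      rw [hX.mul_transpose, Matrix.mul_apply]
      exact Finset.sum_congr rfl fun k _ => by simp [frameMatrix, sq]
    exact h2.trans (h3.le.trans ((le_abs_self _).trans (σ.abs_inv_le hx i i)))
  have h11 : ‖v‖ ≤ 1 + |n * Ni| := by
    have := le_abs_self (n * Ni)
    by_contra! hlt
    nlinarith [norm_nonneg v]
  linarith

end Configuration

end Configuration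

/-! ### Jets of the data along geodesics -/

section JetsOfData

variable {E : Type*} [NormedAddCommGroup E] [NormedSpace ℝ E] {K : E → E →L[ℝ] E →L[ℝ] E} {x : E}
  {B : ℝ}

theorem exists_jet2_form {S : E → E →L[ℝ] E →L[ℝ] ℝ} (hS : ContDiffAt ℝ 2 S x) (hB : 1 ≤ B)
    (hK0 : ‖K x‖ ≤ B) (hK1 : ‖fderiv ℝ K x‖ ≤ B) (hS0 : ‖S x‖ ≤ B) (hS1 : ‖fderiv ℝ S x‖ ≤ B)
    (hS2 : ‖fderiv ℝ (fderiv ℝ S) x‖ ≤ B) {z v : E} (hz : ‖z‖ ≤ B) (hv : ‖v‖ ≤ B) {γ X : ℝ → E}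
    (hγ : Jet2 γ x z (-K x z z)) (hX : Jet2 X v (-K x z v) (parallelSecond K x z v)) :
    ∃ s1 s2 : ℝ, Jet2 (fun τ => S (γ τ) (X τ) (X τ)) (S x v v) s1 s2 ∧
      |s1| ≤ 14 * B ^ 7 ∧ |s2| ≤ 14 * B ^ 7 := by
  have hB0 : 0 ≤ B := by linarith
  refine ⟨_, _, ((hγ.comp hS).clm_apply hX).clm_apply hX, ?_, ?_⟩
  · have b1 := norm_apply₂_le (norm_apply₁_le hS1 hz) hv hv
    have b2 := norm_apply₂_le hS0 (norm_apply₂_le hK0 hz hv) hv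
    have b3 := norm_apply₂_le hS0 hv (norm_apply₂_le hK0 hz hv)
    rw [Real.norm_eq_abs, abs_le] at b1 b2 b3
    have p1 : B ^ 4 ≤ B ^ 7 := pow_le_pow_right₀ hB (by norm_num)
    have p2 : B ^ 5 ≤ B ^ 7 := pow_le_pow_right₀ hB (by norm_num)
    have p3 : 0 ≤ B ^ 7 := by positivity
    simp only [add_apply, map_neg, neg_apply]
    rw [abs_le]
    constructor <;> linarith [b1.1, b1.2, b2.1, b2.2, b3.1, b3.2]
  · have hps := norm_parallelSecond_le hB hK0 hK1 hz hv
    have kzv := norm_apply₂_le hK0 hz hv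
    have b1 := norm_apply₂_le (norm_apply₂_le hS2 hz hz) hv hv
    have b2 := norm_apply₂_le (norm_apply₁_le hS1 (norm_apply₂_le hK0 hz hz)) hv hv
    have b3 := norm_apply₂_le (norm_apply₁_le hS1 hz) kzv hv
    have b4 := norm_apply₂_le (norm_apply₁_le hS1 hz) hv kzv
    have b5 := norm_apply₂_le hS0 hps hv
    have b6 := norm_apply₂_le hS0 hv hps
    have b7 := norm_apply₂_le hS0 kzv kzv
    rw [Real.norm_eq_abs, abs_le] at b1 b2 b3 b4 b5 b6 b7
    have p1 : B ^ 6 ≤ B ^ 7 := pow_le_pow_right₀ hB (by norm_num)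
    have p2 : B ^ 5 ≤ B ^ 7 := pow_le_pow_right₀ hB (by norm_num)
    have p3 : 0 ≤ B ^ 7 := by positivity
    simp only [add_apply, map_neg, neg_apply]
    rw [abs_le]
    constructor <;> linarith [b1.1, b1.2, b2.1, b2.2, b3.1, b3.2, b4.1, b4.2, b5.1, b5.2,
      b6.1, b6.2, b7.1, b7.2]

theorem exists_jet2_scalar {a : E → ℝ} (ha : ContDiffAt ℝ 2 a x) (hB : 1 ≤ B)
    (hK0 : ‖K x‖ ≤ B) (ha1 : ‖fderiv ℝ a x‖ ≤ B) (ha2 : ‖fderiv ℝ (fderiv ℝ a) x‖ ≤ B) {z : E}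
    (hz : ‖z‖ ≤ B) {γ : ℝ → E} (hγ : Jet2 γ x z (-K x z z)) :
    ∃ a1 a2 : ℝ, Jet2 (fun τ => a (γ τ)) (a x) a1 a2 ∧ |a1| ≤ 2 * B ^ 4 ∧ |a2| ≤ 2 * B ^ 4 := by
  have hB0 : 0 ≤ B := by linarith
  refine ⟨_, _, hγ.comp ha, ?_, ?_⟩
  · have b1 := norm_apply₁_le ha1 hz
    rw [Real.norm_eq_abs] at b1
    have p1 : B ^ 2 ≤ B ^ 4 := pow_le_pow_right₀ hB (by norm_num)
    have p3 : 0 ≤ B ^ 4 := by positivity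
    linarith
  · have b1 := norm_apply₂_le ha2 hz hz
    have b2 := norm_apply₁_le ha1 (norm_apply₂_le hK0 hz hz)
    rw [Real.norm_eq_abs, abs_le] at b1 b2
    have p1 : B ^ 3 ≤ B ^ 4 := pow_le_pow_right₀ hB (by norm_num)
    have p3 : 0 ≤ B ^ 4 := by positivity
    rw [map_neg, abs_le]
    constructor <;> linarith [b1.1, b1.2, b2.1, b2.2]

end JetsOfData

/-- The reciprocal of the cut-off function `(R² - |x|²)²` along a geodesic. -/
theorem exists_jet2_cutoff {n : ℕ} {K : Coord n → Coord n →L[ℝ] Coord n →L[ℝ] Coord n}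
    {x : Coord n} {B R : ℝ} (hB : 1 ≤ B) (hR : R ≤ B) (hR0 : 0 < R) (hK0 : ‖K x‖ ≤ B)
    (hx : 0 < R ^ 2 - ‖x‖ ^ 2) {z : Coord n} (hz : ‖z‖ ≤ B) {γ : ℝ → Coord n}
    (hγ : Jet2 γ x z (-K x z z)) :
    ∃ q1 q2 : ℝ, Jet2 (fun τ => ((R ^ 2 - ‖γ τ‖ ^ 2) ^ 2)⁻¹) ((R ^ 2 - ‖x‖ ^ 2) ^ 2)⁻¹ q1 q2 ∧
      |q1| ≤ 32 * B ^ 6 / (R ^ 2 - ‖x‖ ^ 2) ^ 3 ∧ |q2| ≤ 32 * B ^ 6 / (R ^ 2 - ‖x‖ ^ 2) ^ 4 := by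
  have hB0 : 0 ≤ B := by linarith
  have hxB : ‖x‖ ≤ B := by
    have : ‖x‖ < R := by nlinarith [norm_nonneg x]
    linarith
  have kzz := norm_apply₂_le hK0 hz hz
  have hinner : Jet2 (fun τ => inner ℝ (γ τ) (γ τ)) (inner ℝ x x) (2 * inner ℝ x z)
      (2 * inner ℝ z z - 2 * inner ℝ x (K x z z)) := by
    have h1 : Jet2 (fun τ => innerSL ℝ (γ τ)) (innerSL ℝ x) (innerSL ℝ z)
        (innerSL ℝ (-K x z z)) := by
      have := (Jet2.const (innerSL ℝ (E := Coord n))).clm_apply hγ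
      simpa using this
    refine (h1.clm_apply hγ).of_eq ?_ ?_ ?_
    · simp
    · simp [real_inner_comm]; ring
    · simp [real_inner_comm]; ring
  have hρ : Jet2 (fun τ => R ^ 2 - ‖γ τ‖ ^ 2) (R ^ 2 - ‖x‖ ^ 2) (-(2 * inner ℝ x z))
      (-(2 * inner ℝ z z - 2 * inner ℝ x (K x z z))) := by
    have := (Jet2.const (R ^ 2)).sub hinner
    simpa only [real_inner_self_eq_norm_sq, zero_sub] using this
  set ρ := R ^ 2 - ‖x‖ ^ 2 with hρdef
  set d1 : ℝ := -(2 * inner ℝ x z) with hd1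
  set d2 : ℝ := -(2 * inner ℝ z z - 2 * inner ℝ x (K x z z)) with hd2
  have bd1 : |d1| ≤ 2 * B ^ 2 := by
    have h := abs_real_inner_le_norm x z
    have h2 : ‖x‖ * ‖z‖ ≤ B * B := by gcongr
    rw [hd1, abs_neg, abs_mul, abs_two]
    linarith
  have bd2 : |d2| ≤ 4 * B ^ 4 := by
    have h := abs_real_inner_le_norm x (K x z z)
    have h2 : ‖x‖ * ‖K x z z‖ ≤ B * (B * B * B) := by gcongr
    have h3 : ‖z‖ ^ 2 ≤ B ^ 2 := by gcongr
    have h4 : B ^ 2 ≤ B ^ 4 := pow_le_pow_right₀ hB (by norm_num)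
    have h5 := sq_nonneg ‖z‖
    rw [abs_le] at h
    rw [hd2, real_inner_self_eq_norm_sq, abs_le]
    constructor <;> linarith [h.1, h.2]
  have hρB : ρ ≤ B ^ 2 := by
    have : R ^ 2 ≤ B ^ 2 := by gcongr
    linarith [sq_nonneg ‖x‖]
  have hη := (hρ.mul hρ).inv (mul_pos hx hx).ne'
  refine ⟨-2 * d1 / ρ ^ 3, 6 * d1 ^ 2 / ρ ^ 4 - 2 * d2 / ρ ^ 3, ?_, ?_, ?_⟩
  · refine (hη.congr_eventually (Eventually.of_forall fun τ => ?_)).of_eq ?_ ?_ ?_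
    · simp only [sq]
    · rw [sq]
    · field_simp; ring
    · field_simp; ring
  · rw [abs_div, abs_mul, abs_of_pos (pow_pos hx 3)]
    have p : B ^ 2 ≤ B ^ 6 := pow_le_pow_right₀ hB (by norm_num)
    refine div_le_div_of_nonneg_right ?_ (pow_pos hx 3).le
    rw [show |(-2 : ℝ)| = 2 by norm_num]
    have p' : 0 ≤ B ^ 6 := by positivity
    linarith
  · have e : 6 * d1 ^ 2 / ρ ^ 4 - 2 * d2 / ρ ^ 3 = (6 * d1 ^ 2 - 2 * d2 * ρ) / ρ ^ 4 := by
      field_simp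
    rw [e, abs_div, abs_of_pos (pow_pos hx 4)]
    gcongr
    have h1 : d1 ^ 2 ≤ (2 * B ^ 2) ^ 2 := by rw [← sq_abs d1]; gcongr
    have h2 : |d2 * ρ| ≤ 4 * B ^ 4 * B ^ 2 := by
      rw [abs_mul, abs_of_pos hx]; gcongr
    have p : B ^ 4 ≤ B ^ 6 := pow_le_pow_right₀ hB (by norm_num)
    have h3 := sq_nonneg d1
    rw [abs_le] at h2 ⊢
    constructor <;> nlinarith [h2.1, h2.2]

/-! ### The right-hand side along a geodesic -/

section RightHandSide

variable {E : Type*} [NormedAddCommGroup E] [NormedSpace ℝ E] {K : E → E →L[ℝ] E →L[ℝ] E} {x : E}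

/-- The 2-jet of `f(x, u(x))` along a geodesic with initial velocity `z`. -/
theorem jet2_rhs {f : E → ℝ → ℝ} {u : E → ℝ}
    (hf : ContDiffAt ℝ 2 (fun p : E × ℝ => f p.1 p.2) (x, u x)) (hu : ContDiffAt ℝ 2 u x) {z : E}
    {γ : ℝ → E} (hγ : Jet2 γ x z (-K x z z)) :
    Jet2 (fun τ => f (γ τ) (u (γ τ))) (f x (u x))
      (fderiv ℝ (fun y => f y (u x)) x z + deriv (f x) (u x) * fderiv ℝ u x z)
      (covHess K (fun y => f y (u x)) x z z
        + 2 * (fderiv ℝ (fun y => deriv (f y) (u x)) x z * fderiv ℝ u x z)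
        + deriv (deriv (f x)) (u x) * fderiv ℝ u x z ^ 2
        + deriv (f x) (u x) * covHess K u x z z) := by
  set g : E × ℝ → ℝ := fun p => f p.1 p.2 with hg
  have hu2 : Jet2 (fun τ => u (γ τ)) (u x) (fderiv ℝ u x z) (covHess K u x z z) :=
    (hγ.comp hu).of_eq rfl rfl (by simp [covHess, sub_eq_add_neg])
  have hjet := (hγ.prodMk hu2).comp (f := g) hf
  have hev : ∀ᶠ p in 𝓝 (x, u x), DifferentiableAt ℝ g p := by
    filter_upwards [hf.eventually (by simp)] with p hp using hp.differentiableAt (by norm_num)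
  have hd2 : DifferentiableAt ℝ (fderiv ℝ g) (x, u x) :=
    (hf.fderiv_right (m := 1) (by norm_num)).differentiableAt (by norm_num)
  -- partial derivatives in terms of the total derivative
  have fx : ∀ y s, DifferentiableAt ℝ g (y, s) → ∀ v, fderiv ℝ (fun y => f y s) y v =
      fderiv ℝ g (y, s) (v, 0) := by
    intro y s h v
    have h1 : HasFDerivAt (fun y => f y s) ((fderiv ℝ g (y, s)).comp
        (ContinuousLinearMap.inl ℝ E ℝ)) y :=
      HasFDerivAt.comp (g := g) (f := fun y => (y, s)) y h.hasFDerivAt (hasFDerivAt_prodMk_left y s)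
    rw [h1.fderiv]
    simp
  have fz : ∀ y s, DifferentiableAt ℝ g (y, s) → deriv (f y) s = fderiv ℝ g (y, s) (0, 1) := by
    intro y s h
    have h1 : HasDerivAt (fun s : ℝ => (y, s)) ((0, 1) : E × ℝ) s :=
      (hasDerivAt_const s y).prodMk (hasDerivAt_id s)
    exact (h.hasFDerivAt.comp_hasDerivAt s h1 : HasDerivAt (f y) _ s).deriv
  have hevx : ∀ᶠ y in 𝓝 x, DifferentiableAt ℝ g (y, u x) :=
    (Continuous.prodMk_left (u x)).continuousAt.eventually hev
  have hevz : ∀ᶠ s in 𝓝 (u x), DifferentiableAt ℝ g (x, s) :=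
    (Continuous.prodMk_right x).continuousAt.eventually hev
  have hd := hev.self_of_nhds
  have fxz : fderiv ℝ (fun y => deriv (f y) (u x)) x z =
      fderiv ℝ (fderiv ℝ g) (x, u x) (z, 0) (0, 1) := by
    have h1 : (fun y => deriv (f y) (u x)) =ᶠ[𝓝 x] fun y => fderiv ℝ g (y, u x) (0, 1) := by
      filter_upwards [hevx] with y hy using fz y _ hy
    rw [h1.fderiv_eq]
    have h2 : HasFDerivAt (fun y => fderiv ℝ g (y, u x))
        ((fderiv ℝ (fderiv ℝ g) (x, u x)).comp (ContinuousLinearMap.inl ℝ E ℝ)) x :=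
      HasFDerivAt.comp (g := fderiv ℝ g) x hd2.hasFDerivAt (hasFDerivAt_prodMk_left x (u x))
    rw [(h2.clm_apply (hasFDerivAt_const ((0, 1) : E × ℝ) x)).fderiv]
    simp
  have fzz : deriv (deriv (f x)) (u x) = fderiv ℝ (fderiv ℝ g) (x, u x) (0, 1) (0, 1) := by
    have h1 : deriv (f x) =ᶠ[𝓝 (u x)] fun s => fderiv ℝ g (x, s) (0, 1) := by
      filter_upwards [hevz] with s hs using fz x s hs
    rw [h1.deriv_eq]
    have h2 : HasDerivAt (fun s : ℝ => (x, s)) ((0, 1) : E × ℝ) (u x) :=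
      (hasDerivAt_const _ x).prodMk (hasDerivAt_id _)
    have h3 := hd2.hasFDerivAt.comp_hasDerivAt (u x) h2
    have h4 := (h3.clm_apply (hasDerivAt_const (u x) ((0, 1) : E × ℝ)))
    simpa using h4.deriv
  have fxx : fderiv ℝ (fderiv ℝ fun y => f y (u x)) x z z =
      fderiv ℝ (fderiv ℝ g) (x, u x) (z, 0) (z, 0) := by
    have h1 : (fderiv ℝ fun y => f y (u x)) =ᶠ[𝓝 x] fun y =>
        (fderiv ℝ g (y, u x)).comp (ContinuousLinearMap.inl ℝ E ℝ) := by
      filter_upwards [hevx] with y hy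
      ext v
      rw [fx y _ hy]; simp
    rw [h1.fderiv_eq]
    have h2 : HasFDerivAt (fun y => fderiv ℝ g (y, u x))
        ((fderiv ℝ (fderiv ℝ g) (x, u x)).comp (ContinuousLinearMap.inl ℝ E ℝ)) x :=
      HasFDerivAt.comp (g := fderiv ℝ g) x hd2.hasFDerivAt (hasFDerivAt_prodMk_left x (u x))
    rw [(h2.clm_comp (hasFDerivAt_const (ContinuousLinearMap.inl ℝ E ℝ) x)).fderiv]
    simp
  have hsymm := fderiv_fderiv_symm hf (z, 0) (0, 1)
  have split : ∀ (v : E) (s : ℝ), (v, s) = (v, (0 : ℝ)) + s • ((0 : E), (1 : ℝ)) := by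
    intro v s; simp
  refine hjet.of_eq rfl ?_ ?_
  · rw [split z, map_add, map_smul, fx _ _ hd, fz _ _ hd, smul_eq_mul]
    ring
  · rw [split z, split (-K x z z)]
    simp only [covHess, fxx, fxz, fzz, fx _ _ hd, fz _ _ hd, map_add, map_smul, add_apply,
      smul_apply, smul_eq_mul, ← hsymm]
    have : ((-K x z z, 0) : E × ℝ) = -(K x z z, 0) := by simp
    rw [this, map_neg]
    ring

end RightHandSide

/-! ### Derivatives of a solution in orthonormal frames -/

section Solution

variable {n : ℕ} {t r Na Nb NS Ng Ni c : ℝ}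

namespace Configuration

variable (σ : Configuration n t r Na Nb NS Ng Ni c)

/-- The Christoffel symbols of the metric, as a bilinear map. -/
abbrev conn (x : Coord n) : Coord n →L[ℝ] Coord n →L[ℝ] Coord n := christoffelMap σ.G x

/-- The covariant Hessian of the solution, as a bilinear form. -/
abbrev hess (x v w : Coord n) : ℝ := covHess (christoffelMap σ.G) σ.u x v w

/-- The norm of the gradient of the solution. -/
def gradNorm (x : Coord n) : ℝ := Real.sqrt (covectorNormSq (σ.G x) (differential σ.u x))

/-- The norm of the Hessian of the solution. -/
def hessNorm (x : Coord n) : ℝ := tensorNorm (σ.G x) (hessian σ.G σ.u x)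

variable {σ} {x : Coord n} {X : Fin n → Coord n}

theorem gradNorm_nonneg : 0 ≤ σ.gradNorm x := Real.sqrt_nonneg _

theorem hessNorm_nonneg : 0 ≤ σ.hessNorm x := Real.sqrt_nonneg _

theorem ball_mem_nhds (hx : x ∈ Metric.ball (0 : Coord n) r) : Metric.ball (0 : Coord n) r ∈ 𝓝 x :=
  Metric.isOpen_ball.mem_nhds hx

theorem contDiffAt_u (hx : x ∈ Metric.ball (0 : Coord n) r) : ContDiffAt ℝ 4 σ.u x :=
  σ.contDiffOn_u.contDiffAt (ball_mem_nhds hx)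

theorem contDiffOn_conn : ContDiffOn ℝ 2 σ.conn (Metric.ball 0 r) :=
  jetBdd_christoffelMap.contDiffOn σ

theorem contDiffAt_conn (hx : x ∈ Metric.ball (0 : Coord n) r) : ContDiffAt ℝ 2 σ.conn x :=
  contDiffOn_conn.contDiffAt (ball_mem_nhds hx)

theorem contDiffOn_form : ContDiffOn ℝ 2 (fun y => toForm (σ.S y)) (Metric.ball 0 r) :=
  (jetBdd_toForm Metric.isOpen_ball jetBdd_S).contDiffOn σ

theorem contDiffOn_metric : ContDiffOn ℝ 3 (fun y => toForm (σ.G y)) (Metric.ball 0 r) :=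
  (jetBdd_toForm Metric.isOpen_ball jetBdd_G).contDiffOn σ

theorem conn_symm (hx : x ∈ Metric.ball (0 : Coord n) r) (v w : Coord n) :
    σ.conn x v w = σ.conn x w v := by
  refine christoffelMap_symm (fun i j => ?_) v w
  filter_upwards [ball_mem_nhds hx] with y hy using σ.symm_G hy i j

theorem hess_symm (hx : x ∈ Metric.ball (0 : Coord n) r) (v w : Coord n) :
    σ.hess x v w = σ.hess x w v := by
  unfold hess covHess
  rw [fderiv_fderiv_symm ((contDiffAt_u hx).of_le (by norm_num)), conn_symm hx]

theorem toForm_hessian_eq (hx : x ∈ Metric.ball (0 : Coord n) r) (v w : Coord n) :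
    toForm (hessian σ.G σ.u x) v w = σ.hess x v w :=
  toForm_hessian ((contDiffAt_u hx).of_le (by norm_num)) v w

theorem gradNorm_sq (hX : IsFrame (σ.G x) X) : σ.gradNorm x ^ 2 = ∑ k,
    fderiv ℝ σ.u x (X k) ^ 2 := by
  rw [gradNorm, hX.covectorNormSq_differential, Real.sq_sqrt]
  exact Finset.sum_nonneg fun _ _ => sq_nonneg _

theorem hessNorm_sq (hx : x ∈ Metric.ball (0 : Coord n) r) (hX : IsFrame (σ.G x) X) :
    σ.hessNorm x ^ 2 = ∑ k, ∑ l, σ.hess x (X k) (X l) ^ 2 := by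
  simp only [hessNorm, hX.tensorNorm_eq, toForm_hessian_eq hx]
  rw [Real.sq_sqrt]
  exact Finset.sum_nonneg fun _ _ => Finset.sum_nonneg fun _ _ => sq_nonneg _

theorem abs_grad_le (hx : x ∈ Metric.ball (0 : Coord n) r) {v : Coord n}
    (hv : toForm (σ.G x) v v = 1) : |fderiv ℝ σ.u x v| ≤ σ.gradNorm x := by
  obtain ⟨X, hX⟩ := exists_frame (σ.posDef x hx)
  have h := hX.apply_sq_le (σ.symm_G hx) (fderiv ℝ σ.u x) v
  rw [hv, one_mul, ← gradNorm_sq hX] at h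
  exact abs_le_of_sq_le_sq h gradNorm_nonneg

theorem hess_sq_le (hx : x ∈ Metric.ball (0 : Coord n) r) (v w : Coord n) :
    σ.hess x v w ^ 2 ≤ toForm (σ.G x) v v * toForm (σ.G x) w w * σ.hessNorm x ^ 2 := by
  obtain ⟨X, hX⟩ := exists_frame (σ.posDef x hx)
  have h := hX.apply₂_sq_le (σ.symm_G hx) (toForm (hessian σ.G σ.u x)) v w
  simp only [toForm_hessian_eq hx] at h
  rwa [hessNorm_sq hx hX]

theorem abs_hess_le (hx : x ∈ Metric.ball (0 : Coord n) r) {v w : Coord n}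
    (hv : toForm (σ.G x) v v = 1) (hw : toForm (σ.G x) w w = 1) :
    |σ.hess x v w| ≤ σ.hessNorm x := by
  have h := hess_sq_le (σ := σ) hx v w
  rw [hv, hw, one_mul, one_mul] at h
  exact abs_le_of_sq_le_sq h hessNorm_nonneg

variable {B : ℝ}

theorem toForm_self_le (hc : σ.CoeffBound B x) (v : Coord n) :
    toForm (σ.G x) v v ≤ B * ‖v‖ ^ 2 := by
  have := norm_apply₂_le hc.g0 (le_refl ‖v‖) (le_refl ‖v‖)
  rw [Real.norm_eq_abs] at this
  linarith [le_abs_self (toForm (σ.G x) v v)]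

/-- The coordinate gradient is controlled by the norm of the gradient. -/
theorem norm_fderiv_le (hx : x ∈ Metric.ball (0 : Coord n) r) (hB : 1 ≤ B)
    (hc : σ.CoeffBound B x) : ‖fderiv ℝ σ.u x‖ ≤ B * σ.gradNorm x := by
  have hB0 : 0 ≤ B := by linarith
  have hq := gradNorm_nonneg (σ := σ) (x := x)
  refine ContinuousLinearMap.opNorm_le_bound _ (by positivity) fun v => ?_
  obtain ⟨X, hX⟩ := exists_frame (σ.posDef x hx)
  have h := hX.apply_sq_le (σ.symm_G hx) (fderiv ℝ σ.u x) v
  rw [← gradNorm_sq hX] at h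
  refine abs_le_of_sq_le_sq (h.trans ?_) (by positivity)
  calc toForm (σ.G x) v v * σ.gradNorm x ^ 2 ≤ B * ‖v‖ ^ 2 * σ.gradNorm x ^ 2 := by
        gcongr; exact toForm_self_le hc v
    _ ≤ B ^ 2 * ‖v‖ ^ 2 * σ.gradNorm x ^ 2 := by
        gcongr; exact le_self_pow₀ hB (by norm_num)
    _ = _ := by ring

/-- The coordinate second derivatives are controlled by the norms of the Hessian and gradient. -/
theorem norm_fderiv_fderiv_le (hx : x ∈ Metric.ball (0 : Coord n) r) (hB : 1 ≤ B)
    (hc : σ.CoeffBound B x) :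
    ‖fderiv ℝ (fderiv ℝ σ.u) x‖ ≤ B ^ 2 * (σ.hessNorm x + σ.gradNorm x) := by
  have hB0 : 0 ≤ B := by linarith
  have hq := gradNorm_nonneg (σ := σ) (x := x)
  have hy := hessNorm_nonneg (σ := σ) (x := x)
  refine ContinuousLinearMap.opNorm_le_bound₂ _ (by positivity) fun v w => ?_
  have h1 : |σ.hess x v w| ≤ B * ‖v‖ * ‖w‖ * σ.hessNorm x := by
    refine abs_le_of_sq_le_sq ((hess_sq_le hx v w).trans ?_) (by positivity)
    obtain ⟨X, hX⟩ := exists_frame (σ.posDef x hx)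
    have hw := hX.toForm_self_nonneg (σ.symm_G hx) w
    calc _ ≤ (B * ‖v‖ ^ 2) * (B * ‖w‖ ^ 2) * σ.hessNorm x ^ 2 := by
          gcongr
          · exact toForm_self_le hc v
          · exact toForm_self_le hc w
      _ = _ := by ring
  have h2 := norm_apply₁_le (norm_fderiv_le hx hB hc)
    (norm_apply₂_le hc.K0 (le_refl ‖v‖) (le_refl ‖w‖))
  have h3 : fderiv ℝ (fderiv ℝ σ.u) x v w = σ.hess x v w + fderiv ℝ σ.u x (σ.conn x v w) := by
    simp [covHess]
  rw [h3]
  refine (norm_add_le _ _).trans ((add_le_add h1 h2).trans ?_)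
  have h4 : B * ‖v‖ * ‖w‖ * σ.hessNorm x ≤ B ^ 2 * ‖v‖ * ‖w‖ * σ.hessNorm x := by
    gcongr; exact le_self_pow₀ hB (by norm_num)
  linarith

theorem abs_covThird_comm_le (hx : x ∈ Metric.ball (0 : Coord n) r) (hB : 1 ≤ B)
    (hc : σ.CoeffBound B x) {z v : Coord n} (hz : toForm (σ.G x) z z = 1)
    (hv : toForm (σ.G x) v v = 1) :
    |covThird σ.conn σ.u x z z v - covThird σ.conn σ.u x v z z| ≤ 100 * B ^ 9 * σ.gradNorm x := by
  have hB0 : 0 ≤ B := by linarith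
  have hq := gradNorm_nonneg (σ := σ) (x := x)
  refine (abs_covThird_sub_le ((contDiffAt_u hx).of_le (by norm_num)) hB (conn_symm hx) hc.K0 hc.K1
    (hc.unit z hz) (hc.unit v hv)).trans ?_
  calc 6 * B ^ 5 * ‖fderiv ℝ σ.u x‖ ≤ 6 * B ^ 5 * (B * σ.gradNorm x) := by
        gcongr; exact norm_fderiv_le hx hB hc
    _ = 6 * B ^ 6 * σ.gradNorm x := by ring
    _ ≤ 100 * B ^ 9 * σ.gradNorm x := by
        gcongr
        · norm_num
        · norm_num

theorem abs_covFourth_comm_le (hx : x ∈ Metric.ball (0 : Coord n) r) (hB : 1 ≤ B)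
    (hc : σ.CoeffBound B x) {z v : Coord n} (hz : toForm (σ.G x) z z = 1)
    (hv : toForm (σ.G x) v v = 1) :
    |covFourth σ.conn σ.u x z v - covFourth σ.conn σ.u x v z| ≤
      100 * B ^ 9 * (σ.hessNorm x + σ.gradNorm x) := by
  have hB0 : 0 ≤ B := by linarith
  have hq := gradNorm_nonneg (σ := σ) (x := x)
  have hy := hessNorm_nonneg (σ := σ) (x := x)
  refine (abs_covFourth_sub_le (contDiffAt_u hx) hB (conn_symm hx) hc.K0 hc.K1 hc.K2
    (hc.unit z hz) (hc.unit v hv)).trans ?_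
  have h1 := norm_fderiv_le hx hB hc
  have h2 := norm_fderiv_fderiv_le hx hB hc
  have h3 : B * σ.gradNorm x ≤ B ^ 2 * (σ.hessNorm x + σ.gradNorm x) := by
    have : B ≤ B ^ 2 := le_self_pow₀ hB (by norm_num)
    have h4 : B * σ.gradNorm x ≤ B ^ 2 * σ.gradNorm x := by gcongr
    have h5 : 0 ≤ B ^ 2 * σ.hessNorm x := by positivity
    linarith
  calc _ ≤ 30 * B ^ 7 * (2 * (B ^ 2 * (σ.hessNorm x + σ.gradNorm x))) := by
        gcongr; linarith
    _ = 60 * (B ^ 9 * (σ.hessNorm x + σ.gradNorm x)) := by ring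
    _ ≤ 100 * B ^ 9 * (σ.hessNorm x + σ.gradNorm x) := by
        have : 0 ≤ B ^ 9 * (σ.hessNorm x + σ.gradNorm x) := by positivity
        linarith

/-- The right-hand side along a geodesic. -/
theorem exists_jet2_f (hx : x ∈ Metric.ball (0 : Coord n) r) (hB : 1 ≤ B)
    (hc : σ.CoeffBound B x) {z : Coord n} (hz : toForm (σ.G x) z z = 1) {γ : ℝ → Coord n}
    (hγ : Jet2 γ x z (-σ.conn x z z)) :
    ∃ f1 f2 : ℝ, Jet2 (fun τ => σ.f (γ τ) (σ.u (γ τ))) (σ.f x (σ.u x)) f1 f2 ∧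
      |f1| ≤ 100 * B ^ 9 * (1 + σ.gradNorm x) ∧
      |f2| ≤ 100 * B ^ 9 * (1 + σ.gradNorm x ^ 2 + σ.hessNorm x) := by
  have hB0 : 0 ≤ B := by linarith
  have hq := gradNorm_nonneg (σ := σ) (x := x)
  have hy := hessNorm_nonneg (σ := σ) (x := x)
  have hf : ContDiffAt ℝ 2 (fun p : Coord n × ℝ => σ.f p.1 p.2) (x, σ.u x) :=
    σ.contDiffOn_f.contDiffAt (prod_mem_nhds (ball_mem_nhds hx) univ_mem)
  refine ⟨_, _, jet2_rhs hf ((contDiffAt_u hx).of_le (by norm_num)) hγ, ?_⟩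
  obtain ⟨X, hX⟩ := exists_frame (σ.posDef x hx)
  have hJ := (σ.jetSize_le x hx).trans hc.c_le
  have h0 := σ.f_pos x hx (σ.u x)
  have hcov : ∀ φ : Coord n → ℝ, |fderiv ℝ φ x z| ≤
      Real.sqrt (covectorNormSq (σ.G x) (differential φ x)) := by
    intro φ
    have h := hX.apply_sq_le (σ.symm_G hx) (fderiv ℝ φ x) z
    rw [hz, one_mul, ← hX.covectorNormSq_differential] at h
    exact Real.abs_le_sqrt h
  have hfx : ContDiffAt ℝ 2 (fun y => σ.f y (σ.u x)) x :=
    hf.comp (f := fun y => (y, σ.u x)) x (contDiffAt_id.prodMk contDiffAt_const)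
  have hten : |covHess σ.conn (fun y => σ.f y (σ.u x)) x z z| ≤
      tensorNorm (σ.G x) (hessian σ.G (fun y => σ.f y (σ.u x)) x) := by
    have h := hX.apply₂_sq_le (σ.symm_G hx) (toForm (hessian σ.G (fun y => σ.f y (σ.u x)) x)) z z
    rw [hz, one_mul, one_mul] at h
    rw [hX.tensorNorm_eq, ← toForm_hessian hfx]
    exact Real.abs_le_sqrt h
  have h1 := hcov fun y => σ.f y (σ.u x)
  have h2 := hcov fun y => deriv (σ.f y) (σ.u x)
  have n1 := abs_nonneg (fderiv ℝ (fun y => σ.f y (σ.u x)) x z)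
  have n2 := abs_nonneg (fderiv ℝ (fun y => deriv (σ.f y) (σ.u x)) x z)
  have n3 := abs_nonneg (covHess σ.conn (fun y => σ.f y (σ.u x)) x z z)
  have n4 := abs_nonneg (deriv (σ.f x) (σ.u x))
  have n5 := abs_nonneg (deriv (deriv (σ.f x)) (σ.u x))
  unfold jetSize at hJ
  have b1 : |fderiv ℝ (fun y => σ.f y (σ.u x)) x z| ≤ B := by linarith only [hJ, h0, h1, h2, hten,
      n1, n2, n3, n4, n5]
  have b2 : |fderiv ℝ (fun y => deriv (σ.f y) (σ.u x)) x z| ≤ B := by linarith only [hJ, h0, h1,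
      h2, hten, n1, n2, n3, n4, n5]
  have b3 : |covHess σ.conn (fun y => σ.f y (σ.u x)) x z z| ≤ B := by linarith only [hJ, h0, h1,
      h2, hten, n1, n2, n3, n4, n5]
  have b4 : |deriv (σ.f x) (σ.u x)| ≤ B := by linarith only [hJ, h0, h1, h2, hten, n1, n2, n3, n4,
      n5]
  have b5 : |deriv (deriv (σ.f x)) (σ.u x)| ≤ B := by linarith only [hJ, h0, h1, h2, hten, n1, n2,
      n3, n4, n5]
  have bu := abs_grad_le hx hz
  have bh := abs_hess_le hx hz hz
  have bu2 : |fderiv ℝ σ.u x z ^ 2| ≤ σ.gradNorm x * σ.gradNorm x := by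
    rw [sq]; exact abs_mul_le_mul bu bu
  have hB9 : B ≤ B ^ 9 := le_self_pow₀ hB (by norm_num)
  constructor
  · refine (abs_add_le _ _).trans ((add_le_add b1 (abs_mul_le_mul b4 bu)).trans ?_)
    have : B * (1 + σ.gradNorm x) ≤ 100 * B ^ 9 * (1 + σ.gradNorm x) := by
      gcongr; linarith
    linarith
  · have e1 := abs_mul_le_mul b2 bu
    have e2 := abs_mul_le_mul b5 bu2
    have e3 := abs_mul_le_mul b4 bh
    have e4 : B * (2 + 2 * σ.gradNorm x ^ 2 + σ.hessNorm x) ≤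
        100 * B ^ 9 * (1 + σ.gradNorm x ^ 2 + σ.hessNorm x) := by
      calc _ ≤ B * (100 * (1 + σ.gradNorm x ^ 2 + σ.hessNorm x)) := by
            gcongr; nlinarith
        _ ≤ B ^ 9 * (100 * (1 + σ.gradNorm x ^ 2 + σ.hessNorm x)) := by gcongr
        _ = _ := by ring
    have e5 : B * (2 * σ.gradNorm x) ≤ B * (1 + σ.gradNorm x ^ 2) := by
      gcongr; nlinarith [sq_nonneg (σ.gradNorm x - 1)]
    rw [abs_le] at b3 e1 e2 e3 ⊢
    constructor <;>
    linarith only [b3.1, b3.2, e1.1, e1.2, e2.1, e2.2, e3.1, e3.2, e4, e5]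

end Configuration

end Solution

/-! ### The linearized equation and the test function along geodesics -/

section Linearized

variable {n : ℕ} {t r Na Nb NS Ng Ni c : ℝ}

namespace Configuration

variable (σ : Configuration n t r Na Nb NS Ng Ni c)

/-- The sum `∑ F_m V(X_m, X_m)` with constant weights `F_m`, written in terms of the Hessian and the
gradient of the solution. -/
def weightedV (Fv : Fin n → ℝ) (x : Coord n) (X : Fin n → Coord n) : ℝ :=
  ∑ m, ((t - 1) / ((n : ℝ) - 2) * (∑ k, Fv k) - Fv m) * σ.hess x (X m) (X m)
    - ∑ m, (σ.a x * Fv m + σ.b x * ∑ k, Fv k) * fderiv ℝ σ.u x (X m) ^ 2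
    + ∑ m, Fv m * toForm (σ.S x) (X m) (X m)

variable {σ} {x : Coord n} {X : Fin n → Coord n}

theorem sum_mul_toForm_tensorV (hx : x ∈ Metric.ball (0 : Coord n) r) (hX : IsFrame (σ.G x) X)
    (Fv : Fin n → ℝ) :
    ∑ m, Fv m * toForm (tensorV t σ.G σ.a σ.b σ.u σ.S x) (X m) (X m) = σ.weightedV Fv x X := by
  have h : ∀ m, Fv m * toForm (tensorV t σ.G σ.a σ.b σ.u σ.S x) (X m) (X m) =
      Fv m * ((t - 1) / ((n : ℝ) - 2) * ∑ j, σ.hess x (X j) (X j)) - Fv m * σ.hess x (X m) (X m)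
      - σ.a x * Fv m * fderiv ℝ σ.u x (X m) ^ 2
      - Fv m * (σ.b x * ∑ j, fderiv ℝ σ.u x (X j) ^ 2)
      + Fv m * toForm (σ.S x) (X m) (X m) := by
    intro m
    rw [toForm_tensorV hX ((contDiffAt_u hx).of_le (by norm_num)), if_pos rfl]
    ring
  simp only [h, weightedV, Finset.sum_add_distrib, Finset.sum_sub_distrib, ← Finset.sum_mul,
    sub_mul, add_mul, ← Finset.mul_sum]
  ring

theorem tensorV_symm (hx : x ∈ Metric.ball (0 : Coord n) r) (i j : Fin n) :
    tensorV t σ.G σ.a σ.b σ.u σ.S x i j = tensorV t σ.G σ.a σ.b σ.u σ.S x j i := by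
  have h : ∀ k l, toForm (hessian σ.G σ.u x) (EuclideanSpace.single k 1)
      (EuclideanSpace.single l 1) = hessian σ.G σ.u x k l := by
    intro k l
    simp [toForm_apply]
  have hH : hessian σ.G σ.u x i j = hessian σ.G σ.u x j i := by
    rw [← h i j, ← h j i, toForm_hessian_eq hx, toForm_hessian_eq hx, hess_symm hx]
  simp only [tensorV, Matrix.add_apply, Matrix.sub_apply, Matrix.smul_apply, hH,
    σ.symm_G hx i j, σ.symm_S x hx i j, Matrix.vecMulVec_apply, smul_eq_mul]
  ring

/-- The equation diagonalized at a point: in a suitable frame there, with the weights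
`F_m = ∂F/∂λ_m`, the function `∑ F_m V(X_m, X_m) - f` of a point and a frame attains its minimum.
This is the concavity of the equation together with Schur's theorem. -/
theorem exists_weights (hx : x ∈ Metric.ball (0 : Coord n) r) :
    ∃ (E : Fin n → Coord n) (Fv : Fin n → ℝ), IsFrame (σ.G x) E ∧ (∀ m, 0 ≤ Fv m) ∧
      1 ≤ ∑ m, Fv m ∧ ∀ y ∈ Metric.ball (0 : Coord n) r, ∀ X, IsFrame (σ.G y) X →
        σ.weightedV Fv x E - σ.f x (σ.u x) ≤ σ.weightedV Fv y X - σ.f y (σ.u y) := by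
  obtain ⟨lam, hlam, hmem, heq⟩ := σ.equation x hx
  obtain ⟨E, hE, hdiag⟩ := exists_frame_diagonal (σ.posDef x hx) (tensorV_symm hx) hlam
  have hsc := σ.structureConditions
  refine ⟨E, fun m => partialF σ.F m lam, hE, fun m => (hsc.F_monotone lam hmem m).le,
    hsc.one_le_sum_partialF hmem, fun y hy X hX => ?_⟩
  obtain ⟨mu, hmu, hmem', heq'⟩ := σ.equation y hy
  have hle := hsc.le_linearization hmem hmem'
    (A := Matrix.of fun k l => toForm (tensorV t σ.G σ.a σ.b σ.u σ.S y) (X k) (X l))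
    (by ext k l; simp [toForm_symm (tensorV_symm hy) (X l) (X k)])
    (by rw [← hX.charpoly_eq]; exact hmu)
  rw [← sum_mul_toForm_tensorV hx hE, ← sum_mul_toForm_tensorV hy hX, ← heq, ← heq']
  simp only [hdiag, if_true]
  simp only [Matrix.of_apply, mul_sub, Finset.sum_sub_distrib] at hle
  linarith

theorem exists_parallel {ι : Type*} [Fintype ι] (hx : x ∈ Metric.ball (0 : Coord n) r)
    (z : Coord n) (e : ι → Coord n) :
    ∃ (γ : ℝ → Coord n) (X : ι → ℝ → Coord n), Jet2 γ x z (-σ.conn x z z) ∧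
      (∀ i, Jet2 (X i) (e i) (-σ.conn x z (e i)) (parallelSecond σ.conn x z (e i))) ∧
      ∀ᶠ τ in 𝓝 0, γ τ ∈ Metric.ball (0 : Coord n) r ∧
        ∀ i j, toForm (σ.G (γ τ)) (X i τ) (X j τ) = toForm (σ.G x) (e i) (e j) := by
  refine exists_parallel_frame Metric.isOpen_ball (contDiffOn_conn.of_le (by norm_num))
    (g := fun y => toForm (σ.G y)) ?_ ?_ hx z e
  · intro y hy
    exact (contDiffOn_metric.contDiffAt (ball_mem_nhds hy)).differentiableAt (by norm_num)
  · intro y hy z v w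
    refine fderiv_toForm_metric ?_ ((σ.det_ne_zero hy).isUnit) ?_ z v w
    · filter_upwards [ball_mem_nhds hy] with w hw using σ.symm_G hw
    · intro i j
      exact ((σ.contDiffOn_G i j).contDiffAt (ball_mem_nhds hy)).differentiableAt (by norm_num)

variable {B : ℝ}

/-- The linearized equation, differentiated once and twice in a unit direction `z`. -/
theorem exists_linearized (hx : x ∈ Metric.ball (0 : Coord n) r) (hB : 1 ≤ B)
    (hc : σ.CoeffBound B x) {E : Fin n → Coord n} {Fv : Fin n → ℝ} (hE : IsFrame (σ.G x) E)
    (hmin : ∀ y ∈ Metric.ball (0 : Coord n) r, ∀ X, IsFrame (σ.G y) X →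
      σ.weightedV Fv x E - σ.f x (σ.u x) ≤ σ.weightedV Fv y X - σ.f y (σ.u y))
    {z : Coord n} (hz : toForm (σ.G x) z z = 1) :
    ∃ (a1 a2 b1 b2 f1 f2 : ℝ) (S1 S2 : Fin n → ℝ),
      (|a1| ≤ 100 * B ^ 9 ∧ |a2| ≤ 100 * B ^ 9 ∧ |b1| ≤ 100 * B ^ 9 ∧ |b2| ≤ 100 * B ^ 9 ∧
        |f1| ≤ 100 * B ^ 9 * (1 + σ.gradNorm x) ∧
        |f2| ≤ 100 * B ^ 9 * (1 + σ.gradNorm x ^ 2 + σ.hessNorm x) ∧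
        (∀ m, |S1 m| ≤ 100 * B ^ 9) ∧ ∀ m, |S2 m| ≤ 100 * B ^ 9) ∧
      0 = ∑ m, ((t - 1) / ((n : ℝ) - 2) * (∑ k, Fv k) - Fv m) * covThird σ.conn σ.u x z (E m) (E m)
        - ∑ m, ((σ.a x * Fv m + σ.b x * ∑ k, Fv k)
            * (2 * (fderiv ℝ σ.u x (E m) * σ.hess x z (E m)))
          + (a1 * Fv m + b1 * ∑ k, Fv k) * fderiv ℝ σ.u x (E m) ^ 2)
        + ∑ m, Fv m * S1 m - f1 ∧
      0 ≤ ∑ m, ((t - 1) / ((n : ℝ) - 2) * (∑ k, Fv k) - Fv m) * covFourth σ.conn σ.u x z (E m)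
        - ∑ m, ((σ.a x * Fv m + σ.b x * ∑ k, Fv k) * (2 * σ.hess x z (E m) ^ 2
            + 2 * (fderiv ℝ σ.u x (E m) * covThird σ.conn σ.u x z z (E m)))
          + 4 * ((a1 * Fv m + b1 * ∑ k, Fv k) * (fderiv ℝ σ.u x (E m) * σ.hess x z (E m)))
          + (a2 * Fv m + b2 * ∑ k, Fv k) * fderiv ℝ σ.u x (E m) ^ 2)
        + ∑ m, Fv m * S2 m - f2 := by
  have hB0 : 0 ≤ B := by linarith
  obtain ⟨γ, X, hγ, hX, hev⟩ := exists_parallel (σ := σ) hx z E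
  have bz := hc.unit z hz
  have bE : ∀ m, ‖E m‖ ≤ B := fun m => hc.unit _ (by rw [hE, if_pos rfl])
  obtain ⟨a1, a2, ja, ba1, ba2⟩ := exists_jet2_scalar
    (σ.contDiffOn_a.contDiffAt (ball_mem_nhds hx)) hB hc.K0 hc.a1 hc.a2 bz hγ
  obtain ⟨b1, b2, jb, bb1, bb2⟩ := exists_jet2_scalar
    (σ.contDiffOn_b.contDiffAt (ball_mem_nhds hx)) hB hc.K0 hc.b1 hc.b2 bz hγ
  obtain ⟨f1, f2, jf, bf1, bf2⟩ := exists_jet2_f hx hB hc hz hγ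
  have hS := fun m => exists_jet2_form (contDiffOn_form.contDiffAt (ball_mem_nhds hx)) hB hc.K0
    hc.K1 hc.S0 hc.S1 hc.S2 bz (bE m) hγ (hX m)
  choose S1 S2 jS bS1 bS2 using hS
  have p4 : 2 * B ^ 4 ≤ 100 * B ^ 9 := by
    have : B ^ 4 ≤ B ^ 9 := pow_le_pow_right₀ hB (by norm_num)
    have : 0 ≤ B ^ 9 := by positivity
    linarith
  have p7 : 14 * B ^ 7 ≤ 100 * B ^ 9 := by
    have : B ^ 7 ≤ B ^ 9 := pow_le_pow_right₀ hB (by norm_num)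
    have : 0 ≤ B ^ 9 := by positivity
    linarith
  refine ⟨a1, a2, b1, b2, f1, f2, S1, S2, ⟨ba1.trans p4, ba2.trans p4, bb1.trans p4,
    bb2.trans p4, bf1, bf2, fun m => (bS1 m).trans p7, fun m => (bS2 m).trans p7⟩, ?_⟩
  have hu4 := contDiffAt_u (σ := σ) hx
  have jH := fun m => jet2_covHess hu4 (contDiffAt_conn hx) hγ (hX m)
  have ju := fun m => jet2_fderiv_apply (hu4.of_le (by norm_num)) hγ (hX m)
  have j1 := Jet2.sum (s := Finset.univ) fun m _ => (jH m).const_mul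
    ((t - 1) / ((n : ℝ) - 2) * (∑ k, Fv k) - Fv m)
  have j2 := Jet2.sum (s := Finset.univ) fun m _ =>
    ((ja.const_mul (Fv m)).add (jb.const_mul (∑ k, Fv k))).mul ((ju m).mul (ju m))
  have j3 := Jet2.sum (s := Finset.univ) fun m _ => (jS m).const_mul (Fv m)
  have j := ((j1.sub j2).add j3).sub jf
  have hloc : IsLocalMin (fun τ => ∑ m, ((t - 1) / ((n : ℝ) - 2) * (∑ k, Fv k) - Fv m)
        * covHess σ.conn σ.u (γ τ) (X m τ) (X m τ)
      - ∑ m, (Fv m * σ.a (γ τ) + (∑ k, Fv k) * σ.b (γ τ))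
        * (fderiv ℝ σ.u (γ τ) (X m τ) * fderiv ℝ σ.u (γ τ) (X m τ))
      + ∑ m, Fv m * toForm (σ.S (γ τ)) (X m τ) (X m τ) - σ.f (γ τ) (σ.u (γ τ))) 0 := by
    filter_upwards [hev] with τ hτ
    have h := hmin (γ τ) hτ.1 (fun m => X m τ) fun k l => by rw [hτ.2, hE]
    have hX0 : ∀ m, X m 0 = E m := fun m => (hX m).val
    rw [hγ.val]
    simp only [hX0]
    simp only [weightedV, mul_comm (σ.a _), mul_comm (σ.b _), pow_two] at h
    exact h
  obtain ⟨k1, k2⟩ := j.of_isLocalMin hloc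
  constructor
  · rw [← k1]
    congr 3
    exact Finset.sum_congr rfl fun m _ => by ring
  · refine k2.trans (le_of_eq ?_)
    congr 3
    exact Finset.sum_congr rfl fun m _ => by ring

/-- The test function, differentiated once and twice in the direction of the frame vector `E m`. -/
theorem exists_test_function_jet (hx : x ∈ Metric.ball (0 : Coord n) r) (hB : 1 ≤ B)
    (hc : σ.CoeffBound B x) {E : Fin n → Coord n} (hE : IsFrame (σ.G x) E)
    {e : Coord n} (he : toForm (σ.G x) e e = 1) {R α M : ℝ} (hR0 : 0 < R) (hRr : R ≤ r)
    (hxR : ‖x‖ < R)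
    (hmax : ∀ y ∈ Metric.ball (0 : Coord n) r, ‖y‖ < R → ∀ v, toForm (σ.G y) v v = 1 →
      σ.hess y v v + α * σ.gradNorm y ^ 2 ≤ M * ((R ^ 2 - ‖y‖ ^ 2) ^ 2)⁻¹)
    (heq : σ.hess x e e + α * σ.gradNorm x ^ 2 = M * ((R ^ 2 - ‖x‖ ^ 2) ^ 2)⁻¹) (m : Fin n) :
    ∃ q1 q2 : ℝ, (|q1| ≤ 32 * B ^ 6 / (R ^ 2 - ‖x‖ ^ 2) ^ 3 ∧
        |q2| ≤ 32 * B ^ 6 / (R ^ 2 - ‖x‖ ^ 2) ^ 4) ∧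
      covThird σ.conn σ.u x (E m) e e
        + 2 * α * ∑ k, fderiv ℝ σ.u x (E k) * σ.hess x (E m) (E k) - M * q1 = 0 ∧
      covFourth σ.conn σ.u x (E m) e
        + 2 * α * ∑ k, (σ.hess x (E m) (E k) ^ 2
          + fderiv ℝ σ.u x (E k) * covThird σ.conn σ.u x (E m) (E m) (E k)) - M * q2 ≤ 0 := by
  obtain ⟨γ, X, hγ, hX, hev⟩ := exists_parallel (σ := σ) hx (E m)
    (fun i : Option (Fin n) => i.elim e E)
  have hx2 : 0 < R ^ 2 - ‖x‖ ^ 2 := by nlinarith [norm_nonneg x]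
  have hu4 := contDiffAt_u (σ := σ) hx
  obtain ⟨q1, q2, jq, bq1, bq2⟩ := exists_jet2_cutoff hB (hRr.trans hc.r_le) hR0 hc.K0 hx2
    (hc.unit (E m) (by rw [hE, if_pos rfl])) hγ
  have jH := jet2_covHess hu4 (contDiffAt_conn hx) hγ (hX none)
  have ju := fun k => jet2_fderiv_apply (hu4.of_le (by norm_num)) hγ (hX (some k))
  have jp := (Jet2.sum (s := Finset.univ) fun k _ => (ju k).mul (ju k)).const_mul α
  have j := (jH.add jp).sub (jq.const_mul M)
  have hloc : IsLocalMax (fun τ => covHess σ.conn σ.u (γ τ) (X none τ) (X none τ)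
      + α * ∑ k, fderiv ℝ σ.u (γ τ) (X (some k) τ) * fderiv ℝ σ.u (γ τ) (X (some k) τ)
      - M * ((R ^ 2 - ‖γ τ‖ ^ 2) ^ 2)⁻¹) 0 := by
    have hcont : ∀ᶠ τ in 𝓝 (0 : ℝ), ‖γ τ‖ < R := by
      obtain ⟨γ', h1, -⟩ := hγ.exists_deriv
      exact h1.self_of_nhds.continuousAt.norm.eventually_lt_const (by simpa [hγ.val] using hxR)
    filter_upwards [hev, hcont] with τ hτ hτR
    have hfr : IsFrame (σ.G (γ τ)) fun k => X (some k) τ := fun k l => by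
      rw [hτ.2]; exact hE k l
    have h := hmax (γ τ) hτ.1 hτR (X none τ) (by rw [hτ.2]; exact he)
    rw [gradNorm_sq hfr] at h
    rw [gradNorm_sq hE] at heq
    have hX0 : ∀ k, X (some k) 0 = E k := fun k => (hX (some k)).val
    have hXn : X none 0 = e := (hX none).val
    simp only [hγ.val, hX0, hXn]
    simp only [pow_two (fderiv ℝ _ _ _)] at h heq
    linarith
  obtain ⟨k1, k2⟩ := j.of_isLocalMax hloc
  refine ⟨q1, q2, ⟨bq1, bq2⟩, ?_, ?_⟩
  · rw [← k1, mul_assoc, mul_left_comm, Finset.mul_sum]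
    congr 3
    exact Finset.sum_congr rfl fun k _ => by simp only [Option.elim]; ring
  · refine le_trans (le_of_eq ?_) k2
    rw [mul_assoc, mul_left_comm, Finset.mul_sum]
    congr 3
    exact Finset.sum_congr rfl fun k _ => by simp only [Option.elim]; ring

end Configuration

end Linearized

/-! ### The estimate at an interior maximum -/

section Maximum

variable {n : ℕ} {t r Na Nb NS Ng Ni c : ℝ}

namespace Configuration

variable {σ : Configuration n t r Na Nb NS Ng Ni c} {x : Coord n} {X : Fin n → Coord n} {B : ℝ}

set_option maxHeartbeats 800000 in
/-- The differential inequality at a maximum of `(R² - |x|²)² (∇²u(e, e) + α |∇u|²)`, in terms of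
the geometry only. -/
theorem exists_frame_inequality (hs : 1 ≤ (t - 1) / ((n : ℝ) - 2))
    (hx : x ∈ Metric.ball (0 : Coord n) r) (hB : 1 ≤ B)
    (hc : σ.CoeffBound B x) {e : Coord n} (he : toForm (σ.G x) e e = 1) {R α M : ℝ} (hR0 : 0 < R)
    (hRr : R ≤ r) (hxR : ‖x‖ < R) (hα : 0 ≤ α) (hM : 0 ≤ M)
    (hmax : ∀ y ∈ Metric.ball (0 : Coord n) r, ‖y‖ < R → ∀ v, toForm (σ.G y) v v = 1 →
      σ.hess y v v + α * σ.gradNorm y ^ 2 ≤ M * ((R ^ 2 - ‖y‖ ^ 2) ^ 2)⁻¹)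
    (heq : σ.hess x e e + α * σ.gradNorm x ^ 2 = M * ((R ^ 2 - ‖x‖ ^ 2) ^ 2)⁻¹) :
    ∃ (E : Fin n → Coord n) (Fv : Fin n → ℝ), IsFrame (σ.G x) E ∧ (∀ m, 0 ≤ Fv m) ∧
      1 ≤ ∑ m, Fv m ∧
      ∑ m, (σ.a x * Fv m + σ.b x * ∑ k, Fv k) * σ.hess x e (E m) ^ 2
        + α * ∑ m, ((t - 1) / ((n : ℝ) - 2) * (∑ k, Fv k) - Fv m)
          * ∑ k, σ.hess x (E m) (E k) ^ 2 ≤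
      (∑ m, Fv m) * (40 * (n + 1) ^ 2 * ((t - 1) / ((n : ℝ) - 2)) * (1 + α) * (100 * B ^ 9) ^ 2
        * (1 + σ.hessNorm x * σ.gradNorm x + σ.gradNorm x ^ 3 + σ.hessNorm x + σ.gradNorm x ^ 2
          + σ.gradNorm x + M / (R ^ 2 - ‖x‖ ^ 2) ^ 4
          + M * σ.gradNorm x / (R ^ 2 - ‖x‖ ^ 2) ^ 3)) := by
  have hB0 : 0 ≤ B := by linarith
  have hq := gradNorm_nonneg (σ := σ) (x := x)
  have hy := hessNorm_nonneg (σ := σ) (x := x)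
  obtain ⟨E, Fv, hE, hF, hT, hmin⟩ := exists_weights (σ := σ) hx
  refine ⟨E, Fv, hE, hF, hT, ?_⟩
  have hEu : ∀ m, toForm (σ.G x) (E m) (E m) = 1 := fun m => by rw [hE, if_pos rfl]
  obtain ⟨a1, a2, b1, b2, -, f2, -, S2, ⟨ba1, ba2, bb1, bb2, -, bf2, -, bS2⟩, -, hII⟩ :=
    exists_linearized hx hB hc hE hmin he
  have hk := fun k => exists_linearized hx hB hc hE hmin (hEu k)
  choose da _ db _ f1 _ S1 _ bk hIII _ using hk
  have hm := fun m => exists_test_function_jet hx hB hc hE he hR0 hRr hxR hmax heq m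
  choose q1 q2 bq hIV hI using hm
  have hB9 : B ≤ 100 * B ^ 9 := by
    have : B ≤ B ^ 9 := le_self_pow₀ hB (by norm_num)
    linarith
  set s := (t - 1) / ((n : ℝ) - 2) with hsdef
  set T := ∑ m, Fv m with hTdef
  set C : ℝ := 100 * B ^ 9 with hC
  set q := σ.gradNorm x
  set y := σ.hessNorm x
  set ρ := R ^ 2 - ‖x‖ ^ 2 with hρ
  have hρ0 : 0 < ρ := by
    have := norm_nonneg x
    nlinarith
  have hC1 : 1 ≤ C := hB.trans hB9
  have main := maximum_inequality (Fv := Fv) (u := fun m => fderiv ℝ σ.u x (E m))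
    (He := fun m => σ.hess x e (E m)) (D := fun m => covThird σ.conn σ.u x e e (E m))
    (D' := fun m => covThird σ.conn σ.u x (E m) e e) (q1 := q1) (q2 := q2)
    (N := fun m => covFourth σ.conn σ.u x (E m) e)
    (N' := fun m => covFourth σ.conn σ.u x e (E m)) (S2 := S2) (f1 := f1) (da := da) (db := db)
    (H := fun m k => σ.hess x (E m) (E k))
    (A := fun m k => covThird σ.conn σ.u x (E m) (E m) (E k))
    (A' := fun m k => covThird σ.conn σ.u x (E k) (E m) (E m)) (S1 := fun m k => S1 k m)
    (C := C) (y := y) (q := q) (T := T) (a := σ.a x) (b := σ.b x)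
    hF rfl hT hs hα hC1 hy hq (fun m k => hess_symm hx _ _) hI hIV hII hIII
    (fun m => abs_hess_le hx he (hEu m)) (fun m => abs_grad_le hx (hEu m))
    (fun m => abs_covFourth_comm_le hx hB hc (hEu m) he)
    (fun m k => abs_covThird_comm_le hx hB hc (hEu m) (hEu k))
    (fun m => abs_covThird_comm_le hx hB hc he (hEu m))
    (hc.a0.trans hB9) (hc.b0.trans hB9) ba1 bb1 ba2 bb2 (fun k => (bk k).1)
    (fun k => (bk k).2.2.1) (fun m k => (bk k).2.2.2.2.2.2.1 m) bS2
    (fun k => (bk k).2.2.2.2.1) bf2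
  have hFle : ∀ m, Fv m ≤ T := fun m => Finset.single_le_sum (fun i _ => hF i) (Finset.mem_univ m)
  have hT0 : 0 ≤ T := by linarith
  have hs0 : 0 ≤ s := by linarith
  set d : ℝ := 32 * B ^ 6 with hd
  have hd0 : 0 ≤ d := by positivity
  have e1 : ∑ m, (s * T - Fv m) * q2 m ≤ n * (s * T * (d / ρ ^ 4)) := by
    refine (le_abs_self _).trans (abs_sum_le_of_le fun m => abs_mul_le_mul ?_ (bq m).2)
    have : T ≤ s * T := le_mul_of_one_le_left hT0 hs
    exact abs_le.2 ⟨by linarith [hFle m], by linarith [hF m]⟩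
  have e2 : -∑ m, (σ.a x * Fv m + σ.b x * T) * (fderiv ℝ σ.u x (E m) * q1 m) ≤
      n * (2 * B * T * (q * (d / ρ ^ 3))) :=
    (neg_le_abs _).trans (abs_sum_le_of_le fun m => abs_mul_le_mul
      (abs_weight_le hc.a0 hc.b0 (hF m) (hFle m))
      (abs_mul_le_mul (abs_grad_le hx (hEu m)) (bq m).1))
  have g1 := mul_le_mul_of_nonneg_left e1 hM
  have g2 := mul_le_mul_of_nonneg_left e2 hM
  -- both cut-off terms are dominated by the constant of the remainder
  set K := 40 * ((n : ℝ) + 1) ^ 2 * s * (1 + α) * C ^ 2 with hK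
  have hK0 : 0 ≤ K := by positivity
  have hn0 : (0 : ℝ) ≤ n := Nat.cast_nonneg n
  have hdC : d * B ≤ C ^ 2 := by
    have h1 : B ^ 7 ≤ B ^ 18 := pow_le_pow_right₀ hB (by norm_num)
    have h2 : 0 ≤ B ^ 18 := by positivity
    calc d * B = 32 * B ^ 7 := by rw [hd]; ring
      _ ≤ 10000 * B ^ 18 := by linarith
      _ = C ^ 2 := by rw [hC]; ring
  have hKd : 40 * (n * s * (d * B)) ≤ K := by
    have h1 : (n : ℝ) ≤ (n + 1) ^ 2 * (1 + α) := by
      have h2 : 0 ≤ ((n : ℝ) + 1) ^ 2 * α := by positivity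
      have h3 : 0 ≤ (n : ℝ) ^ 2 := by positivity
      linarith only [h2, h3, hn0]
    calc 40 * (n * s * (d * B)) ≤ 40 * (((n + 1) ^ 2 * (1 + α)) * s * C ^ 2) := by gcongr
      _ = K := by rw [hK]; ring
  have hndB : 0 ≤ n * s * (d * B) := by positivity
  have k1 : M * (n * (s * T * (d / ρ ^ 4))) ≤ T * (K * (M / ρ ^ 4)) := by
    have h1 : n * s * d ≤ K := by
      have : n * s * d ≤ n * s * (d * B) := by gcongr; exact le_mul_of_one_le_right hd0 hB
      linarith
    calc _ = T * (n * s * d * (M / ρ ^ 4)) := by ring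
      _ ≤ _ := by gcongr
  have k2 : M * (n * (2 * B * T * (q * (d / ρ ^ 3)))) ≤ T * (K * (M * q / ρ ^ 3)) := by
    have h1 : 2 * n * (d * B) ≤ K := by
      have : n * (d * B) ≤ n * s * (d * B) := by
        gcongr; exact le_mul_of_one_le_right hn0 hs
      linarith
    calc _ = T * (2 * n * (d * B) * (M * q / ρ ^ 3)) := by ring
      _ ≤ _ := by gcongr
  have n1 : 0 ≤ T * (K * (1 + y * q + q ^ 3 + y + q ^ 2 + q)) := by positivity
  have n2 : 0 ≤ T * (K * (M / ρ ^ 4)) := by positivity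
  have n3 : 0 ≤ T * (K * (M * q / ρ ^ 3)) := by positivity
  linarith only [main, g1, g2, k1, k2, n1, n2, n3]

/-- A unit vector at which a symmetric form is maximal on the unit sphere is an eigenvector. -/
theorem apply_eq_of_forall_le {A : Matrix (Fin n) (Fin n) ℝ} (hA : A.PosDef)
    {T : Coord n →L[ℝ] Coord n →L[ℝ] ℝ} (hT : ∀ v w, T v w = T w v) {e : Coord n}
    (he : toForm A e e = 1) (hmax : ∀ v, toForm A v v = 1 → T v v ≤ T e e) (w : Coord n) :
    T e w = T e e * toForm A e w := by
  have hsymm : ∀ i j, A i j = A j i := fun i j => by simpa using hA.isHermitian.apply j i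
  obtain ⟨X, hX⟩ := exists_frame hA
  have hall : ∀ v, T v v ≤ T e e * toForm A v v := by
    intro v
    rcases (hX.toForm_self_nonneg hsymm v).eq_or_lt with h0 | h0
    · have h1 : v = 0 := by
        rw [hX.expansion hsymm v]
        have h2 := hX.sum_sq hsymm v
        rw [← h0, Finset.sum_eq_zero_iff_of_nonneg fun _ _ => sq_nonneg _] at h2
        exact Finset.sum_eq_zero fun k hk => by rw [pow_eq_zero_iff two_ne_zero |>.1 (h2 k hk),
          zero_smul]
      simp [h1]
    · set l := Real.sqrt (toForm A v v) with hl
      have hl0 : 0 < l := Real.sqrt_pos.2 h0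
      have hl2 : l * l = toForm A v v := Real.mul_self_sqrt h0.le
      have h1 := hmax (l⁻¹ • v) (by
        simp only [map_smul, smul_apply, smul_eq_mul, ← hl2]; field_simp)
      simp only [map_smul, smul_apply, smul_eq_mul] at h1
      rw [← hl2]
      calc T v v = l * l * (l⁻¹ * (l⁻¹ * T v v)) := by field_simp
        _ ≤ l * l * T e e := by gcongr
        _ = _ := mul_comm _ _
  set d := T e e * toForm A e w - T e w with hd
  have hquad : ∀ s : ℝ, 0 ≤ (T e e * toForm A w w - T w w) * (s * s) + 2 * d * s + 0 := by
    intro s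
    have h := hall (e + s • w)
    simp only [map_add, map_smul, add_apply, smul_apply, smul_eq_mul, he] at h
    rw [hT w e, toForm_symm hsymm w e] at h
    linarith
  have h := discrim_le_zero hquad
  simp only [discrim] at h
  have : d = 0 := by nlinarith [sq_nonneg d]
  linarith

/-- The Hessian is controlled by an upper bound on its eigenvalues and a lower bound on its
trace. -/
theorem hessNorm_le (hx : x ∈ Metric.ball (0 : Coord n) r) (hX : IsFrame (σ.G x) X) {m d : ℝ}
    (hm : ∀ v, toForm (σ.G x) v v = 1 → σ.hess x v v ≤ m) (hm0 : 0 ≤ m) (hd0 : 0 ≤ d)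
    (hd : -d ≤ ∑ k, σ.hess x (X k) (X k)) :
    σ.hessNorm x ≤ n * ((n + 2) * m + d) := by
  have hdiag : ∀ k, σ.hess x (X k) (X k) ≤ m := fun k => hm _ (by rw [hX, if_pos rfl])
  have hlow : ∀ k, -(n * m + d) ≤ σ.hess x (X k) (X k) := by
    intro k
    have h1 := Finset.single_le_sum (f := fun k => m - σ.hess x (X k) (X k))
      (fun i _ => sub_nonneg.2 (hdiag i)) (Finset.mem_univ k)
    simp only [Finset.sum_sub_distrib, Finset.sum_const, Finset.card_univ, Fintype.card_fin,
      nsmul_eq_mul] at h1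
    linarith
  have hn0 : (0 : ℝ) ≤ n := Nat.cast_nonneg n
  have hnm : 0 ≤ n * m := by positivity
  have hent : ∀ k l, |σ.hess x (X k) (X l)| ≤ (n + 2) * m + d := by
    intro k l
    by_cases hkl : k = l
    · subst hkl
      exact abs_le.2 ⟨by linarith [hlow k], by linarith [hdiag k]⟩
    -- polarization with the unit vectors `(X k ± X l) / √2`
    have hs2 : (Real.sqrt 2)⁻¹ * (Real.sqrt 2)⁻¹ = 1 / 2 := by
      rw [← mul_inv, Real.mul_self_sqrt (by norm_num)]; norm_num
    have key : ∀ ε : ℝ, ε * ε = 1 → (σ.hess x (X k) (X k) + 2 * ε * σ.hess x (X k) (X l)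
        + σ.hess x (X l) (X l)) / 2 ≤ m := by
      intro ε hε
      have h1 := hm ((Real.sqrt 2)⁻¹ • (X k + ε • X l)) (by
        simp only [map_add, map_smul, add_apply, smul_apply, smul_eq_mul, hX k k, hX l l, hX k l,
          hX l k, if_neg hkl, if_neg (Ne.symm hkl), if_true]
        linear_combination (1 + ε * ε) * hs2 + hε / 2)
      rw [← toForm_hessian_eq hx] at h1
      simp only [map_add, map_smul, add_apply, smul_apply, smul_eq_mul, toForm_hessian_eq hx,
        hess_symm hx (X l) (X k)] at h1
      refine le_trans (le_of_eq ?_) h1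
      linear_combination (-(σ.hess x (X k) (X k) + 2 * ε * σ.hess x (X k) (X l)
        + ε * ε * σ.hess x (X l) (X l))) * hs2 - σ.hess x (X l) (X l) / 2 * hε
    have h1 := key 1 (by norm_num)
    have h2 := key (-1) (by norm_num)
    have h3 := hlow k
    have h4 := hlow l
    exact abs_le.2 ⟨by linarith, by linarith⟩
  have hz : 0 ≤ (n + 2) * m + d := by positivity
  refine abs_le_of_sq_le_sq' ?_ (by positivity) |>.2
  rw [hessNorm_sq hx hX]
  calc ∑ k, ∑ l, σ.hess x (X k) (X l) ^ 2 ≤ ∑ _k : Fin n, ∑ _l : Fin n, ((n + 2) * m + d) ^ 2 :=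
        Finset.sum_le_sum fun k _ => Finset.sum_le_sum fun l _ => by
          rw [← sq_abs]; gcongr; exact hent k l
    _ = (n * ((n + 2) * m + d)) ^ 2 := by simp; ring

end Configuration

end Maximum

/-! ### Uniform bounds at an interior maximum -/

section UniformBounds

/-- The pointwise condition on the coefficients `a` and `b` under which the estimate holds: in the
first case the gradient is controlled by the trace of `V` and the top eigenvalue direction has a
good quadratic term; in the second case the gradient is controlled by the smallest eigenvalue of
`V`. -/
def CoefficientCondition (n : ℕ) (s δ a b : ℝ) : Prop :=
  (δ ≤ a + b ∧ δ ≤ a + n * b) ∨ (2 ≤ s ∧ δ ≤ -b - max a 0)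

variable {n : ℕ} {t r Na Nb NS Ng Ni c : ℝ}

namespace Configuration

variable {σ : Configuration n t r Na Nb NS Ng Ni c} {x : Coord n} {X : Fin n → Coord n} {B : ℝ}

theorem exists_frame_eigenvalues (hx : x ∈ Metric.ball (0 : Coord n) r) :
    ∃ (E : Fin n → Coord n) (lam : Fin n → ℝ), IsFrame (σ.G x) E ∧ lam ∈ σ.cone ∧
      σ.F lam = σ.f x (σ.u x) ∧ ∀ k, lam k =
        (t - 1) / ((n : ℝ) - 2) * (∑ j, σ.hess x (E j) (E j)) - σ.hess x (E k) (E k)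
        - σ.a x * fderiv ℝ σ.u x (E k) ^ 2 - σ.b x * σ.gradNorm x ^ 2
        + toForm (σ.S x) (E k) (E k) := by
  obtain ⟨lam, hlam, hmem, heq⟩ := σ.equation x hx
  obtain ⟨E, hE, hdiag⟩ := exists_frame_diagonal (σ.posDef x hx) (tensorV_symm hx) hlam
  refine ⟨E, lam, hE, hmem, heq, fun k => ?_⟩
  have h := hdiag k k
  rw [if_pos rfl, toForm_tensorV hE ((contDiffAt_u hx).of_le (by norm_num)), if_pos rfl] at h
  rw [gradNorm_sq hE, ← h]
  ring

/-- The trace of `V` is positive. -/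
theorem exists_frame_trace_pos (hx : x ∈ Metric.ball (0 : Coord n) r)
    (hc : σ.CoeffBound B x) : ∃ E : Fin n → Coord n, IsFrame (σ.G x) E ∧
      (σ.a x + n * σ.b x) * σ.gradNorm x ^ 2 - n * B ^ 3 ≤
        ((t - 1) / ((n : ℝ) - 2) * n - 1) * ∑ k, σ.hess x (E k) (E k) := by
  obtain ⟨E, lam, hE, hmem, -, hlam⟩ := exists_frame_eigenvalues (σ := σ) hx
  refine ⟨E, hE, ?_⟩
  have h1 := σ.structureConditions.subset_gamma_one hmem 1 le_rfl le_rfl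
  have h2 : sigma 1 lam = ∑ k, lam k := by
    rw [sigma, Finset.powersetCard_one, Finset.sum_map]
    simp
  have h3 : ∑ k, toForm (σ.S x) (E k) (E k) ≤ n * B ^ 3 := by
    calc _ ≤ ∑ _k : Fin n, B ^ 3 := Finset.sum_le_sum fun k _ => ?_
      _ = n * B ^ 3 := by simp
    have hu := hc.unit (E k) (by rw [hE, if_pos rfl])
    have := norm_apply₂_le hc.S0 hu hu
    rw [Real.norm_eq_abs] at this
    linarith [le_abs_self (toForm (σ.S x) (E k) (E k))]
  rw [h2] at h1
  simp only [hlam, Finset.sum_add_distrib, Finset.sum_sub_distrib, ← Finset.mul_sum,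
    ← gradNorm_sq hE, Finset.sum_const, Finset.card_univ, Fintype.card_fin, nsmul_eq_mul] at h1
  linarith

/-- In the first case an upper bound for the Hessian controls the gradient and the full Hessian,
since the trace of `V` is positive. -/
theorem bounds_of_forall_hess_le (hx : x ∈ Metric.ball (0 : Coord n) r) (hB : 1 ≤ B)
    (hn : (2 : ℝ) ≤ n) (hc : σ.CoeffBound B x) (hs : 1 ≤ (t - 1) / ((n : ℝ) - 2)) {δ m : ℝ}
    (hδ0 : 0 ≤ δ) (hδ : δ ≤ σ.a x + n * σ.b x)
    (hm : ∀ v, toForm (σ.G x) v v = 1 → σ.hess x v v ≤ m) (hm0 : 0 ≤ m) :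
    δ * σ.gradNorm x ^ 2 ≤ ((t - 1) / ((n : ℝ) - 2) * n * n + n * B ^ 3) * (m + 1) ∧
      σ.hessNorm x ≤ (n * (n + 2) + n * (n * B ^ 3)) * (m + 1) := by
  obtain ⟨X, hX, htr⟩ := exists_frame_trace_pos hx hc
  set s := (t - 1) / ((n : ℝ) - 2)
  have hB0 : 0 ≤ B := by linarith
  have hs0 : 0 ≤ s := by linarith
  have hsn : 1 ≤ s * n - 1 := by nlinarith
  have htrle : ∑ k, σ.hess x (X k) (X k) ≤ n * m := by
    calc ∑ k, σ.hess x (X k) (X k) ≤ ∑ _k : Fin n, m := Finset.sum_le_sum fun k _ =>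
          hm _ (by rw [hX, if_pos rfl])
      _ = n * m := by simp
  have g1 := mul_le_mul_of_nonneg_right hδ (sq_nonneg (σ.gradNorm x))
  have g2 := mul_le_mul_of_nonneg_left htrle (by linarith : 0 ≤ s * n - 1)
  have g3 : 0 ≤ n * m := by positivity
  have g4 : 0 ≤ n * B ^ 3 * m := by positivity
  have g5 : 0 ≤ s * n * n := by positivity
  have g6 : 0 ≤ n * B ^ 3 := by positivity
  have g7 : 0 ≤ δ * σ.gradNorm x ^ 2 := by positivity
  refine ⟨by linarith only [g1, g2, g3, g4, g5, htr], ?_⟩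
  have hlow : -(n * B ^ 3) ≤ ∑ k, σ.hess x (X k) (X k) := by
    by_contra! hcon
    have g8 := mul_nonneg (sub_nonneg.2 hsn)
      (by linarith : 0 ≤ -∑ k, σ.hess x (X k) (X k))
    linarith only [g8, hcon, g1, htr, g7]
  have h := hessNorm_le hx hX hm hm0 g6 hlow
  have g9 : 0 ≤ n * (n * B ^ 3) * m := by positivity
  have g10 : (0 : ℝ) ≤ n * (n + 2) := by positivity
  linarith only [h, g9, g10]

/-- In the second case the gradient is controlled by the Hessian, since the smallest eigenvalue of
`V` is bounded. -/
theorem gradNorm_sq_le (hx : x ∈ Metric.ball (0 : Coord n) r) (hB : 1 ≤ B)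
    (hc : σ.CoeffBound B x) (hs : 1 ≤ (t - 1) / ((n : ℝ) - 2)) {δ : ℝ}
    (hδ : δ ≤ -σ.b x - max (σ.a x) 0) :
    δ * σ.gradNorm x ^ 2 ≤
      ((t - 1) / ((n : ℝ) - 2) * n + 1) * σ.hessNorm x + B ^ 3 + B + 1 := by
  obtain ⟨E, lam, hE, hmem, hF, hlam⟩ := exists_frame_eigenvalues (σ := σ) hx
  have hEu : ∀ k, toForm (σ.G x) (E k) (E k) = 1 := fun k => by rw [hE, if_pos rfl]
  have hle : ∃ k, lam k < B + 1 := by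
    by_contra! hcon
    have h1 := σ.structureConditions.le_of_forall_le hmem (by linarith) hcon
    have h2 := (σ.jetSize_le x hx).trans hc.c_le
    have h3 : σ.f x (σ.u x) ≤ jetSize σ.G σ.f x (σ.u x) := by
      unfold jetSize tensorNorm
      have := abs_nonneg (deriv (σ.f x) (σ.u x))
      have := abs_nonneg (deriv (deriv (σ.f x)) (σ.u x))
      linarith [Real.sqrt_nonneg
        (covectorNormSq (σ.G x) (differential (fun y => σ.f y (σ.u x)) x)),
        Real.sqrt_nonneg
        (covectorNormSq (σ.G x) (differential (fun y => deriv (σ.f y) (σ.u x)) x)),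
        Real.sqrt_nonneg (((σ.G x)⁻¹ * hessian σ.G (fun y => σ.f y (σ.u x)) x * (σ.G x)⁻¹ *
          (hessian σ.G (fun y => σ.f y (σ.u x)) x).transpose).trace)]
    linarith
  obtain ⟨k, hk⟩ := hle
  rw [hlam] at hk
  have hy := hessNorm_nonneg (σ := σ) (x := x)
  have hH : ∀ j, -σ.hessNorm x ≤ σ.hess x (E j) (E j) := fun j =>
    (abs_le.1 (abs_hess_le hx (hEu j) (hEu j))).1
  have hHk := (abs_le.1 (abs_hess_le (σ := σ) hx (hEu k) (hEu k))).2
  have htr : -(n * σ.hessNorm x) ≤ ∑ j, σ.hess x (E j) (E j) := by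
    calc -(n * σ.hessNorm x) = ∑ _j : Fin n, -σ.hessNorm x := by simp
      _ ≤ _ := Finset.sum_le_sum fun j _ => hH j
  have htr' := mul_le_mul_of_nonneg_left htr (by linarith : 0 ≤ (t - 1) / ((n : ℝ) - 2))
  have hu := hc.unit (E k) (hEu k)
  have hS := norm_apply₂_le hc.S0 hu hu
  rw [Real.norm_eq_abs, abs_le] at hS
  have huk : fderiv ℝ σ.u x (E k) ^ 2 ≤ σ.gradNorm x ^ 2 := by
    rw [← sq_abs]; gcongr; exact abs_grad_le hx (hEu k)
  have ha : σ.a x * fderiv ℝ σ.u x (E k) ^ 2 ≤ max (σ.a x) 0 * σ.gradNorm x ^ 2 :=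
    mul_le_mul (le_max_left _ _) huk (sq_nonneg _) (le_max_right _ _)
  have hδ' := mul_le_mul_of_nonneg_right hδ (sq_nonneg (σ.gradNorm x))
  linarith [hS.1]

end Configuration

/-- The constant in front of the remainder in the inequality at a maximum. -/
def remainderConst (n : ℕ) (s B : ℝ) : ℝ :=
  40 * (n + 1) ^ 2 * s * (1 + (2 * B + 1)) * (100 * B ^ 9) ^ 2

theorem remainder_mono {y q Y lam A : ℝ} (hY : 0 ≤ Y) (hq : 0 ≤ q) (hlam : 0 ≤ lam)
    (hA : 0 ≤ A) (hy : y ≤ lam * (Y + 1)) :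
    1 + y * q + q ^ 3 + y + q ^ 2 + q + A ≤
      (2 * lam + 1) * (1 + Y * q + q ^ 3 + Y + q ^ 2 + q + A) := by
  have h1 := mul_le_mul_of_nonneg_right hy hq
  have h2 : 0 ≤ lam * Y * q := by positivity
  have h3 : 0 ≤ lam * q ^ 3 := by positivity
  have h4 : 0 ≤ lam * Y := by positivity
  have h5 : 0 ≤ lam * q ^ 2 := by positivity
  have h6 : 0 ≤ lam * q := by positivity
  have h7 : 0 ≤ lam * A := by positivity
  have h8 : 0 ≤ Y * q := by positivity
  linarith

namespace Configuration

/-- The maximum of the test function is bounded, uniformly over all configurations. -/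
theorem exists_bound_at_maximum (n : ℕ) (t r Na Nb NS Ng Ni c : ℝ) (hn : 3 ≤ n)
    (hs : 1 ≤ (t - 1) / ((n : ℝ) - 2)) {B δ R : ℝ} (hB : 1 ≤ B) (hδ : 0 < δ) (hR0 : 0 < R)
    (hRr : R ≤ r) : ∃ W : ℝ, ∀ (σ : Configuration n t r Na Nb NS Ng Ni c) (x e : Coord n) (M : ℝ),
      x ∈ Metric.ball (0 : Coord n) r → σ.CoeffBound B x →
      CoefficientCondition n ((t - 1) / ((n : ℝ) - 2)) δ (σ.a x) (σ.b x) →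
      toForm (σ.G x) e e = 1 → ‖x‖ < R → 0 ≤ M →
      (∀ y ∈ Metric.ball (0 : Coord n) r, ‖y‖ < R → ∀ v, toForm (σ.G y) v v = 1 →
        σ.hess y v v + (2 * B + 1) * σ.gradNorm y ^ 2 ≤ M * ((R ^ 2 - ‖y‖ ^ 2) ^ 2)⁻¹) →
      σ.hess x e e + (2 * B + 1) * σ.gradNorm x ^ 2 = M * ((R ^ 2 - ‖x‖ ^ 2) ^ 2)⁻¹ →
      M ≤ W := by
  set s := (t - 1) / ((n : ℝ) - 2) with hsdef
  have hn1 : (1 : ℝ) ≤ n := by exact_mod_cast (by omega : 1 ≤ n)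
  have hn2 : (2 : ℝ) ≤ n := by exact_mod_cast (by omega : 2 ≤ n)
  have hB0 : 0 ≤ B := by linarith
  have hs0 : 0 ≤ s := by linarith
  have hK0 : 0 ≤ remainderConst n s B := by unfold remainderConst; positivity
  have hsn : 1 ≤ s * n - 1 := by nlinarith
  set lam : ℝ := n * (n + 2) + n * (n * B ^ 3) with hlam
  have hlam0 : 0 ≤ lam := by positivity
  set l₁ : ℝ := 1 + (s * n * n + n * B ^ 3) / δ with hl₁
  set l₂ : ℝ := 1 + (s * n + 1 + B ^ 3 + B + 1) / δ with hl₂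
  have hl₁1 : 1 ≤ l₁ := by rw [hl₁]; linarith [show 0 ≤ (s * n * n + n * B ^ 3) / δ by positivity]
  have hl₂1 : 1 ≤ l₂ := by
    rw [hl₂]; linarith [show 0 ≤ (s * n + 1 + B ^ 3 + B + 1) / δ by positivity]
  obtain ⟨W₁, hW₁⟩ := exists_bound_of_quadratic (c := min 1 δ)
    (K := remainderConst n s B * (2 * lam + 1)) (l := l₁) (α := 2 * B + 1) (R := R ^ 2)
    (lt_min one_pos hδ) (by positivity) hl₁1 (by linarith) (by positivity)
  obtain ⟨W₂, hW₂⟩ := exists_bound_of_quadratic (c := 1)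
    (K := remainderConst n s B) (l := l₂) (α := 2 * B + 1) (R := R ^ 2)
    one_pos hK0 hl₂1 (by linarith) (by positivity)
  refine ⟨max W₁ W₂, fun σ x e M hx hc hcond he hxR hM hmax heq => ?_⟩
  have hq := gradNorm_nonneg (σ := σ) (x := x)
  have hy := hessNorm_nonneg (σ := σ) (x := x)
  obtain ⟨E, Fv, hE, hF, hT, hineq⟩ := exists_frame_inequality hs hx hB hc he hR0 hRr hxR
    (by linarith : 0 ≤ 2 * B + 1) hM hmax heq
  rw [← hsdef] at hineq
  have hρ0 : 0 < R ^ 2 - ‖x‖ ^ 2 := by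
    have := norm_nonneg x
    nlinarith
  have hρR : R ^ 2 - ‖x‖ ^ 2 ≤ R ^ 2 := by linarith [sq_nonneg ‖x‖]
  set ρ := R ^ 2 - ‖x‖ ^ 2 with hρ
  set T := ∑ m, Fv m
  have hT0 : 0 < T := by linarith
  set μ := σ.hess x e e with hμ
  have hMeq : M = ρ ^ 2 * (μ + (2 * B + 1) * σ.gradNorm x ^ 2) := by
    rw [heq]; field_simp
  have hmax' : ∀ v, toForm (σ.G x) v v = 1 → σ.hess x v v ≤ μ := fun v hv => by
    have := hmax x hx hxR v hv
    linarith
  have hsymm := σ.symm_G hx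
  have heE : ∑ m, toForm (σ.G x) e (E m) ^ 2 = 1 := by rw [hE.sum_sq hsymm, he]
  have hHe : ∀ m, σ.hess x e (E m) = ∑ k, σ.hess x (E m) (E k) * toForm (σ.G x) e (E k) := by
    intro m
    have := hE.apply_eq_sum hsymm (toForm (hessian σ.G σ.u x) (E m)) e
    simp only [toForm_hessian_eq hx] at this
    rw [hess_symm hx, this]
    exact Finset.sum_congr rfl fun k _ => mul_comm _ _
  set Z := 1 + σ.hessNorm x * σ.gradNorm x + σ.gradNorm x ^ 3 + σ.hessNorm x + σ.gradNorm x ^ 2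
    + σ.gradNorm x + M / ρ ^ 4 + M * σ.gradNorm x / ρ ^ 3 with hZ
  have hA0 : 0 ≤ M / ρ ^ 4 + M * σ.gradNorm x / ρ ^ 3 := by positivity
  rcases hcond with ⟨h1, h2⟩ | ⟨h1, h2⟩
  · obtain ⟨hqle, hyle⟩ := bounds_of_forall_hess_le hx hB hn2 hc hs hδ.le h2
      (fun v hv => (hmax' v hv).trans (le_abs_self μ)) (abs_nonneg μ)
    rw [← hsdef] at hqle
    refine le_max_of_le_left (hW₁ |μ| (σ.gradNorm x) ρ M (abs_nonneg _) hq hρ0 hρR ?_ ?_ ?_)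
    · calc σ.gradNorm x ^ 2 ≤ (s * n * n + n * B ^ 3) / δ * (|μ| + 1) := by
            rw [div_mul_eq_mul_div, le_div_iff₀ hδ]; linarith only [hqle]
        _ ≤ l₁ * (|μ| + 1) := by gcongr; linarith only [hl₁]
        _ ≤ l₁ ^ 2 * (|μ| + 1) := by gcongr; exact le_self_pow₀ hl₁1 (by norm_num)
    · rw [hMeq]; gcongr; exact le_abs_self _
    · rw [← hlam] at hyle
      have hquad := quadratic_ge_top (Fv := Fv) (T := T) (s := s) (α := 2 * B + 1) (a := σ.a x)
        (b := σ.b x) (c := min 1 δ) (μ := μ) hF rfl hs (by linarith) hHe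
        (fun m => apply_eq_of_forall_le (T := toForm (hessian σ.G σ.u x)) (σ.posDef x hx)
          (fun v w => by simp only [toForm_hessian_eq hx]; exact hess_symm hx v w) he
          (fun v hv => by simp only [toForm_hessian_eq hx]; exact hmax' v hv) (E m) |>
          fun h => by simpa only [toForm_hessian_eq hx] using h) heE
        (by
          have g1 := (abs_le.1 hc.b0).1
          have g2 : 2 * B + 1 ≤ (2 * B + 1) * s := le_mul_of_one_le_right (by linarith) hs
          exact (min_le_left _ _).trans (by linarith))
        (by
          have g2 : 0 ≤ (2 * B + 1) * (s - 1) := mul_nonneg (by linarith) (by linarith)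
          exact (min_le_right _ _).trans (by linarith))
      have h5 : T * (min 1 δ * |μ| ^ 2) ≤ T * (remainderConst n s B * Z) := by
        rw [sq_abs]
        exact le_trans (le_of_eq (by ring)) (hquad.trans hineq)
      have h6 := le_of_mul_le_mul_left h5 hT0
      have h7 := mul_le_mul_of_nonneg_left (remainder_mono (abs_nonneg μ) hq hlam0 hA0 hyle) hK0
      linarith only [h6, h7, hZ]
  · refine le_max_of_le_right (hW₂ (σ.hessNorm x) (σ.gradNorm x) ρ M hy hq hρ0 hρR ?_ ?_ ?_)
    · have h3 := gradNorm_sq_le hx hB hc hs h2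
      rw [← hsdef] at h3
      calc σ.gradNorm x ^ 2 ≤ (s * n + 1 + B ^ 3 + B + 1) / δ * (σ.hessNorm x + 1) := by
            rw [div_mul_eq_mul_div, le_div_iff₀ hδ]
            have g1 : 0 ≤ B ^ 3 * σ.hessNorm x := by positivity
            have g2 : 0 ≤ B * σ.hessNorm x := by positivity
            have g3 : 0 ≤ s * n := by positivity
            linarith only [g1, g2, g3, h3, hy]
        _ ≤ l₂ * (σ.hessNorm x + 1) := by gcongr; linarith only [hl₂]
        _ ≤ l₂ ^ 2 * (σ.hessNorm x + 1) := by gcongr; exact le_self_pow₀ hl₂1 (by norm_num)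
    · rw [hMeq]
      gcongr
      exact (le_abs_self _).trans (abs_hess_le hx he he)
    · have hquad := quadratic_ge_full (Fv := Fv) (T := T) (s := s) (α := 2 * B + 1) (a := σ.a x)
        (b := σ.b x) hF rfl h1 hHe heE hc.a0 hc.b0 le_rfl
      rw [← hessNorm_sq hx hE] at hquad
      have h5 : T * σ.hessNorm x ^ 2 ≤ T * (remainderConst n s B * Z) := hquad.trans hineq
      have h6 := le_of_mul_le_mul_left h5 hT0
      rw [hZ] at h6
      linarith only [h6]

end Configuration

end UniformBounds

/-! ### The interior estimate in coordinates -/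

section InteriorCoordinates

variable {n : ℕ} {t r Na Nb NS Ng Ni c : ℝ}

namespace Configuration

variable {σ : Configuration n t r Na Nb NS Ng Ni c}

theorem covectorNormSq_eq_gradNorm_sq {x : Coord n} (hx : x ∈ Metric.ball (0 : Coord n) r) :
    covectorNormSq (σ.G x) (differential σ.u x) = σ.gradNorm x ^ 2 := by
  obtain ⟨X, hX⟩ := exists_frame (σ.posDef x hx)
  rw [gradNorm_sq hX, hX.covectorNormSq_differential]

theorem continuousOn_gradNorm_sq :
    ContinuousOn (fun x => σ.gradNorm x ^ 2) (Metric.ball (0 : Coord n) r) := by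
  have hd : ∀ i, ContinuousOn (fun x => pd i σ.u x) (Metric.ball (0 : Coord n) r) := fun i =>
    (σ.contDiffOn_u.continuousOn_fderiv_of_isOpen Metric.isOpen_ball (by norm_num)).clm_apply
      continuousOn_const
  have hG : ∀ i j, ContinuousOn (fun x => (σ.G x)⁻¹ i j) (Metric.ball (0 : Coord n) r) :=
    fun i j => ((jetBdd_G_inv i j).contDiffOn σ).continuousOn
  refine ContinuousOn.congr (f := fun x => ∑ i, pd i σ.u x * ∑ j, (σ.G x)⁻¹ i j * pd j σ.u x) ?_
    fun x hx => ?_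
  · exact continuousOn_finsetSum _ fun i _ => (hd i).mul
      (continuousOn_finsetSum _ fun j _ => (hG i j).mul (hd j))
  · rw [← covectorNormSq_eq_gradNorm_sq hx]
    rfl

theorem continuousOn_hess : ContinuousOn (fun p : Coord n × Coord n => σ.hess p.1 p.2 p.2)
    (Metric.ball (0 : Coord n) r ×ˢ Set.univ) := by
  have hfst : Set.MapsTo Prod.fst (Metric.ball (0 : Coord n) r ×ˢ (Set.univ : Set (Coord n)))
      (Metric.ball (0 : Coord n) r) := fun p hp => hp.1
  have hu1 : ContDiffOn ℝ 3 (fderiv ℝ σ.u) (Metric.ball (0 : Coord n) r) :=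
    σ.contDiffOn_u.fderiv_of_isOpen Metric.isOpen_ball (by norm_num)
  have h1 := hu1.continuousOn.comp continuousOn_fst hfst
  have h2 := (hu1.continuousOn_fderiv_of_isOpen Metric.isOpen_ball (by norm_num)).comp
    continuousOn_fst hfst
  have h3 := (contDiffOn_conn (σ := σ)).continuousOn.comp continuousOn_fst hfst
  exact ((h2.clm_apply continuousOn_snd).clm_apply continuousOn_snd).sub
    (h1.clm_apply ((h3.clm_apply continuousOn_snd).clm_apply continuousOn_snd))

/-- The interior estimate for `∇²u(v, v) + α |∇u|²`, obtained by maximizing this quantity times a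
cut-off function over the unit tangent vectors. -/
theorem exists_weighted_bound (n : ℕ) (t r Na Nb NS Ng Ni c : ℝ) (hn : 3 ≤ n)
    (hs : 1 ≤ (t - 1) / ((n : ℝ) - 2)) {B δ R : ℝ} (hB : 1 ≤ B) (hδ : 0 < δ) (hR0 : 0 < R)
    (hRr : R < r) : ∃ W : ℝ, 0 ≤ W ∧ ∀ σ : Configuration n t r Na Nb NS Ng Ni c,
      (∀ x ∈ Metric.ball (0 : Coord n) r, σ.CoeffBound B x) →
      (∀ x ∈ Metric.ball (0 : Coord n) r,
        CoefficientCondition n ((t - 1) / ((n : ℝ) - 2)) δ (σ.a x) (σ.b x)) →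
      ∀ x, ‖x‖ < R → ∀ v, toForm (σ.G x) v v = 1 →
        σ.hess x v v + (2 * B + 1) * σ.gradNorm x ^ 2 ≤ W * ((R ^ 2 - ‖x‖ ^ 2) ^ 2)⁻¹ := by
  obtain ⟨W, hW⟩ := exists_bound_at_maximum n t r Na Nb NS Ng Ni c hn hs hB hδ hR0 hRr.le
  refine ⟨max W 0, le_max_right _ _, fun σ hc hcond => ?_⟩
  set α := 2 * B + 1 with hα
  have hsub : Metric.closedBall (0 : Coord n) R ⊆ Metric.ball 0 r :=
    Metric.closedBall_subset_ball hRr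
  have hmem : ∀ {x : Coord n}, ‖x‖ < R → x ∈ Metric.closedBall (0 : Coord n) R := fun h =>
    mem_closedBall_zero_iff.2 h.le
  set 𝒦 : Set (Coord n × Coord n) := (Metric.closedBall 0 R ×ˢ Metric.closedBall 0 B) ∩
    (fun p => toForm (σ.G p.1) p.2 p.2) ⁻¹' {1} with h𝒦
  have hsub2 : Metric.closedBall (0 : Coord n) R ×ˢ Metric.closedBall (0 : Coord n) B ⊆
      Metric.ball (0 : Coord n) r ×ˢ Set.univ := Set.prod_mono hsub (Set.subset_univ _)
  have hcompact : IsCompact 𝒦 := by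
    have hcl : IsClosed 𝒦 := by
      refine ContinuousOn.preimage_isClosed_of_isClosed ?_
        (Metric.isClosed_closedBall.prod Metric.isClosed_closedBall) isClosed_singleton
      exact (((contDiffOn_metric (σ := σ)).continuousOn.comp continuousOn_fst
        fun p hp => hsub hp.1).clm_apply continuousOn_snd).clm_apply continuousOn_snd
    exact ((isCompact_closedBall _ _).prod (isCompact_closedBall _ _)).of_isClosed_subset hcl
      Set.inter_subset_left
  have hmem𝒦 : ∀ x, ‖x‖ < R → ∀ v, toForm (σ.G x) v v = 1 → (x, v) ∈ 𝒦 := fun x hx v hv =>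
    ⟨⟨hmem hx, mem_closedBall_zero_iff.2 ((hc x (hsub (hmem hx))).unit v hv)⟩, hv⟩
  have hne : 𝒦.Nonempty := by
    have h0 : ‖(0 : Coord n)‖ < R := by simpa using hR0
    obtain ⟨X, hX⟩ := exists_frame (σ.posDef 0 (hsub (hmem h0)))
    exact ⟨_, hmem𝒦 0 h0 (X ⟨0, by omega⟩) (by rw [hX, if_pos rfl])⟩
  set Φ : Coord n × Coord n → ℝ := fun p =>
    (R ^ 2 - ‖p.1‖ ^ 2) ^ 2 * (σ.hess p.1 p.2 p.2 + α * σ.gradNorm p.1 ^ 2) with hΦ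
  have hcont : ContinuousOn Φ 𝒦 := by
    have h1 : ContinuousOn (fun p : Coord n × Coord n => (R ^ 2 - ‖p.1‖ ^ 2) ^ 2) 𝒦 := by fun_prop
    refine h1.mul ((continuousOn_hess.mono (Set.inter_subset_left.trans hsub2)).add
      (continuousOn_const.mul ?_))
    exact (continuousOn_gradNorm_sq (σ := σ)).comp continuousOn_fst fun p hp => hsub hp.1.1
  obtain ⟨⟨x₀, e⟩, hx₀, hmax⟩ := hcompact.exists_isMaxOn hne hcont
  have hpos : ∀ {x : Coord n}, ‖x‖ < R → 0 < (R ^ 2 - ‖x‖ ^ 2) ^ 2 := fun {x} h => by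
    have := norm_nonneg x
    have : 0 < R ^ 2 - ‖x‖ ^ 2 := by nlinarith
    positivity
  have hle : ∀ x, ‖x‖ < R → ∀ v, toForm (σ.G x) v v = 1 →
      σ.hess x v v + α * σ.gradNorm x ^ 2 ≤ Φ (x₀, e) * ((R ^ 2 - ‖x‖ ^ 2) ^ 2)⁻¹ := by
    intro x hx v hv
    have h1 : Φ (x, v) ≤ Φ (x₀, e) := hmax (hmem𝒦 x hx v hv)
    rw [← div_eq_mul_inv, le_div_iff₀ (hpos hx), mul_comm]
    exact h1
  have hΦW : Φ (x₀, e) ≤ max W 0 := by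
    rcases le_or_gt (Φ (x₀, e)) 0 with h0 | h0
    · exact h0.trans (le_max_right _ _)
    -- The weight vanishes on the boundary, so a positive maximum is attained in the interior.
    have hx₀R : ‖x₀‖ < R := by
      refine lt_of_le_of_ne (mem_closedBall_zero_iff.1 hx₀.1.1) fun h => ?_
      simp [hΦ, h] at h0
    have hx₀r := hsub (hmem hx₀R)
    refine (hW σ x₀ e _ hx₀r (hc x₀ hx₀r) (hcond x₀ hx₀r) hx₀.2 hx₀R h0.le
      (fun y _ hy => hle y hy) ?_).trans (le_max_left _ _)
    rw [← div_eq_mul_inv, eq_div_iff (hpos hx₀R).ne', mul_comm]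
  intro x hx v hv
  refine (hle x hx v hv).trans ?_
  have := hpos hx
  gcongr

/-- The interior estimate in coordinates, with a constant that is uniform over all
configurations. -/
theorem exists_interior_bound (n : ℕ) (t r Na Nb NS Ng Ni c : ℝ) (hn : 3 ≤ n)
    (hs : 1 ≤ (t - 1) / ((n : ℝ) - 2)) (hr : 0 < r) {δ : ℝ} (hδ : 0 < δ) :
    ∃ C : ℝ, ∀ σ : Configuration n t r Na Nb NS Ng Ni c,
      (∀ x ∈ Metric.ball (0 : Coord n) r,
        CoefficientCondition n ((t - 1) / ((n : ℝ) - 2)) δ (σ.a x) (σ.b x)) →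
      ∀ x ∈ Metric.ball (0 : Coord n) (r / 2),
        tensorNorm (σ.G x) (hessian σ.G σ.u x) + covectorNormSq (σ.G x) (differential σ.u x)
          ≤ C := by
  obtain ⟨B, hB, hc⟩ := exists_coeffBound n t r Na Nb NS Ng Ni c
  have hR0 : 0 < 3 * r / 4 := by positivity
  obtain ⟨W, hW0, hW⟩ := exists_weighted_bound n t r Na Nb NS Ng Ni c hn hs hB hδ hR0
    (by linarith)
  set s := (t - 1) / ((n : ℝ) - 2) with hsdef
  have hB0 : 0 ≤ B := by linarith
  have hs0 : 0 ≤ s := by linarith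
  have hn2 : (2 : ℝ) ≤ n := by exact_mod_cast (by omega : 2 ≤ n)
  have hsn : 1 ≤ s * n - 1 := by nlinarith
  -- `5 / 16 = (3 / 4) ^ 2 - (1 / 2) ^ 2` bounds the weight from below on the ball of radius `r / 2`.
  set m : ℝ := W * ((5 / 16 * r ^ 2) ^ 2)⁻¹ with hm
  have hm0 : 0 ≤ m := by positivity
  set P : ℝ := s * n * n * m + n * B ^ 3 with hP
  have hP0 : 0 ≤ P := by positivity
  refine ⟨n * ((n + 2) * m + ((n + 1) * B * P + n * B ^ 3)) + P, fun σ hcond x hx => ?_⟩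
  have hxr : ‖x‖ < r / 2 := mem_ball_zero_iff.1 hx
  have hxb : x ∈ Metric.ball (0 : Coord n) r := mem_ball_zero_iff.2 (by linarith)
  have hwt : ∀ v, toForm (σ.G x) v v = 1 →
      σ.hess x v v + (2 * B + 1) * σ.gradNorm x ^ 2 ≤ m := by
    intro v hv
    refine (hW σ (hc σ) hcond x (by linarith) v hv).trans ?_
    have h1 : 5 / 16 * r ^ 2 ≤ (3 * r / 4) ^ 2 - ‖x‖ ^ 2 := by nlinarith [norm_nonneg x]
    rw [hm]
    gcongr
  have hp0 : 0 ≤ σ.gradNorm x ^ 2 := sq_nonneg _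
  obtain ⟨X, hX, htr⟩ := exists_frame_trace_pos hxb (hc σ x hxb)
  rw [← hsdef] at htr
  have htrle : ∑ k, σ.hess x (X k) (X k) ≤ n * (m - (2 * B + 1) * σ.gradNorm x ^ 2) := by
    calc ∑ k, σ.hess x (X k) (X k) ≤ ∑ _k : Fin n, (m - (2 * B + 1) * σ.gradNorm x ^ 2) :=
          Finset.sum_le_sum fun k _ => by linarith [hwt (X k) (by rw [hX, if_pos rfl])]
      _ = _ := by simp; ring
  have hab : -((n + 1) * B) ≤ σ.a x + n * σ.b x := by
    have h1 := (abs_le.1 (hc σ x hxb).a0).1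
    have h2 := mul_le_mul_of_nonneg_left (abs_le.1 (hc σ x hxb).b0).1 (by linarith : (0 : ℝ) ≤ n)
    linarith
  have hab' := mul_le_mul_of_nonneg_right hab hp0
  have hp : σ.gradNorm x ^ 2 ≤ P := by
    have h1 := mul_le_mul_of_nonneg_left htrle (by linarith : 0 ≤ s * n - 1)
    have h2 : 0 ≤ (s * n - 1 - 1) * (n * ((2 * B + 1) * σ.gradNorm x ^ 2)) :=
      mul_nonneg (by linarith) (by positivity)
    have h3 : 0 ≤ (n - 1) * (B * σ.gradNorm x ^ 2) := mul_nonneg (by linarith) (by positivity)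
    have h4 : 0 ≤ (n - 1) * σ.gradNorm x ^ 2 := mul_nonneg (by linarith) hp0
    have h5 : 0 ≤ n * m := by positivity
    linarith only [h1, h2, h3, h4, h5, hab', htr, hP]
  have hlow : -((n + 1) * B * P + n * B ^ 3) ≤ ∑ k, σ.hess x (X k) (X k) := by
    have h1 : (n + 1) * B * σ.gradNorm x ^ 2 ≤ (n + 1) * B * P := by gcongr
    have h2 : 0 ≤ (n + 1) * B * P + n * B ^ 3 := by positivity
    by_contra! hcon
    have h3 := mul_nonneg (by linarith : 0 ≤ s * n - 1 - 1)
      (by linarith : 0 ≤ -∑ k, σ.hess x (X k) (X k))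
    linarith only [h1, h3, hcon, htr, hab']
  have hH := hessNorm_le hxb hX (m := m) (fun v hv => by
    have h1 := hwt v hv
    have h2 : 0 ≤ (2 * B + 1) * σ.gradNorm x ^ 2 := by positivity
    linarith only [h1, h2]) hm0 (by positivity) hlow
  rw [covectorNormSq_eq_gradNorm_sq hxb]
  exact add_le_add hH hp

end Configuration

/-- The sign conditions of the two cases imply the condition on the coefficients. -/
theorem coefficientCondition_of_min {s δ₁ δ₂ a b : ℝ} (hn : (1 : ℝ) ≤ n) (hs : 1 ≤ s)
    (hδ₁ : 0 < δ₁) (hδ₂ : 0 < δ₂) (h1 : δ₁ ≤ s * a + b) (h2 : δ₂ ≤ min (2 * a * b + b ^ 2) (b ^ 2))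
        :
    CoefficientCondition n s (Real.sqrt δ₂ / 2) a b := by
  obtain ⟨h3, h4⟩ := le_min_iff.1 h2
  have hd0 : 0 < Real.sqrt δ₂ := Real.sqrt_pos.2 hδ₂
  have hd2 : Real.sqrt δ₂ ^ 2 = δ₂ := Real.sq_sqrt hδ₂.le
  set d := Real.sqrt δ₂
  have hdb : d ≤ |b| := Real.sqrt_le_iff.2 ⟨abs_nonneg b, by rwa [sq_abs]⟩
  rcases lt_or_ge b 0 with hb | hb
  · -- here `b < 0`, so `a > 0`, `2 a < |b|` and hence `s > 2`
    rw [abs_of_neg hb] at hdb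
    have ha : 0 < a := by nlinarith
    have hab : 2 * a + b < 0 := by
      by_contra! h
      nlinarith
    right
    refine ⟨by nlinarith, ?_⟩
    rw [max_eq_left ha.le]
    linarith
  · rw [abs_of_nonneg hb] at hdb
    have hb0 : 0 < b := by linarith
    have hab : 0 < 2 * a + b := by
      by_contra! h
      nlinarith
    left
    exact ⟨by linarith, by nlinarith⟩

theorem coefficientCondition_of_nonneg {s δ a b : ℝ} (hn : (1 : ℝ) ≤ n) (ha : 0 ≤ a)
    (h : δ ≤ a + n * b) (hδ : 0 < δ) : CoefficientCondition n s (δ / n) a b := by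
  have hn0 : (0 : ℝ) < n := by linarith
  left
  constructor
  · rw [div_le_iff₀ hn0]
    nlinarith
  · exact (div_le_self hδ.le hn).trans h

end InteriorCoordinates

/-! ### Solutions on a geodesic ball in coordinates -/

section Geodesic

variable {n : ℕ} {M : Type*} [TopologicalSpace M] [ChartedSpace (EuclideanSpace ℝ (Fin n)) M]
  [IsManifold (𝓡 n) ∞ M] {ψ : OpenPartialHomeomorph M (EuclideanSpace ℝ (Fin n))}

/-- The coordinate vector fields are smooth. -/
theorem contMDiffOn_coordinate_field (hψ : ψ ∈ IsManifold.maximalAtlas (𝓡 n) ∞ M) (v : Coord n) :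
    ContMDiffOn (𝓡 n) (𝓡 n).tangent 3 (fun x => (⟨ψ.symm x,
      mfderiv (𝓡 n) (𝓡 n) ψ.symm x v⟩ : TangentBundle (𝓡 n) M)) ψ.target := by
  have h1 : ContMDiffOn (𝓡 n) (𝓡 n) 4 ψ.symm ψ.target :=
    (contMDiffOn_symm_of_mem_maximalAtlas hψ).of_le (by exact_mod_cast ENat.LEInfty.out)
  have h2 := h1.contMDiffOn_tangentMapWithin (m := 3) (by norm_num)
    ψ.open_target.uniqueMDiffOn
  have h3 : ContMDiffOn (𝓡 n) (𝓡 n).tangent 3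
      (fun x => (⟨x, v⟩ : TangentBundle (𝓡 n) (Coord n))) ψ.target :=
    contMDiffOn_vectorSpace_iff_contDiffOn.2 contDiffOn_const
  refine (h2.comp h3 fun x hx => hx).congr fun x hx => ?_
  simp only [Function.comp, tangentMapWithin, mfderivWithin_of_isOpen ψ.open_target hx]

theorem contDiffOn_components (g : RiemMetric n M)
    (hψ : ψ ∈ IsManifold.maximalAtlas (𝓡 n) ∞ M) (i j : Fin n) :
    ContDiffOn ℝ 3 (fun x => components ψ g.inner x i j) ψ.target := by
  have h1 : ContMDiffOn (𝓡 n) (𝓡 n) 3 ψ.symm ψ.target :=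
    (contMDiffOn_symm_of_mem_maximalAtlas hψ).of_le (by exact_mod_cast ENat.LEInfty.out)
  have hg : ContMDiff (𝓡 n) ((𝓡 n).prod 𝓘(ℝ, Coord n →L[ℝ] Coord n →L[ℝ] ℝ)) 3
      (fun b => Bundle.TotalSpace.mk' (Coord n →L[ℝ] Coord n →L[ℝ] ℝ) b (g.inner b)) :=
    g.contMDiff.of_le (by exact_mod_cast ENat.LEInfty.out)
  have h : ContMDiffOn (𝓡 n) ((𝓡 n).prod 𝓘(ℝ)) 3
      (fun x => Bundle.TotalSpace.mk' ℝ (E := Bundle.Trivial M ℝ) (ψ.symm x)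
        (g.inner (ψ.symm x)
          (mfderiv (𝓡 n) (𝓡 n) ψ.symm x (EuclideanSpace.single i (1 : ℝ)))
          (mfderiv (𝓡 n) (𝓡 n) ψ.symm x (EuclideanSpace.single j (1 : ℝ))))) ψ.target := by
    apply ContMDiffOn.clm_bundle_apply₂ (F₁ := Coord n) (F₂ := Coord n)
    · exact hg.comp_contMDiffOn h1
    · exact contMDiffOn_coordinate_field hψ _
    · exact contMDiffOn_coordinate_field hψ _
  intro x hx
  have h2 := h x hx
  simp only [Bundle.contMDiffWithinAt_totalSpace] at h2
  exact h2.2.contDiffWithinAt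

theorem posDef_components (g : RiemMetric n M) (hψ : ψ ∈ IsManifold.maximalAtlas (𝓡 n) ∞ M)
    {x : Coord n} (hx : x ∈ ψ.target) : (components ψ g.inner x).PosDef := by
  set L := mfderiv (𝓡 n) (𝓡 n) ψ.symm x with hL
  have hψ1 : ψ ∈ IsManifold.maximalAtlas (𝓡 n) 1 M :=
    IsManifold.maximalAtlas_subset_of_le ENat.LEInfty.out hψ
  have hinj : ∀ v : Coord n, L v = 0 → v = 0 := by
    intro v hv
    have h1 : MDifferentiableAt (𝓡 n) (𝓡 n) ψ.symm x :=
      mdifferentiableAt_symm_of_mem_maximalAtlas hψ1 hx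
    have h2 : MDifferentiableAt (𝓡 n) (𝓡 n) ψ (ψ.symm x) :=
      mdifferentiableAt_of_mem_maximalAtlas hψ1 (ψ.map_target hx)
    have h3 := mfderiv_comp x h2 h1
    have h4 : mfderiv (𝓡 n) (𝓡 n) (ψ ∘ ψ.symm) x = ContinuousLinearMap.id ℝ _ := by
      rw [← mfderiv_id]
      refine Filter.EventuallyEq.mfderiv_eq ?_
      filter_upwards [ψ.open_target.mem_nhds hx] with y hy using ψ.right_inv hy
    rw [h4] at h3
    have h5 : v = mfderiv (𝓡 n) (𝓡 n) ψ (ψ.symm x) (L v) := congrArg (fun A => A v) h3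
    rw [h5, hv, map_zero]
    rfl
  refine Matrix.PosDef.of_dotProduct_mulVec_pos ?_ fun v hv => ?_
  · exact Matrix.IsHermitian.ext fun i j => g.symm _ _ _
  · set w : Coord n := WithLp.toLp 2 v with hw
    have hsum : w = ∑ i, v i • EuclideanSpace.single i (1 : ℝ) := sum_single_smul w
    have hbilin : ∀ (Q : Coord n →L[ℝ] Coord n →L[ℝ] ℝ) (L : Coord n →L[ℝ] Coord n),
        Q (L (∑ i, v i • EuclideanSpace.single i (1 : ℝ)))
          (L (∑ i, v i • EuclideanSpace.single i (1 : ℝ))) =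
        star v ⬝ᵥ (Matrix.of fun i j => Q (L (EuclideanSpace.single i (1 : ℝ)))
          (L (EuclideanSpace.single j (1 : ℝ)))).mulVec v := by
      intro Q L
      simp only [map_sum, map_smul, sum_apply, smul_apply, smul_eq_mul, dotProduct, Matrix.mulVec,
        Matrix.of_apply, Pi.star_apply, star_trivial, Finset.mul_sum]
      rw [Finset.sum_comm]
      exact Finset.sum_congr rfl fun i _ => Finset.sum_congr rfl fun j _ => by ring
    have h1 : star v ⬝ᵥ (components ψ g.inner x).mulVec v = g.inner (ψ.symm x) (L w) (L w) := by
      rw [hsum]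
      exact (hbilin (g.inner (ψ.symm x)) L).symm
    rw [h1]
    refine g.pos _ _ fun h0 => hv ?_
    have := hinj w h0
    simpa [hw] using this

variable {t r Λ Na Nb NS Ng Ni c : ℝ} {Γ : Set (Fin n → ℝ)} {F : (Fin n → ℝ) → ℝ}
  {g : RiemMetric n M} {a b u : M → ℝ} {S : BilinField n M} {f : M → ℝ → ℝ}

/-- A solution on a geodesic ball, written in its coordinates. -/
def IsSolution.configuration (h : IsSolution t r Λ Na Nb NS Ng Ni c Γ F g ψ a b u S f) :
    Configuration n t r Na Nb NS Ng Ni c :=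
  have hψ := h.geodesicBall.mem_atlas
  have hsub := h.geodesicBall.ball_subset
  have hmaps : Set.MapsTo ψ.symm (Metric.ball 0 r) (coordBall ψ r) := Set.mapsTo_image _ _
  have hsmooth : ∀ {k : WithTop ℕ∞}, k ≤ ∞ →
      ContMDiffOn (𝓡 n) (𝓡 n) k ψ.symm (Metric.ball 0 r) := fun hk =>
    ((contMDiffOn_symm_of_mem_maximalAtlas hψ).of_le hk).mono hsub
  { cone := Γ
    F := F
    G := components ψ g.inner
    a := a ∘ ψ.symm
    b := b ∘ ψ.symm
    u := u ∘ ψ.symm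
    S := components ψ S
    f := fun x z => f (ψ.symm x) z
    structureConditions := h.structureConditions
    contDiffOn_G := fun i j => (contDiffOn_components g hψ i j).mono hsub
    posDef := fun x hx => posDef_components g hψ (hsub hx)
    contDiffOn_a := ((h.a_smooth.of_le (by exact_mod_cast ENat.LEInfty.out)).comp
      (hsmooth (by exact_mod_cast ENat.LEInfty.out)) hmaps).contDiffOn
    contDiffOn_b := ((h.b_smooth.of_le (by exact_mod_cast ENat.LEInfty.out)).comp
      (hsmooth (by exact_mod_cast ENat.LEInfty.out)) hmaps).contDiffOn
    contDiffOn_S := h.S_contDiff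
    symm_S := fun x hx i j => h.S_symm _ (hmaps hx) _ _
    contDiffOn_f := by
      have h1 : ContMDiffOn ((𝓡 n).prod 𝓘(ℝ, ℝ)) ((𝓡 n).prod 𝓘(ℝ, ℝ)) 2
          (fun p : Coord n × ℝ => (ψ.symm p.1, p.2)) (Metric.ball 0 r ×ˢ Set.univ) :=
        ((hsmooth (by exact_mod_cast ENat.LEInfty.out)).comp contMDiffOn_fst fun p hp =>
            hp.1).prodMk
          contMDiffOn_snd
      have h2 := h.f_contMDiff.comp h1 fun p hp => ⟨hmaps hp.1, trivial⟩
      rw [← modelWithCornersSelf_prod, chartedSpaceSelf_prod] at h2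
      exact h2.contDiffOn
    contDiffOn_u := (h.u_contMDiff.comp (hsmooth (by exact_mod_cast ENat.LEInfty.out))
        hmaps).contDiffOn
    f_pos := fun x hx z => h.f_pos _ (hmaps hx) z
    equation := h.equation
    a_bound := h.a_bound
    b_bound := h.b_bound
    S_bound := h.S_bound
    G_bound := h.g_bound
    G_inv_bound := h.g_inv_bound
    jetSize_le := h.c_sup_bound }

end Geodesic

end InteriorEstimate

end

theorem theorem4 (n : ℕ) (hn : 3 ≤ n) (t : ℝ) (ht : (n : ℝ) - 1 ≤ t)
    (r Λ Na Nb NS Ng Ni c : ℝ) (hr : 0 < r) (hΛ : 0 < Λ) :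
    (∀ δ₁ δ₂ : ℝ, 0 < δ₁ → 0 < δ₂ → ∃ C : ℝ,
      ∀ (Γ : Set (Fin n → ℝ)) (F : (Fin n → ℝ) → ℝ)
        (M : Type*) [TopologicalSpace M] [T2Space M]
        [ChartedSpace (EuclideanSpace ℝ (Fin n)) M] [IsManifold (𝓡 n) ∞ M]
        (g : InteriorEstimate.RiemMetric n M)
        (ψ : OpenPartialHomeomorph M (EuclideanSpace ℝ (Fin n)))
        (a b u : M → ℝ) (S : InteriorEstimate.BilinField n M) (f : M → ℝ → ℝ),
        InteriorEstimate.IsSolution t r Λ Na Nb NS Ng Ni c Γ F g ψ a b u S f →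
        Γ ⊆ InteriorEstimate.gammaCone n 2 →
        (∀ q ∈ InteriorEstimate.coordBall ψ r,
          δ₁ ≤ (t - 1) / ((n : ℝ) - 2) * a q + b q) →
        (∀ q ∈ InteriorEstimate.coordBall ψ r,
          δ₂ ≤ min (2 * a q * b q + b q ^ 2) (b q ^ 2)) →
        InteriorEstimate.InteriorBound r C g ψ u) ∧
    (∀ δ₃ : ℝ, 0 < δ₃ → ∃ C : ℝ,
      ∀ (Γ : Set (Fin n → ℝ)) (F : (Fin n → ℝ) → ℝ)
        (M : Type*) [TopologicalSpace M] [T2Space M]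
        [ChartedSpace (EuclideanSpace ℝ (Fin n)) M] [IsManifold (𝓡 n) ∞ M]
        (g : InteriorEstimate.RiemMetric n M)
        (ψ : OpenPartialHomeomorph M (EuclideanSpace ℝ (Fin n)))
        (a b u : M → ℝ) (S : InteriorEstimate.BilinField n M) (f : M → ℝ → ℝ),
        InteriorEstimate.IsSolution t r Λ Na Nb NS Ng Ni c Γ F g ψ a b u S f →
        (∀ q ∈ InteriorEstimate.coordBall ψ r, δ₃ ≤ a q + n * b q) →
        (∀ q ∈ InteriorEstimate.coordBall ψ r, 0 ≤ a q) →
        InteriorEstimate.InteriorBound r C g ψ u) := by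
  have hn3 : (3 : ℝ) ≤ n := by exact_mod_cast hn
  have hn1 : (1 : ℝ) ≤ n := by linarith
  have hs : 1 ≤ (t - 1) / ((n : ℝ) - 2) := by
    rw [le_div_iff₀ (by linarith)]
    linarith
  constructor
  · intro δ₁ δ₂ hδ₁ hδ₂
    obtain ⟨C, hC⟩ := InteriorEstimate.Configuration.exists_interior_bound n t r Na Nb NS Ng Ni c
      hn hs hr (δ := Real.sqrt δ₂ / 2) (half_pos (Real.sqrt_pos.2 hδ₂))
    refine ⟨C, fun Γ F M _ _ _ _ g ψ a b u S f h _ h1 h2 => ?_⟩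
    exact hC h.configuration fun x hx => InteriorEstimate.coefficientCondition_of_min hn1 hs hδ₁ hδ₂
      (h1 _ (Set.mem_image_of_mem _ hx)) (h2 _ (Set.mem_image_of_mem _ hx))
  · intro δ₃ hδ₃
    obtain ⟨C, hC⟩ := InteriorEstimate.Configuration.exists_interior_bound n t r Na Nb NS Ng Ni c
      hn hs hr (δ := δ₃ / n) (div_pos hδ₃ (by linarith))
    refine ⟨C, fun Γ F M _ _ _ _ g ψ a b u S f h h1 h2 => ?_⟩
    exact hC h.configuration fun x hx => InteriorEstimate.coefficientCondition_of_nonneg hn1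
      (h2 _ (Set.mem_image_of_mem _ hx)) (h1 _ (Set.mem_image_of_mem _ hx)) hδ₃
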